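/- Let $n$ be a positive integer and let $\tilde S_n$ be the group of bijections $\pi:\mathbb{Z}\to\mathbb{Z}$ with $\pi(i+n)=\pi(i)+n$ for all $i$ and $\pi(1)+\dots+\pi(n)=1+\dots+n$. For $i\in\mathbb{Z}$ (and $n\ge 2$) let $s_i\in\tilde S_n$ interchange $i$ and $i+1$ and fix all integers outside $\{i,i+1\}+n\mathbb{Z}$ (for $n=1$ the group is trivial); let $\ell$ be the length function with respect to these generators. Let $\pi\mapsto\pi^{\circlearrowright}$ and $\pi\mapsto\pi^*$ be the automorphisms of $\tilde S_n$ with $s_i\mapsto s_{i+1}$ and $s_i\mapsto s_{n-i}$, respectively. An element of $\tilde S_n$ is cyclically decreasing if it has a reduced expression $s_{i_1}\cdots s_{i_l}$ with $s_{i_j+1}\ne s_{i_k}$ for all $j<k$. The affine Stanley symmetric function of $\pi\in\tilde S_n$ is $$F_\pi=\sum_{\pi=\pi^1\pi^2\cdots}x_1^{\ell(\pi^1)}x_2^{\ell(\pi^2)}\cdots,$$ the sum being over the factorizations of $\pi$ into countably many (all but finitely many trivial) cyclically decreasing factors with $\ell(\pi)=\sum_i\ell(\pi^i)$. Let $\circ$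 be the unique associative product on $\tilde S_n$ with $s_i\circ s_i=s_i$ and $\pi'\circ\pi''=\pi'\pi''$ whenever $\ell(\pi'\pi'')=\ell(\pi')+\ell(\pi'')$. For $z\in\tilde I_n:=\{z\in\tilde S_n: z=z^{-1}\}$ let $\mathcal{A}(z)$ be the (finite) set of elements of minimal length in $\{\pi\in\tilde S_n:\pi^{-1}\circ\pi=z\}$, and put $\hat F_z=\sum_{\pi\in\mathcal{A}(z)}F_\pi$. Let $\mathsf{Par}^n$ be the set of partitions with all parts less than $n$, and let $\mathsf{Sym}^{(n)}$ be the $\mathbb{Q}$-span of the monomial symmetric functions $m_\lambda$ with $\lambda\in\mathsf{Par}^n$. The shape $\lambda(\pi)$ of $\pi$ is the transpose of the partition obtained by sorting the numbers $c_i=\#\{j>i:\pi^{-1}(i)>\pi^{-1}(j)\}$, $1\le i\le n$. For $\lambda\in\mathsf{Par}^n$ let $\pi_\lambda$ be the unique element of shape $\lambda$ with $\pi_\lambda^{-1}(1)<\dots<\pi_\lambda^{-1}(n)$, and put $F_\lambda=F_{\pi_\lambda}$ and $\lambda^*=\lambda(\pi_\lambda^*)$. Then, for all $z\in\tilde I_n$,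 one has $\hat F_{z^{\circlearrowright}}=\hat F_z$. Moreover, there is a unique linear involution $\omega^+$ of $\mathsf{Sym}^{(n)}$ with $\omega^+(F_\lambda)=F_{\lambda^*}$ for all $\lambda\in\mathsf{Par}^n$, and for all $z\in\tilde I_n$ one has $\hat F_z\in\mathsf{Sym}^{(n)}$ and $\hat F_{z^*}=\omega^+(\hat F_z)$. -/

import Mathlib

namespace AffineStanley

open Finset

/-! ### The affine symmetric group -/

/-- Reindexing a sum of an `n`-periodic function over a window by a map that is injective mod `n`. -/
theorem sum_window_comp {n : ℕ} (f g : ℤ → ℤ) (hf : ∀ k, f (k + n) = f k)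
    (hg : ∀ i j, (n : ℤ) ∣ g i - g j → (n : ℤ) ∣ i - j) :
    ∑ i ∈ Icc (1 : ℤ) n, f (g i) = ∑ i ∈ Icc (1 : ℤ) n, f i := by
  rcases Nat.eq_zero_or_pos n with rfl | hn
  · simp
  have hn' : (0 : ℤ) < n := by exact_mod_cast hn
  have hper : Function.Periodic f (n : ℤ) := hf
  have hmem : ∀ i : ℤ, (g i - 1) % n + 1 ∈ Icc (1 : ℤ) n := by
    intro i
    have h1 := Int.emod_nonneg (g i - 1) hn'.ne'
    have h2 := Int.emod_lt_of_pos (g i - 1) hn'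
    rw [Finset.mem_Icc]; omega
  have hinj : Set.InjOn (fun i : ℤ => (g i - 1) % n + 1) (Icc (1 : ℤ) n : Finset ℤ) := by
    intro i hi j hj hij
    have h1 : (g i - 1) % n = (g j - 1) % n := by simpa using hij
    have h2 : (n : ℤ) ∣ g i - g j := by
      have := Int.ModEq.dvd (show (g j - 1) ≡ (g i - 1) [ZMOD n] from h1.symm)
      simpa using this
    obtain ⟨c, hc⟩ := hg i j h2
    rw [Finset.mem_coe, Finset.mem_Icc] at hi hj
    have : c = 0 := by
      by_contra hc0
      rcases lt_or_gt_of_ne hc0 with h | h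
      · have : (n : ℤ) * c ≤ n * (-1) := mul_le_mul_of_nonneg_left (by omega) hn'.le
        omega
      · have : (n : ℤ) * 1 ≤ n * c := mul_le_mul_of_nonneg_left (by omega) hn'.le
        omega
    subst this; omega
  refine Finset.sum_nbij (fun i : ℤ => (g i - 1) % n + 1) (fun i _ => hmem i) hinj
    (Finset.surjOn_of_injOn_of_card_le _ (fun i _ => hmem i) hinj le_rfl) ?_
  intro i _
  have : (g i - 1) % n + 1 = g i - ((g i - 1) / n) • (n : ℤ) := by
    have := Int.emod_add_mul_ediv (g i - 1) n
    rw [smul_eq_mul, mul_comm]; linarith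
  rw [this, hper.sub_zsmul_eq]

/-- The defining condition of an affine permutation. -/
def IsAffine (n : ℕ) (π : Equiv.Perm ℤ) : Prop :=
  (∀ i, π (i + n) = π i + n) ∧ ∑ i ∈ Icc (1 : ℤ) n, π i = ∑ i ∈ Icc (1 : ℤ) n, i

theorem IsAffine.add_mul {n : ℕ} {π : Equiv.Perm ℤ} (h : ∀ i, π (i + n) = π i + n) (i c : ℤ) :
    π (i + n * c) = π i + n * c := by
  have h1 : Function.Periodic (fun k => π k - k) (n : ℤ) := by
    intro k; simp only [h]; ring
  have h2 : π (i + c • (n : ℤ)) - (i + c • (n : ℤ)) = π i - i := (h1.zsmul c) i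
  rw [show i + c • (n : ℤ) = i + n * c by rw [smul_eq_mul]; ring] at h2
  linarith

theorem IsAffine.dvd {n : ℕ} {π : Equiv.Perm ℤ} (h : ∀ i, π (i + n) = π i + n) (i j : ℤ)
    (hd : (n : ℤ) ∣ π i - π j) : (n : ℤ) ∣ i - j := by
  obtain ⟨c, hc⟩ := hd
  have h2 : π i = π (j + n * c) := by rw [IsAffine.add_mul h]; linarith
  exact ⟨c, by linarith [π.injective h2]⟩

theorem IsAffine.mul {n : ℕ} {π σ : Equiv.Perm ℤ} (hπ : IsAffine n π) (hσ : IsAffine n σ) :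
    IsAffine n (π * σ) := by
  refine ⟨fun i => by simp [hσ.1, hπ.1], ?_⟩
  have h := sum_window_comp (n := n) (fun k => π k - k) σ (fun k => by simp only [hπ.1]; ring)
    (IsAffine.dvd hσ.1)
  simp only [Finset.sum_sub_distrib] at h
  simp only [Equiv.Perm.mul_apply]
  linarith [hπ.2, hσ.2]

theorem IsAffine.inv {n : ℕ} {π : Equiv.Perm ℤ} (hπ : IsAffine n π) : IsAffine n π⁻¹ := by
  have h1 : ∀ i, π⁻¹ (i + n) = π⁻¹ i + n := fun i => by
    rw [Equiv.Perm.inv_eq_iff_eq, hπ.1]; simp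
  refine ⟨h1, ?_⟩
  have h := sum_window_comp (n := n) (fun k => π k - k) (π⁻¹ : Equiv.Perm ℤ)
    (fun k => by simp only [hπ.1]; ring) (IsAffine.dvd h1)
  have h3 : ∀ x, π (π⁻¹ x) = x := fun x => π.apply_symm_apply x
  simp only [Finset.sum_sub_distrib, h3] at h
  linarith [hπ.2]

/-- The affine symmetric group: bijections `π : ℤ → ℤ` with `π (i + n) = π i + n` and
`π 1 + ⋯ + π n = 1 + ⋯ + n`. -/
def AffineSymmetricGroup (n : ℕ) : Subgroup (Equiv.Perm ℤ) where
  carrier := {π | IsAffine n π}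
  mul_mem' := fun h₁ h₂ => IsAffine.mul h₁ h₂
  one_mem' := ⟨fun _ => rfl, rfl⟩
  inv_mem' := fun h => IsAffine.inv h

/-- The underlying map of the simple reflection `s_i`. -/
def simpleFun (n : ℕ) (i k : ℤ) : ℤ :=
  if (n : ℤ) ∣ k - i then k + 1 else if (n : ℤ) ∣ k - (i + 1) then k - 1 else k

theorem not_dvd_one {n : ℕ} (hn : 2 ≤ n) : ¬ (n : ℤ) ∣ 1 := by
  intro h
  have := Int.le_of_dvd one_pos h
  omega

theorem simpleFun_simpleFun {n : ℕ} (hn : 2 ≤ n) (i k : ℤ) :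
    simpleFun n i (simpleFun n i k) = k := by
  have h1 := not_dvd_one hn
  by_cases ha : (n : ℤ) ∣ k - i
  · have e : simpleFun n i k = k + 1 := by simp [simpleFun, ha]
    have hb : ¬ (n : ℤ) ∣ k + 1 - i := fun h => h1 (by
      have := dvd_sub h ha; rwa [show k + 1 - i - (k - i) = 1 by ring] at this)
    have hc : (n : ℤ) ∣ k + 1 - (i + 1) := by rwa [show k + 1 - (i + 1) = k - i by ring]
    rw [e, simpleFun, if_neg hb, if_pos hc]; ring
  · by_cases hb : (n : ℤ) ∣ k - (i + 1)
    · have e : simpleFun n i k = k - 1 := by simp [simpleFun, ha, hb]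
      have hc : (n : ℤ) ∣ k - 1 - i := by rwa [show k - 1 - i = k - (i + 1) by ring]
      rw [e, simpleFun, if_pos hc]; ring
    · have e : simpleFun n i k = k := by simp [simpleFun, ha, hb]
      rw [e, e]

/-- `simpleFun` as a bijection of `ℤ`. -/
def simplePerm (n : ℕ) (hn : 2 ≤ n) (i : ℤ) : Equiv.Perm ℤ where
  toFun := simpleFun n i
  invFun := simpleFun n i
  left_inv := simpleFun_simpleFun hn i
  right_inv := simpleFun_simpleFun hn i

/-- Indicator function of the class of `i` mod `n`. -/
def classInd (n : ℕ) (i k : ℤ) : ℤ := if (n : ℤ) ∣ k - i then 1 else 0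

theorem classInd_add (n : ℕ) (i k : ℤ) : classInd n i (k + n) = classInd n i k := by
  unfold classInd
  have : (n : ℤ) ∣ k + n - i ↔ (n : ℤ) ∣ k - i := by
    rw [show k + n - i = k - i + n by ring, dvd_add_self_right]
  simp only [this]

theorem simpleFun_sub {n : ℕ} (hn : 2 ≤ n) (i k : ℤ) :
    simpleFun n i k = k + (classInd n i k - classInd n i (k - 1)) := by
  have h1 := not_dvd_one hn
  unfold simpleFun classInd
  rw [show k - 1 - i = k - (i + 1) by ring]
  by_cases ha : (n : ℤ) ∣ k - i
  · have hb : ¬ (n : ℤ) ∣ k - (i + 1) := fun h => h1 (by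
      have := dvd_sub ha h; rwa [show k - i - (k - (i + 1)) = 1 by ring] at this)
    simp [ha, hb]
  · by_cases hb : (n : ℤ) ∣ k - (i + 1)
    · simp [ha, hb]; ring
    · simp [ha, hb]

theorem simplePerm_mem {n : ℕ} (hn : 2 ≤ n) (i : ℤ) :
    simplePerm n hn i ∈ AffineSymmetricGroup n := by
  have hs : ∀ k, simplePerm n hn i k = k + (classInd n i k - classInd n i (k - 1)) :=
    simpleFun_sub hn i
  constructor
  · intro k
    rw [hs, hs, classInd_add, show k + n - 1 = k - 1 + n by ring, classInd_add]
    ring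
  · have h := sum_window_comp (n := n) (classInd n i) (fun k => k - 1) (classInd_add n i)
      (fun a b hab => by simpa using hab)
    simp only [hs, Finset.sum_add_distrib, Finset.sum_sub_distrib]
    linarith

/-- The simple reflection `s_i`, `i ∈ ℤ`: for `n ≥ 2` it interchanges `i` and `i + 1` and fixes every
integer outside `{i, i + 1} + nℤ`.  For `n = 1` the group is trivial and there are no reflections;
`s_i` is the identity then. -/
def simpleRefl (n : ℕ) (i : ℤ) : AffineSymmetricGroup n :=
  if hn : 2 ≤ n then ⟨simplePerm n hn i, simplePerm_mem hn i⟩ else 1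

theorem simpleRefl_apply {n : ℕ} (hn : 2 ≤ n) (i k : ℤ) :
    (simpleRefl n i : Equiv.Perm ℤ) k = simpleFun n i k := by
  simp [simpleRefl, hn, simplePerm]

/-- The product `s_{i₁} s_{i₂} ⋯ s_{i_l}` of a word `[i₁, …, i_l]`. -/
def wordProd (n : ℕ) (l : List ℤ) : AffineSymmetricGroup n := (l.map (simpleRefl n)).prod

theorem exists_word_of_descent {n : ℕ} (hn : 2 ≤ n) :
    ∀ (m : ℕ) (π : AffineSymmetricGroup n),
      ∑ k ∈ Icc (1 : ℤ) n, ((π : Equiv.Perm ℤ) k - k) ^ 2 ≤ m → ∃ l, wordProd n l = π := by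
  intro m
  induction m using Nat.strong_induction_on with
  | _ m ih =>
  intro π hm
  obtain ⟨p, hp⟩ := π
  have hp' : IsAffine n p := hp
  simp only at hm
  by_cases hdes : ∃ i, p (i + 1) < p i
  · obtain ⟨i, hi⟩ := hdes
    set q : AffineSymmetricGroup n := ⟨p, hp⟩ * simpleRefl n i with hq
    have hqk : ∀ k, (q : Equiv.Perm ℤ) k = p (simpleFun n i k) := by
      intro k; simp [hq, simpleRefl_apply hn]
    have hss : ∀ k, simpleFun n i (simpleFun n i k) = k := simpleFun_simpleFun hn i
    have hsper : ∀ k, simpleFun n i (k + n) = simpleFun n i k + n := (simplePerm_mem hn i).1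
    have e1 : ∑ k ∈ Icc (1 : ℤ) n, ((q : Equiv.Perm ℤ) k - k) ^ 2
        = ∑ k ∈ Icc (1 : ℤ) n, (p k - simpleFun n i k) ^ 2 := by
      have := sum_window_comp (n := n) (fun k => (p k - simpleFun n i k) ^ 2) (simpleFun n i)
        (fun k => by simp only [hsper, hp'.1]; ring)
        (IsAffine.dvd (π := simplePerm n hn i) hsper)
      rw [← this]
      refine Finset.sum_congr rfl fun k _ => ?_
      simp only [hqk, hss]
    have e2 : ∀ k, (p k - simpleFun n i k) ^ 2 = (p k - k) ^ 2
        + (classInd n i k * (2 * k + 1 - 2 * p k)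
          - classInd n i (k - 1) * (2 * (k - 1) + 1 - 2 * p (k - 1 + 1))) := by
      intro k
      rw [simpleFun_sub hn, sub_add_cancel]
      have h1 := not_dvd_one hn
      unfold classInd
      by_cases ha : (n : ℤ) ∣ k - i
      · have hb : ¬ (n : ℤ) ∣ k - 1 - i := fun h => h1 (by
          have := dvd_sub ha h; rwa [show k - i - (k - 1 - i) = 1 by ring] at this)
        simp only [ha, hb, if_true, if_false]; ring
      · by_cases hb : (n : ℤ) ∣ k - 1 - i
        · simp only [ha, hb, if_true, if_false]; ring
        · simp only [ha, hb, if_false]; ring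
    have e3 := sum_window_comp (n := n)
      (fun k => classInd n i k * (2 * k + 1 - 2 * p (k + 1))) (fun k => k - 1)
      (fun k => by
        simp only [classInd_add]
        rw [show k + (n : ℤ) + 1 = k + 1 + n by ring, hp'.1]; ring)
      (fun a b hab => by simpa using hab)
    have e4 : ∑ k ∈ Icc (1 : ℤ) n, (p k - simpleFun n i k) ^ 2
        = ∑ k ∈ Icc (1 : ℤ) n, (p k - k) ^ 2
          + ∑ k ∈ Icc (1 : ℤ) n, classInd n i k * (2 * (p (k + 1) - p k)) := by
      simp only [e2, Finset.sum_add_distrib, Finset.sum_sub_distrib, e3]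
      rw [← Finset.sum_sub_distrib]
      congr 1
      refine Finset.sum_congr rfl fun k _ => ?_
      ring
    have hper : ∀ k, (n : ℤ) ∣ k - i → p (k + 1) - p k = p (i + 1) - p i := by
      rintro k ⟨c, hc⟩
      have hk : k = i + n * c := by linarith
      rw [hk, show i + (n : ℤ) * c + 1 = i + 1 + n * c by ring, IsAffine.add_mul hp'.1,
        IsAffine.add_mul hp'.1]
      ring
    have e5 : ∑ k ∈ Icc (1 : ℤ) n, classInd n i k * (2 * (p (k + 1) - p k)) < 0 := by
      refine Finset.sum_neg' (fun k _ => ?_) ⟨(i - 1) % n + 1, ?_, ?_⟩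
      · unfold classInd
        split_ifs with h
        · rw [hper k h]; linarith
        · simp
      · have hn' : (0 : ℤ) < n := by omega
        have h1 := Int.emod_nonneg (i - 1) hn'.ne'
        have h2 := Int.emod_lt_of_pos (i - 1) hn'
        rw [Finset.mem_Icc]; omega
      · have hd : (n : ℤ) ∣ (i - 1) % n + 1 - i := by
          refine ⟨-((i - 1) / n), ?_⟩
          have := Int.emod_add_mul_ediv (i - 1) n
          rw [mul_neg]; linarith
        rw [hper _ hd]
        simp only [classInd, hd, if_true]; linarith
    have hlt : ∑ k ∈ Icc (1 : ℤ) n, ((q : Equiv.Perm ℤ) k - k) ^ 2 < m := by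
      rw [e1, e4]; linarith
    have h0 : 0 ≤ ∑ k ∈ Icc (1 : ℤ) n, ((q : Equiv.Perm ℤ) k - k) ^ 2 :=
      Finset.sum_nonneg fun k _ => sq_nonneg _
    obtain ⟨l, hl⟩ := ih (∑ k ∈ Icc (1 : ℤ) n, ((q : Equiv.Perm ℤ) k - k) ^ 2).toNat
      (by omega) q (by omega)
    refine ⟨l ++ [i], ?_⟩
    have hinv : simpleRefl n i * simpleRefl n i = 1 := by
      apply Subtype.ext; ext k
      simp [simpleRefl_apply hn, hss]
    rw [wordProd, List.map_append, List.prod_append, ← wordProd, hl, hq]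
    simp [mul_assoc, hinv]
  · push Not at hdes
    have hmono : StrictMono p := strictMono_int_of_lt_succ fun i =>
      lt_of_le_of_ne (hdes i) (fun h => by have := p.injective h; omega)
    have hsucc : ∀ k, p (k + 1) = p k + 1 := by
      intro k
      obtain ⟨j, hj⟩ := p.surjective (p k + 1)
      have h1 : k < j := hmono.lt_iff_lt.1 (by omega)
      have h2 : p (k + 1) ≤ p j := hmono.monotone (by omega)
      have h3 : p k < p (k + 1) := hmono (by omega)
      omega
    have hlin : ∀ k, p k = p 0 + k := by
      intro k
      induction k using Int.induction_on with
      | zero => simp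
      | succ k ih => rw [hsucc, ih]; ring
      | pred k ih =>
        have := hsucc (-(k : ℤ) - 1)
        rw [sub_add_cancel] at this
        linarith
    have h0 : p 0 = 0 := by
      have h := hp'.2
      rw [Finset.sum_congr rfl fun k _ => hlin k, Finset.sum_add_distrib, Finset.sum_const,
        Int.card_Icc] at h
      have h2 : (n : ℤ) * p 0 = 0 := by simpa using h
      rcases mul_eq_zero.1 h2 with h3 | h3
      · omega
      · exact h3
    refine ⟨[], ?_⟩
    apply Subtype.ext; ext k
    simp [wordProd, hlin k, h0]

/-- The simple reflections generate the affine symmetric group. -/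
theorem exists_word {n : ℕ} (hn : 0 < n) (π : AffineSymmetricGroup n) :
    ∃ l, wordProd n l = π := by
  rcases Nat.lt_or_ge n 2 with h | h
  · obtain rfl : n = 1 := by omega
    refine ⟨[], ?_⟩
    have hp : IsAffine 1 (π : Equiv.Perm ℤ) := π.2
    have h1 : (π : Equiv.Perm ℤ) 1 = 1 := by simpa using hp.2
    apply Subtype.ext; ext k
    have := IsAffine.add_mul hp.1 1 (k - 1)
    rw [Nat.cast_one, one_mul, add_sub_cancel, h1, add_sub_cancel] at this
    simp [wordProd, this]
  · exact exists_word_of_descent h _ π (Int.self_le_toNat _)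

/-! ### Length, reduced words, cyclically decreasing elements -/

/-- The length `ℓ(π)`: the least number of factors in an expression of `π` as a product of simple
reflections. -/
noncomputable def length {n : ℕ} (π : AffineSymmetricGroup n) : ℕ :=
  sInf {k | ∃ l : List ℤ, wordProd n l = π ∧ l.length = k}

/-- `l` spells a reduced expression for `π`. -/
def IsReducedWord {n : ℕ} (l : List ℤ) (π : AffineSymmetricGroup n) : Prop :=
  wordProd n l = π ∧ l.length = length π

theorem exists_reducedWord {n : ℕ} (hn : 0 < n) (π : AffineSymmetricGroup n) :
    ∃ l, IsReducedWord l π := by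
  obtain ⟨l, hl⟩ := exists_word hn π
  exact Nat.sInf_mem (s := {k | ∃ l : List ℤ, wordProd n l = π ∧ l.length = k}) ⟨_, l, hl, rfl⟩

/-- `π` has a reduced expression `s_{i₁} ⋯ s_{i_l}` with `s_{i_j + 1} ≠ s_{i_k}` for `j < k`. -/
def IsCyclicallyDecreasing {n : ℕ} (π : AffineSymmetricGroup n) : Prop :=
  ∃ l : List ℤ, IsReducedWord l π ∧
    l.Pairwise (fun i k => simpleRefl n (i + 1) ≠ simpleRefl n k)

/-! ### Stanley symmetric functions -/

/-- Length-additive factorizations `π = π¹ π² ⋯` into countably many cyclically decreasing factors,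
all but finitely many of them trivial. -/
def IsStanleyFactorization {n : ℕ} (π : AffineSymmetricGroup n) (f : ℕ → AffineSymmetricGroup n) :
    Prop :=
  (∀ i, IsCyclicallyDecreasing (f i)) ∧
    ∃ N, (∀ i, N ≤ i → f i = 1) ∧ ((List.range N).map f).prod = π ∧
      ∑ i ∈ range N, length (f i) = length π

/-- The affine Stanley symmetric function `F_π = ∑ x₁^{ℓ(π¹)} x₂^{ℓ(π²)} ⋯`, given by its
coefficients: that of `x^α` counts the factorizations with `ℓ(π^i) = α_i` for all `i`. -/
noncomputable def stanley {n : ℕ} (π : AffineSymmetricGroup n) : MvPowerSeries ℕ ℚ :=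
  fun α => ({f | IsStanleyFactorization π f ∧ ∀ i, length (f i) = α i}.ncard : ℚ)

theorem simpleRefl_emod (n : ℕ) (i : ℤ) : simpleRefl n (i % n) = simpleRefl n i := by
  unfold simpleRefl
  split_ifs with hn
  · apply Subtype.ext; ext k
    have h : ∀ a, (n : ℤ) ∣ a - (i % n) ↔ (n : ℤ) ∣ a - i := fun a => by
      rw [← dvd_add_left (show (n : ℤ) ∣ i % n - i from ⟨-(i / n), by
        have := Int.emod_add_mul_ediv i n; rw [mul_neg]; linarith⟩)]
      rw [sub_add_sub_cancel]
    have h' : (n : ℤ) ∣ k - (i % n + 1) ↔ (n : ℤ) ∣ k - (i + 1) := by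
      rw [show k - (i % n + 1) = k - 1 - i % n by ring, h, show k - 1 - i = k - (i + 1) by ring]
    simp only [simplePerm, Equiv.coe_fn_mk, simpleFun, h, h']
  · rfl

/-- There are finitely many affine permutations of a given length. -/
theorem finite_length_eq {n : ℕ} (hn : 0 < n) (m : ℕ) :
    {π : AffineSymmetricGroup n | length π = m}.Finite := by
  refine ((List.finite_length_eq (Fin n) m).image
    (fun l => wordProd n (l.map fun i : Fin n => ((i : ℕ) : ℤ)))).subset ?_
  intro π hπ
  obtain ⟨l, hl, hlen⟩ := exists_reducedWord hn π
  have hn' : (0 : ℤ) < n := by exact_mod_cast hn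
  refine ⟨l.map fun i => ⟨(i % (n : ℤ)).toNat, ?_⟩, ?_, ?_⟩
  · have h1 := Int.emod_nonneg i hn'.ne'
    have h2 := Int.emod_lt_of_pos i hn'
    omega
  · simpa [hlen] using hπ
  · rw [← hl]
    simp only [wordProd, List.map_map]
    congr 1
    refine List.map_congr_left fun i _ => ?_
    have h1 := Int.emod_nonneg i hn'.ne'
    simp only [Function.comp, Int.toNat_of_nonneg h1, simpleRefl_emod]

/-- The coefficients of `stanley π` count finite sets. -/
theorem finite_stanley_coeff {n : ℕ} (hn : 0 < n) (π : AffineSymmetricGroup n) (α : ℕ →₀ ℕ) :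
    {f | IsStanleyFactorization π f ∧ ∀ i, length (f i) = α i}.Finite := by
  have h1 : ∀ σ : AffineSymmetricGroup n, length σ = 0 → σ = 1 := by
    intro σ hσ
    obtain ⟨l, hl, hlen⟩ := exists_reducedWord hn σ
    rw [hσ, List.length_eq_zero_iff] at hlen
    rw [← hl, hlen]; rfl
  have hfin : (Set.pi Set.univ (fun i : α.support =>
      {σ : AffineSymmetricGroup n | length σ = α i})).Finite :=
    Set.Finite.pi fun i => finite_length_eq hn _
  refine Set.Finite.of_finite_image (f := fun f (i : α.support) => f i) (hfin.subset ?_) ?_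
  · rintro _ ⟨f, hf, rfl⟩ i _
    exact hf.2 i
  · intro f hf g hg hfg
    funext i
    by_cases hi : i ∈ α.support
    · exact congrFun hfg ⟨i, hi⟩
    · rw [Finsupp.notMem_support_iff] at hi
      rw [h1 (f i) (by rw [hf.2, hi]), h1 (g i) (by rw [hg.2, hi])]

/-! ### The `0`-Hecke product, atoms and involution Stanley symmetric functions -/

/-- Right multiplication by `s_i` for the `0`-Hecke product: `w ∘ s_i` is `w s_i` if this is longer
than `w`, and is `w` otherwise. -/
noncomputable def heckeStep {n : ℕ} (w : AffineSymmetricGroup n) (i : ℤ) :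
    AffineSymmetricGroup n :=
  open Classical in if length w < length (w * simpleRefl n i) then w * simpleRefl n i else w

/-- The `0`-Hecke (Demazure) product `π ∘ σ`: the associative product with `s_i ∘ s_i = s_i` and
`π ∘ σ = π σ` whenever `ℓ(π σ) = ℓ(π) + ℓ(σ)`.  It is computed by multiplying `π` successively by the
letters of a reduced word of `σ`; which reduced word is used does not matter. -/
noncomputable def heckeMul {n : ℕ} (π σ : AffineSymmetricGroup n) : AffineSymmetricGroup n :=
  (Classical.epsilon fun l : List ℤ => IsReducedWord l σ).foldl heckeStep π

/-- The set `Ĩ_n` of involutions (including the identity). -/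
def affineInvolutions (n : ℕ) : Set (AffineSymmetricGroup n) := {z | z = z⁻¹}

/-- Hecke atoms of `z`. -/
def heckeAtoms {n : ℕ} (z : AffineSymmetricGroup n) : Set (AffineSymmetricGroup n) :=
  {π | heckeMul π⁻¹ π = z}

/-- Atoms of `z`: the Hecke atoms of minimal length. -/
def atoms {n : ℕ} (z : AffineSymmetricGroup n) : Set (AffineSymmetricGroup n) :=
  {π | π ∈ heckeAtoms z ∧ ∀ σ ∈ heckeAtoms z, length π ≤ length σ}

theorem atoms_finite {n : ℕ} (hn : 0 < n) (z : AffineSymmetricGroup n) : (atoms z).Finite := by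
  rcases (atoms z).eq_empty_or_nonempty with h | ⟨σ, hσ⟩
  · rw [h]; exact Set.finite_empty
  · exact (finite_length_eq hn (length σ)).subset fun π hπ =>
      le_antisymm (hπ.2 σ hσ.1) (hσ.2 π hπ.1)

/-- The involution Stanley symmetric function `F̂_z = ∑_{π ∈ 𝒜(z)} F_π`, a finite sum. -/
noncomputable def involutionStanley {n : ℕ} (z : AffineSymmetricGroup n) : MvPowerSeries ℕ ℚ :=
  ∑ᶠ π ∈ atoms z, stanley π

/-! ### The two automorphisms -/

/-- Conjugation by a bijection of `ℤ` that normalizes the affine symmetric group. -/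
def conjEquiv {n : ℕ} (c : Equiv.Perm ℤ)
    (h₁ : ∀ π ∈ AffineSymmetricGroup n, c * π * c⁻¹ ∈ AffineSymmetricGroup n)
    (h₂ : ∀ π ∈ AffineSymmetricGroup n, c⁻¹ * π * c ∈ AffineSymmetricGroup n) :
    AffineSymmetricGroup n ≃* AffineSymmetricGroup n where
  toFun π := ⟨c * π * c⁻¹, h₁ _ π.2⟩
  invFun π := ⟨c⁻¹ * π * c, h₂ _ π.2⟩
  left_inv π := by apply Subtype.ext; simp [mul_assoc]
  right_inv π := by apply Subtype.ext; simp [mul_assoc]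
  map_mul' π σ := by apply Subtype.ext; simp [mul_assoc]

theorem shift_mem {n : ℕ} (a : ℤ) {π σ : Equiv.Perm ℤ} (hπ : π ∈ AffineSymmetricGroup n)
    (h : ∀ k, σ k = π (k - a) + a) : σ ∈ AffineSymmetricGroup n := by
  have hp : IsAffine n π := hπ
  constructor
  · intro k
    rw [h, h, show k + n - a = k - a + n by ring, hp.1]; ring
  · have e := sum_window_comp (n := n) (fun k => π k - k) (fun k => k - a)
      (fun k => by simp only [hp.1]; ring) (fun i j hij => by simpa using hij)
    have e2 : ∀ k, σ k = (π (k - a) - (k - a)) + k := fun k => by rw [h]; ring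
    simp only [e2, Finset.sum_add_distrib, e]
    rw [Finset.sum_sub_distrib, hp.2]; ring

theorem flip_mem {n : ℕ} {π σ : Equiv.Perm ℤ} (hπ : π ∈ AffineSymmetricGroup n)
    (h : ∀ k, σ k = 1 - π (1 - k)) : σ ∈ AffineSymmetricGroup n := by
  have hp : IsAffine n π := hπ
  constructor
  · intro k
    have := hp.1 (1 - (k + n))
    rw [show 1 - (k + (n : ℤ)) + n = 1 - k by ring] at this
    rw [h, h, this]; ring
  · have e := sum_window_comp (n := n) (fun k => π k - k) (fun k => 1 - k)
      (fun k => by simp only [hp.1]; ring) (fun i j hij => by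
        rw [show i - j = -(1 - i - (1 - j)) by ring]; exact (dvd_neg).2 hij)
    have e2 : ∀ k, σ k = k - (π (1 - k) - (1 - k)) := fun k => by rw [h]; ring
    simp only [e2]
    rw [Finset.sum_sub_distrib, e, Finset.sum_sub_distrib, hp.2]; ring

/-- The automorphism `π ↦ π^↻` with `s_i ↦ s_{i+1}`, i.e. `π^↻(k) = π(k - 1) + 1`. -/
def rotate (n : ℕ) : AffineSymmetricGroup n ≃* AffineSymmetricGroup n :=
  conjEquiv (Equiv.addRight (1 : ℤ))
    (fun _ hπ => shift_mem 1 hπ fun k => by simp [sub_eq_add_neg])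
    (fun _ hπ => shift_mem (-1) hπ fun k => by simp)

theorem rotate_apply {n : ℕ} (π : AffineSymmetricGroup n) (k : ℤ) :
    (rotate n π : Equiv.Perm ℤ) k = (π : Equiv.Perm ℤ) (k - 1) + 1 := by
  simp [rotate, conjEquiv, sub_eq_add_neg]

theorem rotate_simpleRefl (n : ℕ) (i : ℤ) :
    rotate n (simpleRefl n i) = simpleRefl n (i + 1) := by
  by_cases hn : 2 ≤ n
  · apply Subtype.ext; ext k
    rw [rotate_apply, simpleRefl_apply hn, simpleRefl_apply hn]
    unfold simpleFun
    rw [show k - 1 - i = k - (i + 1) by ring, show k - 1 - (i + 1) = k - (i + 1 + 1) by ring]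
    split_ifs <;> ring
  · simp [simpleRefl, hn]

/-- The automorphism `π ↦ π^*` with `s_i ↦ s_{n-i}`, i.e. `π^*(k) = 1 - π(1 - k)`. -/
def star (n : ℕ) : AffineSymmetricGroup n ≃* AffineSymmetricGroup n :=
  conjEquiv (Equiv.subLeft (1 : ℤ))
    (fun _ hπ => flip_mem hπ fun k => by simp [sub_eq_neg_add])
    (fun _ hπ => flip_mem hπ fun k => by simp [sub_eq_neg_add])

theorem star_apply {n : ℕ} (π : AffineSymmetricGroup n) (k : ℤ) :
    (star n π : Equiv.Perm ℤ) k = 1 - (π : Equiv.Perm ℤ) (1 - k) := by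
  simp [star, conjEquiv, sub_eq_neg_add]

theorem star_simpleRefl (n : ℕ) (i : ℤ) :
    star n (simpleRefl n i) = simpleRefl n (n - i) := by
  by_cases hn : 2 ≤ n
  · apply Subtype.ext; ext k
    rw [star_apply, simpleRefl_apply hn, simpleRefl_apply hn]
    unfold simpleFun
    have h1 : (n : ℤ) ∣ 1 - k - i ↔ (n : ℤ) ∣ k - (n - i + 1) := by
      rw [← dvd_neg, show k - ((n : ℤ) - i + 1) = -(1 - k - i) - n by ring, dvd_sub_self_right]
    have h2 : (n : ℤ) ∣ 1 - k - (i + 1) ↔ (n : ℤ) ∣ k - (n - i) := by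
      rw [← dvd_neg, show k - ((n : ℤ) - i) = -(1 - k - (i + 1)) - n by ring, dvd_sub_self_right]
    have h3 : (n : ℤ) ∣ k - (n - i) → ¬ (n : ℤ) ∣ k - (n - i + 1) := fun ha hb =>
      not_dvd_one hn (by
        have := dvd_sub ha hb
        rwa [show k - ((n : ℤ) - i) - (k - (n - i + 1)) = 1 by ring] at this)
    simp only [h1, h2]
    by_cases ha : (n : ℤ) ∣ k - (n - i)
    · simp only [ha, h3 ha, if_true, if_false]; ring
    · by_cases hb : (n : ℤ) ∣ k - (n - i + 1)
      · simp only [ha, hb, if_true, if_false]; ring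
      · simp only [ha, hb, if_false]; ring
  · simp [simpleRefl, hn]

/-! ### Symmetric functions, affine Schur functions and the involution `ω⁺` -/

/-- `Par^n`: the partitions with all parts less than `n`. -/
def Par (n : ℕ) : Set YoungDiagram := {μ | ∀ p ∈ μ.rowLens, p < n}

/-- The monomial symmetric function `m_μ`: the sum of all distinct monomials whose nonzero exponents
are the parts of `μ` in some order. -/
noncomputable def monomialSymm (μ : YoungDiagram) : MvPowerSeries ℕ ℚ :=
  fun α => if α.support.val.map α = (μ.rowLens : Multiset ℕ) then 1 else 0

/-- `Sym^{(n)}`, the `ℚ`-span of the `m_μ` with `μ ∈ Par^n`. -/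
noncomputable def SymN (n : ℕ) : Submodule ℚ (MvPowerSeries ℕ ℚ) :=
  Submodule.span ℚ (monomialSymm '' Par n)

/-- The entry `c_i` of the code of `π`: the number of `j > i` with `π i > π j`. -/
noncomputable def codeEntry {n : ℕ} (π : AffineSymmetricGroup n) (i : ℤ) : ℕ :=
  {j : ℤ | i < j ∧ (π : Equiv.Perm ℤ) j < (π : Equiv.Perm ℤ) i}.ncard

/-- The multiset of entries of the code `(c_1, …, c_n)`. -/
noncomputable def code {n : ℕ} (π : AffineSymmetricGroup n) : Multiset ℕ :=
  (Icc (1 : ℤ) n).val.map (codeEntry π)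

/-- The shape `λ(π)`: the transpose of the partition that sorts the code of `π⁻¹`. -/
noncomputable def shape {n : ℕ} (π : AffineSymmetricGroup n) : YoungDiagram :=
  (YoungDiagram.ofRowLens ((code π⁻¹).sort (· ≥ ·))
    (Multiset.pairwise_sort (code π⁻¹) (· ≥ ·)).sortedGE).transpose

/-- `π` is Grassmannian if `π⁻¹(1) < π⁻¹(2) < ⋯ < π⁻¹(n)`. -/
def IsGrassmannian {n : ℕ} (π : AffineSymmetricGroup n) : Prop :=
  StrictMonoOn ((π⁻¹ : AffineSymmetricGroup n) : Equiv.Perm ℤ) (Set.Icc 1 (n : ℤ))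

/-- The unique Grassmannian element of shape `μ`, for `μ ∈ Par^n`. -/
noncomputable def grassmannian (n : ℕ) (μ : YoungDiagram) : AffineSymmetricGroup n :=
  Classical.epsilon fun π => IsGrassmannian π ∧ shape π = μ

/-- The affine Schur function `F_μ`, for `μ ∈ Par^n`. -/
noncomputable def affineSchur (n : ℕ) (μ : YoungDiagram) : MvPowerSeries ℕ ℚ :=
  stanley (grassmannian n μ)

/-- `μ^* = λ(π^*)`, where `π` is the Grassmannian element of shape `μ ∈ Par^n`. -/
noncomputable def starPartition (n : ℕ) (μ : YoungDiagram) : YoungDiagram :=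
  shape (star n (grassmannian n μ))

/-- The characterization of `ω⁺`: a linear involution of `Sym^{(n)}` that sends the affine Schur
function `F_μ` to `F_{μ^*}` for every `μ ∈ Par^n` (in particular these functions lie in `Sym^{(n)}`). -/
def IsOmegaPlus (n : ℕ) (ω : SymN n →ₗ[ℚ] SymN n) : Prop :=
  Function.Involutive ω ∧
    ∀ μ ∈ Par n, ∃ h : affineSchur n μ ∈ SymN n,
      (ω ⟨affineSchur n μ, h⟩ : MvPowerSeries ℕ ℚ) = affineSchur n (starPartition n μ)

end AffineStanley

namespace AffineStanley
open Finset

/-! ### Words and length -/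

/-! Both automorphisms permute the simple reflections, so they preserve length, the `0`-Hecke
product and atoms, and the involution Stanley function of an image is the sum of the F of the images
of the atoms (`IsDiagramAutomorphism.involutionStanley_map`). Everything reduces to a single F_π.
Rotation preserves cyclically decreasing elements, hence F_π. The star turns them into inverses of
such elements, so the coefficients of F_{π^*} count factorizations of π into cyclically increasing
factors; these have to be compared with decreasing ones by a linear map that does not depend on π.

Let h_k and e_k be the operators on functions on the group that sum the length-additive right
translations by cyclically decreasing, respectively increasing, elements of length k. The
coefficient of x^α in F_π is (h_{α_0} h_{α_1} ⋯ δ_π)(1) (`stanley_eq_hOp`), and that in F_{π^*} is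
the same expression in the e's (`stanley_star_eq_eOp`). Decreasing elements are indexed by proper
subsets of ℤ/n and have an explicit one-line form `cycFun`. A bijection on pairs of subsets gives
e_i h_j = h_j e_i (`eOp_hOp_commute`), and a sign-reversing involution gives ∑ (-1)^i e_i h_{k-i} =
0 for 0 < k < n (`sum_eOp_mul_hOp`). Solved for h_k, these relations show that the h's commute, so
F_π is symmetric (`stanley_symmetric`). Solved for e_k, they show that the e's are polynomials in
the h's, so the coefficients of F_{π^*} are universal linear combinations of those of F_π
(`exists_duality`).

It remains to see that the F_λ span Sym^{(n)} (`symN_eq_span`). Among the partitions ν whose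
coefficient in F_π is nonzero, the shape of π is the unique minimizer of ∑ i ν_i
(`stanley_shape_ne_zero`, `weight_lt_of_stanley_ne_zero`). Codes are exactly the n-periodic
sequences with a zero, so every λ in Par^n is the shape of exactly one Grassmannian element, and the
system expressing the F_λ in monomials is triangular. The duality operator then restricts to
Sym^{(n)}; it is an involution there because the star is one, it sends F_λ to F_{λ^*} because the
star preserves Grassmannian elements, and the spanning property makes it unique. -/

theorem simpleRefl_mul_self (n : ℕ) (i : ℤ) : simpleRefl n i * simpleRefl n i = 1 := by
  by_cases hn : 2 ≤ n
  · apply Subtype.ext; ext k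
    simp [simpleRefl_apply hn, simpleFun_simpleFun hn]
  · simp [simpleRefl, hn]

theorem simpleRefl_inv (n : ℕ) (i : ℤ) : (simpleRefl n i)⁻¹ = simpleRefl n i :=
  inv_eq_of_mul_eq_one_left (simpleRefl_mul_self n i)

theorem mul_simpleRefl_cancel {n : ℕ} (π : AffineSymmetricGroup n) (i : ℤ) :
    π * simpleRefl n i * simpleRefl n i = π := by
  rw [mul_assoc, simpleRefl_mul_self, mul_one]

theorem simpleRefl_mul_cancel {n : ℕ} (π : AffineSymmetricGroup n) (i : ℤ) :
    simpleRefl n i * (simpleRefl n i * π) = π := by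
  rw [← mul_assoc, simpleRefl_mul_self, one_mul]

@[simp] theorem wordProd_nil (n : ℕ) : wordProd n [] = 1 := rfl

@[simp] theorem wordProd_cons (n : ℕ) (i : ℤ) (l : List ℤ) :
    wordProd n (i :: l) = simpleRefl n i * wordProd n l := by simp [wordProd]

theorem wordProd_append (n : ℕ) (l₁ l₂ : List ℤ) :
    wordProd n (l₁ ++ l₂) = wordProd n l₁ * wordProd n l₂ := by simp [wordProd]

theorem wordProd_reverse (n : ℕ) (l : List ℤ) : wordProd n l.reverse = (wordProd n l)⁻¹ := by
  induction l with
  | nil => simp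
  | cons i l ih => simp [wordProd_append, ih, simpleRefl_inv]

theorem length_wordProd_le {n : ℕ} (l : List ℤ) : length (wordProd n l) ≤ l.length :=
  Nat.sInf_le ⟨l, rfl, rfl⟩

theorem length_one {n : ℕ} : length (1 : AffineSymmetricGroup n) = 0 :=
  Nat.le_zero.1 (length_wordProd_le (n := n) [])

theorem length_simpleRefl_le {n : ℕ} (i : ℤ) : length (simpleRefl n i) ≤ 1 := by
  simpa using length_wordProd_le (n := n) [i]

theorem length_mul_le {n : ℕ} (hn : 0 < n) (π σ : AffineSymmetricGroup n) :
    length (π * σ) ≤ length π + length σ := by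
  obtain ⟨l, hl, hl'⟩ := exists_reducedWord hn π
  obtain ⟨m, hm, hm'⟩ := exists_reducedWord hn σ
  have := length_wordProd_le (n := n) (l ++ m)
  rwa [wordProd_append, hl, hm, List.length_append, hl', hm'] at this

theorem length_inv_le {n : ℕ} (hn : 0 < n) (π : AffineSymmetricGroup n) :
    length π⁻¹ ≤ length π := by
  obtain ⟨l, hl, hl'⟩ := exists_reducedWord hn π
  have := length_wordProd_le (n := n) l.reverse
  rwa [wordProd_reverse, hl, List.length_reverse, hl'] at this

theorem length_inv {n : ℕ} (hn : 0 < n) (π : AffineSymmetricGroup n) :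
    length π⁻¹ = length π :=
  le_antisymm (length_inv_le hn π) (by simpa using length_inv_le hn π⁻¹)

theorem eq_one_of_length_eq_zero {n : ℕ} (hn : 0 < n) {π : AffineSymmetricGroup n}
    (h : length π = 0) : π = 1 := by
  obtain ⟨l, hl, hlen⟩ := exists_reducedWord hn π
  rw [h, List.length_eq_zero_iff] at hlen
  rw [← hl, hlen]; rfl

theorem length_list_prod_le {n : ℕ} (hn : 0 < n) (L : List (AffineSymmetricGroup n)) :
    length L.prod ≤ (L.map length).sum := by
  induction L with
  | nil => simp [length_one]
  | cons a L ih =>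
    simp only [List.prod_cons, List.map_cons, List.sum_cons]
    exact (length_mul_le hn _ _).trans (by omega)

/-! ### Codes and inversions -/

theorem affine_add {n : ℕ} (π : AffineSymmetricGroup n) (i : ℤ) :
    (π : Equiv.Perm ℤ) (i + n) = (π : Equiv.Perm ℤ) i + n := π.2.1 i

theorem affine_add_mul {n : ℕ} (π : AffineSymmetricGroup n) (i c : ℤ) :
    (π : Equiv.Perm ℤ) (i + n * c) = (π : Equiv.Perm ℤ) i + n * c :=
  IsAffine.add_mul π.2.1 i c

theorem exists_mem_window {n : ℕ} (hn : 0 < n) (k : ℤ) :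
    ∃ r ∈ Icc (1 : ℤ) n, ∃ c : ℤ, k = r + n * c := by
  have hn' : (0 : ℤ) < n := by exact_mod_cast hn
  have h1 := Int.emod_nonneg (k - 1) hn'.ne'
  have h2 := Int.emod_lt_of_pos (k - 1) hn'
  have h3 := Int.emod_add_mul_ediv (k - 1) n
  exact ⟨(k - 1) % n + 1, by rw [Finset.mem_Icc]; omega, (k - 1) / n, by linarith⟩

theorem exists_displacement_bound {n : ℕ} (hn : 0 < n) (π : AffineSymmetricGroup n) :
    ∃ M : ℤ, ∀ j, j - M ≤ (π : Equiv.Perm ℤ) j := by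
  refine ⟨∑ r ∈ Icc (1 : ℤ) n, |(π : Equiv.Perm ℤ) r - r|, fun j => ?_⟩
  obtain ⟨r, hr, c, rfl⟩ := exists_mem_window hn j
  have h := Finset.single_le_sum (f := fun r => |(π : Equiv.Perm ℤ) r - r|)
    (fun i _ => abs_nonneg _) hr
  have h2 := neg_abs_le ((π : Equiv.Perm ℤ) r - r)
  rw [affine_add_mul]
  linarith

/-- The displacement is bounded, so j is confined to a bounded interval. Without this, `Set.ncard`
in `codeEntry` could be the default 0 of an infinite set. -/
theorem finite_code {n : ℕ} (hn : 0 < n) (π : AffineSymmetricGroup n) (i a : ℤ) :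
    {j : ℤ | i < j ∧ (π : Equiv.Perm ℤ) j < a}.Finite := by
  obtain ⟨M, hM⟩ := exists_displacement_bound hn π
  refine (Set.finite_Ioo i (a + M)).subset fun j hj => ⟨hj.1, ?_⟩
  have := hM j
  have := hj.2
  linarith

theorem simpleRefl_apply_of_dvd {n : ℕ} (hn : 2 ≤ n) {i k : ℤ} (h : (n : ℤ) ∣ k - i) :
    (simpleRefl n i : Equiv.Perm ℤ) k = k + 1 := by
  simp [simpleRefl_apply hn, simpleFun, h]

theorem not_dvd_of_dvd_succ {n : ℕ} (hn : 2 ≤ n) {i k : ℤ} (h : (n : ℤ) ∣ k - (i + 1)) :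
    ¬ (n : ℤ) ∣ k - i := fun h' => not_dvd_one hn (by
  have := dvd_sub h' h; rwa [show k - i - (k - (i + 1)) = 1 by ring] at this)

theorem simpleRefl_apply_of_dvd_succ {n : ℕ} (hn : 2 ≤ n) {i k : ℤ}
    (h : (n : ℤ) ∣ k - (i + 1)) : (simpleRefl n i : Equiv.Perm ℤ) k = k - 1 := by
  simp [simpleRefl_apply hn, simpleFun, h, not_dvd_of_dvd_succ hn h]

theorem simpleRefl_apply_of_not_dvd {n : ℕ} (hn : 2 ≤ n) {i k : ℤ}
    (h : ¬ (n : ℤ) ∣ k - i) (h' : ¬ (n : ℤ) ∣ k - (i + 1)) :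
    (simpleRefl n i : Equiv.Perm ℤ) k = k := by
  simp [simpleRefl_apply hn, simpleFun, h, h']

theorem simpleRefl_simpleRefl_apply {n : ℕ} (hn : 2 ≤ n) (i k : ℤ) :
    (simpleRefl n i : Equiv.Perm ℤ) ((simpleRefl n i : Equiv.Perm ℤ) k) = k := by
  simp [simpleRefl_apply hn, simpleFun_simpleFun hn]

theorem ascent_congr {n : ℕ} (π : AffineSymmetricGroup n) {i k : ℤ} (h : (n : ℤ) ∣ k - i) :
    (π : Equiv.Perm ℤ) k < (π : Equiv.Perm ℤ) (k + 1) ↔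
      (π : Equiv.Perm ℤ) i < (π : Equiv.Perm ℤ) (i + 1) := by
  obtain ⟨c, hc⟩ := h
  obtain rfl : k = i + n * c := by linarith
  rw [show i + (n : ℤ) * c + 1 = i + 1 + n * c by ring, affine_add_mul, affine_add_mul]
  omega

/-- A simple reflection reverses the order of two integers only if they form a swapped pair. -/
theorem simpleRefl_lt_iff {n : ℕ} (hn : 2 ≤ n) (i : ℤ) {k m : ℤ}
    (h : ¬ ((n : ℤ) ∣ k - i ∧ m = k + 1)) (h' : ¬ ((n : ℤ) ∣ m - i ∧ k = m + 1)) :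
    (simpleRefl n i : Equiv.Perm ℤ) k < (simpleRefl n i : Equiv.Perm ℤ) m ↔ k < m := by
  have key : ∀ a, (n : ℤ) ∣ a - i → (n : ℤ) ∣ a + 1 - (i + 1) := fun a ha => by
    rwa [show a + 1 - (i + 1) = a - i by ring]
  have key' : ∀ a, (n : ℤ) ∣ a - (i + 1) → (n : ℤ) ∣ a - 1 - i := fun a ha => by
    rwa [show a - 1 - i = a - (i + 1) by ring]
  have hinj : ∀ a b, (simpleRefl n i : Equiv.Perm ℤ) a = (simpleRefl n i : Equiv.Perm ℤ) b → a = b :=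
    fun a b hab => (simpleRefl n i : Equiv.Perm ℤ).injective hab
  by_cases hkm : k = m
  · subst hkm; simp
  have hne : (simpleRefl n i : Equiv.Perm ℤ) k ≠ (simpleRefl n i : Equiv.Perm ℤ) m :=
    fun e => hkm (hinj _ _ e)
  have bounds : ∀ a, ((n : ℤ) ∣ a - i ∧ (simpleRefl n i : Equiv.Perm ℤ) a = a + 1) ∨
      ((n : ℤ) ∣ a - (i + 1) ∧ (simpleRefl n i : Equiv.Perm ℤ) a = a - 1) ∨
      ((simpleRefl n i : Equiv.Perm ℤ) a = a) := by
    intro a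
    by_cases h1 : (n : ℤ) ∣ a - i
    · exact Or.inl ⟨h1, simpleRefl_apply_of_dvd hn h1⟩
    · by_cases h2 : (n : ℤ) ∣ a - (i + 1)
      · exact Or.inr (Or.inl ⟨h2, simpleRefl_apply_of_dvd_succ hn h2⟩)
      · exact Or.inr (Or.inr (simpleRefl_apply_of_not_dvd hn h1 h2))
  rcases bounds k with ⟨a1, a2⟩ | ⟨a1, a2⟩ | a2 <;> rcases bounds m with ⟨b1, b2⟩ | ⟨b1, b2⟩ | b2
  · omega
  · have : m ≠ k + 1 := fun e => h ⟨a1, e⟩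
    have : m ≠ k + 2 := fun e => not_dvd_one hn (by
      have := dvd_sub b1 a1; subst e; rwa [show k + 2 - (i + 1) - (k - i) = 1 by ring] at this)
    omega
  · have : m ≠ k + 1 := fun e => h ⟨a1, e⟩
    omega
  · have : k ≠ m + 1 := fun e => h' ⟨b1, e⟩
    have : k ≠ m + 2 := fun e => not_dvd_one hn (by
      have := dvd_sub a1 b1; subst e; rwa [show m + 2 - (i + 1) - (m - i) = 1 by ring] at this)
    omega
  · omega
  · have : k ≠ m + 1 := fun e => h' ⟨by have := key' _ a1; rwa [e, add_sub_cancel_right] at this, e⟩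
    omega
  · have : k ≠ m + 1 := fun e => h' ⟨b1, e⟩
    omega
  · have : m ≠ k + 1 := fun e => h ⟨by have := key' _ b1; rwa [e, add_sub_cancel_right] at this, e⟩
    omega
  · omega

/-- The effect on the code of right multiplication by a simple reflection at an ascent. -/
theorem codeEntry_mul_simpleRefl {n : ℕ} (hn : 2 ≤ n) (π : AffineSymmetricGroup n) (i : ℤ)
    (hi : (π : Equiv.Perm ℤ) i < (π : Equiv.Perm ℤ) (i + 1)) (k : ℤ) :
    codeEntry (π * simpleRefl n i) k =
      codeEntry π ((simpleRefl n i : Equiv.Perm ℤ) k) + if (n : ℤ) ∣ k - i then 1 else 0 := by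
  set s : Equiv.Perm ℤ := (simpleRefl n i : Equiv.Perm ℤ) with hs
  have hss : ∀ a, s (s a) = a := simpleRefl_simpleRefl_apply hn i
  have e1 : codeEntry (π * simpleRefl n i) k =
      {m : ℤ | k < s m ∧ (π : Equiv.Perm ℤ) m < (π : Equiv.Perm ℤ) (s k)}.ncard := by
    unfold codeEntry
    rw [← Set.ncard_image_of_injective _ s.injective]
    congr 1
    ext m
    simp only [Set.mem_image, Set.mem_ofPred_eq, Subgroup.coe_mul, Equiv.Perm.mul_apply, ← hs]
    constructor
    · rintro ⟨j, ⟨h1, h2⟩, rfl⟩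
      exact ⟨by rwa [hss], h2⟩
    · rintro ⟨h1, h2⟩
      exact ⟨s m, ⟨h1, by rwa [hss]⟩, hss m⟩
  rw [e1]
  have hlt := fun m => simpleRefl_lt_iff hn i (k := s k) (m := m)
  simp only [← hs, hss] at hlt
  by_cases hk : (n : ℤ) ∣ k - i
  · have hsk : s k = k + 1 := simpleRefl_apply_of_dvd hn hk
    rw [if_pos hk, codeEntry]
    -- The one new inversion is the swapped pair itself, which appears here as m = k after the
    -- reindexing by s.
    have hset : {m : ℤ | k < s m ∧ (π : Equiv.Perm ℤ) m < (π : Equiv.Perm ℤ) (s k)} =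
        insert k {j : ℤ | s k < j ∧ (π : Equiv.Perm ℤ) j < (π : Equiv.Perm ℤ) (s k)} := by
      ext m
      simp only [Set.mem_ofPred_eq, Set.mem_insert_iff]
      by_cases hm : m = k
      · subst hm
        simp only [hsk, true_or, iff_true]
        exact ⟨by omega, (ascent_congr π hk).2 hi⟩
      · rw [hlt m (fun h => not_dvd_of_dvd_succ hn (k := s k) (i := i)
          (by rw [hsk]; rwa [show k + 1 - (i + 1) = k - i by ring]) h.1)
          (fun h => hm (by omega))]
        simp [hm]
    rw [hset, Set.ncard_insert_of_notMem (by simp [hsk]) (finite_code (by omega) π _ _)]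
  · rw [if_neg hk, add_zero, codeEntry]
    congr 1
    ext m
    simp only [Set.mem_ofPred_eq]
    -- The only pair whose order s could reverse; by the ascent hypothesis it is an inversion on
    -- neither side.
    by_cases hm : (n : ℤ) ∣ s k - i ∧ m = s k + 1
    · have h1 := (ascent_congr π hm.1).2 hi
      rw [← hm.2] at h1
      constructor <;> intro h <;> omega
    · rw [hlt m hm]
      rintro ⟨h1, h2⟩
      have h3 : s (s k) = s k - 1 := simpleRefl_apply_of_dvd_succ hn
        (by rw [h2]; rwa [show m + 1 - (i + 1) = m - i by ring])
      rw [hss] at h3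
      exact hk (by rw [h3, h2]; simpa using h1)

theorem codeEntry_add {n : ℕ} (π : AffineSymmetricGroup n) (k : ℤ) :
    codeEntry π (k + n) = codeEntry π k := by
  unfold codeEntry
  rw [← Set.ncard_image_of_injective {j : ℤ | k < j ∧ _} (add_left_injective (n : ℤ))]
  congr 1
  ext m
  simp only [Set.mem_ofPred_eq, Set.mem_image]
  constructor
  · rintro ⟨h1, h2⟩
    refine ⟨m - n, ⟨by omega, ?_⟩, by ring⟩
    have := affine_add π (m - n)
    rw [sub_add_cancel] at this
    rw [affine_add] at h2
    omega
  · rintro ⟨j, ⟨h1, h2⟩, rfl⟩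
    rw [affine_add, affine_add]
    omega

theorem codeEntry_add_mul {n : ℕ} (π : AffineSymmetricGroup n) (k c : ℤ) :
    codeEntry π (k + n * c) = codeEntry π k := by
  have h : Function.Periodic (codeEntry π) (n : ℤ) := codeEntry_add π
  have := (h.zsmul c) k
  rwa [smul_eq_mul, mul_comm] at this

theorem codeEntry_congr {n : ℕ} (π : AffineSymmetricGroup n) {k m : ℤ} (h : (n : ℤ) ∣ k - m) :
    codeEntry π k = codeEntry π m := by
  obtain ⟨c, hc⟩ := h
  obtain rfl : k = m + n * c := by linarith
  exact codeEntry_add_mul π m c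

/-- Summing a function of the code over a window is invariant under an affine reindexing. -/
theorem sum_code_comp {n : ℕ} (π g : AffineSymmetricGroup n) (φ : ℕ → ℕ) :
    ∑ k ∈ Icc (1 : ℤ) n, φ (codeEntry π ((g : Equiv.Perm ℤ) k)) =
      ∑ k ∈ Icc (1 : ℤ) n, φ (codeEntry π k) := by
  have := sum_window_comp (n := n) (fun k => (φ (codeEntry π k) : ℤ)) (g : Equiv.Perm ℤ)
    (fun k => by simp only [codeEntry_add]) (IsAffine.dvd g.2.1)
  exact_mod_cast this

theorem sum_window_indicator {n : ℕ} (hn : 0 < n) (i : ℤ) :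
    ∑ k ∈ Icc (1 : ℤ) n, (if (n : ℤ) ∣ k - i then 1 else 0 : ℕ) = 1 := by
  obtain ⟨r, hr, c, rfl⟩ := exists_mem_window hn i
  rw [Finset.sum_eq_single_of_mem r hr]
  · rw [if_pos ⟨-c, by ring⟩]
  · intro k hk hkr
    rw [if_neg]
    rintro ⟨d, hd⟩
    rw [Finset.mem_Icc] at hr hk
    have h : k - r = n * (d + c) := by linarith
    apply hkr
    have : d + c = 0 := by
      by_contra h0
      rcases lt_or_gt_of_ne h0 with h1 | h1
      · have : (n : ℤ) * (d + c) ≤ n * (-1) := mul_le_mul_of_nonneg_left (by omega) (by omega)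
        omega
      · have : (n : ℤ) * 1 ≤ n * (d + c) := mul_le_mul_of_nonneg_left (by omega) (by omega)
        omega
    rw [this] at h
    linarith

/-- The number of inversions modulo translation by `n`. -/
noncomputable def inversionCount {n : ℕ} (π : AffineSymmetricGroup n) : ℕ :=
  ∑ k ∈ Icc (1 : ℤ) n, codeEntry π k

theorem inversionCount_mul_simpleRefl {n : ℕ} (hn : 2 ≤ n) (π : AffineSymmetricGroup n) (i : ℤ)
    (hi : (π : Equiv.Perm ℤ) i < (π : Equiv.Perm ℤ) (i + 1)) :
    inversionCount (π * simpleRefl n i) = inversionCount π + 1 := by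
  unfold inversionCount
  simp only [codeEntry_mul_simpleRefl hn π i hi, Finset.sum_add_distrib]
  rw [sum_window_indicator (by omega)]
  congr 1
  exact sum_code_comp π (simpleRefl n i) id

theorem mul_simpleRefl_apply_self {n : ℕ} (hn : 2 ≤ n) (π : AffineSymmetricGroup n) (i : ℤ) :
    ((π * simpleRefl n i : AffineSymmetricGroup n) : Equiv.Perm ℤ) i =
      (π : Equiv.Perm ℤ) (i + 1) := by
  simp [simpleRefl_apply_of_dvd hn (show (n : ℤ) ∣ i - i by simp)]

theorem mul_simpleRefl_apply_succ {n : ℕ} (hn : 2 ≤ n) (π : AffineSymmetricGroup n) (i : ℤ) :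
    ((π * simpleRefl n i : AffineSymmetricGroup n) : Equiv.Perm ℤ) (i + 1) =
      (π : Equiv.Perm ℤ) i := by
  simp [simpleRefl_apply_of_dvd_succ hn (show (n : ℤ) ∣ i + 1 - (i + 1) by simp)]

theorem ascent_or_descent {n : ℕ} (π : AffineSymmetricGroup n) (i : ℤ) :
    (π : Equiv.Perm ℤ) i < (π : Equiv.Perm ℤ) (i + 1) ∨
      (π : Equiv.Perm ℤ) (i + 1) < (π : Equiv.Perm ℤ) i := by
  rcases lt_trichotomy ((π : Equiv.Perm ℤ) i) ((π : Equiv.Perm ℤ) (i + 1)) with h | h | h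
  · exact Or.inl h
  · have := (π : Equiv.Perm ℤ).injective h
    omega
  · exact Or.inr h

theorem inversionCount_of_descent {n : ℕ} (hn : 2 ≤ n) (π : AffineSymmetricGroup n) (i : ℤ)
    (hi : (π : Equiv.Perm ℤ) (i + 1) < (π : Equiv.Perm ℤ) i) :
    inversionCount π = inversionCount (π * simpleRefl n i) + 1 := by
  rw [← inversionCount_mul_simpleRefl hn (π * simpleRefl n i) i, mul_simpleRefl_cancel]
  rwa [mul_simpleRefl_apply_self hn, mul_simpleRefl_apply_succ hn]

theorem inversionCount_mul_simpleRefl_le {n : ℕ} (hn : 2 ≤ n) (π : AffineSymmetricGroup n)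
    (i : ℤ) : inversionCount (π * simpleRefl n i) ≤ inversionCount π + 1 := by
  rcases ascent_or_descent π i with h | h
  · exact (inversionCount_mul_simpleRefl hn π i h).le
  · have := inversionCount_of_descent hn π i h
    omega

theorem codeEntry_one {n : ℕ} (k : ℤ) : codeEntry (1 : AffineSymmetricGroup n) k = 0 := by
  unfold codeEntry
  convert Set.ncard_empty ℤ
  ext j
  simp only [OneMemClass.coe_one, Equiv.Perm.coe_one, id_eq, Set.mem_ofPred_eq,
    Set.mem_empty_iff_false, iff_false]
  omega

theorem inversionCount_le_length {n : ℕ} (hn : 2 ≤ n) (π : AffineSymmetricGroup n) :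
    inversionCount π ≤ length π := by
  obtain ⟨l, rfl, hl⟩ := exists_reducedWord (show 0 < n by omega) π
  rw [← hl]
  clear hl
  induction l using List.reverseRecOn with
  | nil => simp [inversionCount, codeEntry_one]
  | append_singleton l i ih =>
    have h := inversionCount_mul_simpleRefl_le hn (wordProd n l) i
    rw [wordProd_append, wordProd_cons, wordProd_nil, mul_one, List.length_append]
    simp only [List.length_singleton]
    omega

/-- An affine permutation without descents is the identity. -/
theorem eq_one_of_no_descent {n : ℕ} (hn : 0 < n) (π : AffineSymmetricGroup n)
    (h : ∀ i, (π : Equiv.Perm ℤ) i < (π : Equiv.Perm ℤ) (i + 1)) : π = 1 := by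
  obtain ⟨p, hp⟩ := π
  have hp' : IsAffine n p := hp
  have hmono : StrictMono p := strictMono_int_of_lt_succ h
  have hsucc : ∀ k, p (k + 1) = p k + 1 := by
    intro k
    obtain ⟨j, hj⟩ := p.surjective (p k + 1)
    have h1 : k < j := hmono.lt_iff_lt.1 (by omega)
    have h2 : p (k + 1) ≤ p j := hmono.monotone (by omega)
    have h3 : p k < p (k + 1) := hmono (by omega)
    omega
  have hlin : ∀ k, p k = p 0 + k := by
    intro k
    induction k using Int.induction_on with
    | zero => simp
    | succ k ih => rw [hsucc, ih]; ring
    | pred k ih =>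
      have := hsucc (-(k : ℤ) - 1)
      rw [sub_add_cancel] at this
      linarith
  have h0 : p 0 = 0 := by
    have h := hp'.2
    rw [Finset.sum_congr rfl fun k _ => hlin k, Finset.sum_add_distrib, Finset.sum_const,
      Int.card_Icc] at h
    have h2 : (n : ℤ) * p 0 = 0 := by simpa using h
    rcases mul_eq_zero.1 h2 with h3 | h3
    · omega
    · exact h3
  apply Subtype.ext; ext k
  simp [hlin k, h0]

/-- Each letter creates at most one inversion, and multiplying at a descent removes exactly one
until the identity is reached. From here on, comparing the values at i and i + 1 decides whether s_i
lengthens π. -/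
theorem length_eq_inversionCount {n : ℕ} (hn : 2 ≤ n) (π : AffineSymmetricGroup n) :
    length π = inversionCount π := by
  refine le_antisymm ?_ (inversionCount_le_length hn π)
  induction hm : inversionCount π using Nat.strong_induction_on generalizing π with
  | _ m ih =>
  by_cases hd : ∃ i, (π : Equiv.Perm ℤ) (i + 1) < (π : Equiv.Perm ℤ) i
  · obtain ⟨i, hi⟩ := hd
    have h1 := inversionCount_of_descent hn π i hi
    have h2 := ih _ (by omega) (π * simpleRefl n i) rfl
    have h3 := length_mul_le (by omega) (π * simpleRefl n i) (simpleRefl n i)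
    rw [mul_simpleRefl_cancel] at h3
    have h4 := length_simpleRefl_le (n := n) i
    omega
  · push Not at hd
    rw [eq_one_of_no_descent (by omega) π fun i => (ascent_or_descent π i).resolve_right
      (not_lt.2 (hd i)), length_one]
    exact Nat.zero_le _

theorem length_mul_simpleRefl {n : ℕ} (hn : 2 ≤ n) (π : AffineSymmetricGroup n) (i : ℤ)
    (hi : (π : Equiv.Perm ℤ) i < (π : Equiv.Perm ℤ) (i + 1)) :
    length (π * simpleRefl n i) = length π + 1 := by
  rw [length_eq_inversionCount hn, length_eq_inversionCount hn, inversionCount_mul_simpleRefl hn π i hi]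

theorem length_of_descent {n : ℕ} (hn : 2 ≤ n) (π : AffineSymmetricGroup n) (i : ℤ)
    (hi : (π : Equiv.Perm ℤ) (i + 1) < (π : Equiv.Perm ℤ) i) :
    length π = length (π * simpleRefl n i) + 1 := by
  rw [length_eq_inversionCount hn, length_eq_inversionCount hn, inversionCount_of_descent hn π i hi]

theorem length_lt_length_mul_simpleRefl_iff {n : ℕ} (hn : 2 ≤ n) (π : AffineSymmetricGroup n)
    (i : ℤ) : length π < length (π * simpleRefl n i) ↔
      (π : Equiv.Perm ℤ) i < (π : Equiv.Perm ℤ) (i + 1) := by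
  rcases ascent_or_descent π i with h | h
  · have := length_mul_simpleRefl hn π i h
    constructor <;> intro <;> omega
  · have := length_of_descent hn π i h
    constructor <;> intro <;> omega

end AffineStanley
namespace AffineStanley
open Finset

/-! ### The `0`-Hecke product does not depend on the reduced word -/

theorem heckeStep_eq {n : ℕ} (hn : 2 ≤ n) (w : AffineSymmetricGroup n) (i : ℤ) :
    heckeStep w i =
      if (w : Equiv.Perm ℤ) i < (w : Equiv.Perm ℤ) (i + 1) then w * simpleRefl n i else w := by
  unfold heckeStep
  simp only [length_lt_length_mul_simpleRefl_iff hn]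

/-- Left multiplication by `s_j` for the `0`-Hecke product. -/
noncomputable def leftHeckeStep {n : ℕ} (j : ℤ) (w : AffineSymmetricGroup n) :
    AffineSymmetricGroup n := (heckeStep w⁻¹ j)⁻¹

theorem leftHeckeStep_eq {n : ℕ} (hn : 2 ≤ n) (w : AffineSymmetricGroup n) (j : ℤ) :
    leftHeckeStep j w =
      if ((w⁻¹ : AffineSymmetricGroup n) : Equiv.Perm ℤ) j <
        ((w⁻¹ : AffineSymmetricGroup n) : Equiv.Perm ℤ) (j + 1) then simpleRefl n j * w else w := by
  unfold leftHeckeStep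
  rw [heckeStep_eq hn]
  split_ifs <;> simp [simpleRefl_inv]

theorem inv_affine_apply_self {n : ℕ} (w : AffineSymmetricGroup n) (k : ℤ) :
    ((w⁻¹ : AffineSymmetricGroup n) : Equiv.Perm ℤ) ((w : Equiv.Perm ℤ) k) = k := by
  simp

theorem affine_apply_inv_self {n : ℕ} (w : AffineSymmetricGroup n) (k : ℤ) :
    (w : Equiv.Perm ℤ) (((w⁻¹ : AffineSymmetricGroup n) : Equiv.Perm ℤ) k) = k := by
  simp

theorem affine_dvd_iff {n : ℕ} (w : AffineSymmetricGroup n) (a b : ℤ) :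
    (n : ℤ) ∣ (w : Equiv.Perm ℤ) a - (w : Equiv.Perm ℤ) b ↔ (n : ℤ) ∣ a - b := by
  refine ⟨IsAffine.dvd w.2.1 a b, ?_⟩
  rintro ⟨c, hc⟩
  obtain rfl : a = b + n * c := by linarith
  rw [affine_add_mul]
  simp

/-- The conjugate w s_i w⁻¹ swaps w(i) and w(i + 1) and their translates; under the hypotheses this
is s_j. -/
theorem simpleRefl_mul_eq_mul_simpleRefl {n : ℕ} (hn : 2 ≤ n) (w : AffineSymmetricGroup n)
    (i j : ℤ) (h : (n : ℤ) ∣ (w : Equiv.Perm ℤ) i - j)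
    (h' : (w : Equiv.Perm ℤ) (i + 1) = (w : Equiv.Perm ℤ) i + 1) :
    simpleRefl n j * w = w * simpleRefl n i := by
  have e1 : ∀ k, (n : ℤ) ∣ (w : Equiv.Perm ℤ) k - j ↔ (n : ℤ) ∣ k - i := fun k => by
    rw [← affine_dvd_iff w k i, ← sub_add_sub_cancel ((w : Equiv.Perm ℤ) k) ((w : Equiv.Perm ℤ) i) j,
      dvd_add_left h]
  have e2 : ∀ k, (n : ℤ) ∣ (w : Equiv.Perm ℤ) k - (j + 1) ↔ (n : ℤ) ∣ k - (i + 1) := fun k => by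
    rw [← affine_dvd_iff w k (i + 1), h', ← sub_add_sub_cancel ((w : Equiv.Perm ℤ) k)
      ((w : Equiv.Perm ℤ) i + 1) (j + 1), dvd_add_left (by rwa [add_sub_add_right_eq_sub])]
  apply Subtype.ext; ext k
  simp only [Subgroup.coe_mul, Equiv.Perm.mul_apply]
  by_cases h1 : (n : ℤ) ∣ k - i
  · rw [simpleRefl_apply_of_dvd hn ((e1 k).2 h1), simpleRefl_apply_of_dvd hn h1]
    obtain ⟨c, hc⟩ := h1
    obtain rfl : k = i + n * c := by linarith
    rw [show i + (n : ℤ) * c + 1 = i + 1 + n * c by ring, affine_add_mul, affine_add_mul, h']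
    ring
  · by_cases h2 : (n : ℤ) ∣ k - (i + 1)
    · rw [simpleRefl_apply_of_dvd_succ hn ((e2 k).2 h2), simpleRefl_apply_of_dvd_succ hn h2]
      obtain ⟨c, hc⟩ := h2
      obtain rfl : k = i + 1 + n * c := by linarith
      rw [show i + 1 + (n : ℤ) * c - 1 = i + n * c by ring, affine_add_mul, affine_add_mul, h']
      ring
    · rw [simpleRefl_apply_of_not_dvd hn (fun h => h1 ((e1 k).1 h)) (fun h => h2 ((e2 k).1 h)),
        simpleRefl_apply_of_not_dvd hn h1 h2]

theorem inv_apply_of_adjacent {n : ℕ} (w : AffineSymmetricGroup n) (i j : ℤ)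
    (h : (n : ℤ) ∣ (w : Equiv.Perm ℤ) i - j)
    (h' : (w : Equiv.Perm ℤ) (i + 1) = (w : Equiv.Perm ℤ) i + 1) :
    (n : ℤ) ∣ ((w⁻¹ : AffineSymmetricGroup n) : Equiv.Perm ℤ) j - i ∧
    ((w⁻¹ : AffineSymmetricGroup n) : Equiv.Perm ℤ) (j + 1) =
      ((w⁻¹ : AffineSymmetricGroup n) : Equiv.Perm ℤ) j + 1 := by
  obtain ⟨c, hc⟩ := h
  have e1 : ((w⁻¹ : AffineSymmetricGroup n) : Equiv.Perm ℤ) j = i + n * (-c) := by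
    rw [← inv_affine_apply_self w (i + n * (-c)), affine_add_mul]
    congr 1
    linarith
  have e2 : ((w⁻¹ : AffineSymmetricGroup n) : Equiv.Perm ℤ) (j + 1) = i + 1 + n * (-c) := by
    rw [← inv_affine_apply_self w (i + 1 + n * (-c)), affine_add_mul, h']
    congr 1
    linarith
  rw [e1, e2]
  exact ⟨⟨-c, by ring⟩, by ring⟩

/-- Left and right `0`-Hecke multiplications by simple reflections commute. -/
theorem heckeStep_leftHeckeStep {n : ℕ} (hn : 2 ≤ n) (w : AffineSymmetricGroup n) (i j : ℤ) :
    heckeStep (leftHeckeStep j w) i = leftHeckeStep j (heckeStep w i) := by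
  -- If w carries the pair i, i + 1 to a translate of j, j + 1 in order, then s_j w = w s_i: the
  -- first step from either side gives this element and the second does nothing.
  by_cases hs : (n : ℤ) ∣ (w : Equiv.Perm ℤ) i - j ∧
      (w : Equiv.Perm ℤ) (i + 1) = (w : Equiv.Perm ℤ) i + 1
  · obtain ⟨h1, h2⟩ := hs
    have h3 := inv_apply_of_adjacent w i j h1 h2
    have e := simpleRefl_mul_eq_mul_simpleRefl hn w i j h1 h2
    have eL : leftHeckeStep j w = w * simpleRefl n i := by
      rw [leftHeckeStep_eq hn, if_pos (by omega), e]
    have eR : heckeStep w i = w * simpleRefl n i := by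
      rw [heckeStep_eq hn, if_pos (by omega)]
    rw [eL, eR, heckeStep_eq hn, mul_simpleRefl_apply_self hn, mul_simpleRefl_apply_succ hn,
      if_neg (by omega), leftHeckeStep_eq hn, if_neg]
    rw [← e, mul_inv_rev, simpleRefl_inv, mul_simpleRefl_apply_self hn,
      mul_simpleRefl_apply_succ hn]
    omega
  -- If the pair arrives reversed, both steps fix w.
  by_cases hs' : (n : ℤ) ∣ (w : Equiv.Perm ℤ) (i + 1) - j ∧
      (w : Equiv.Perm ℤ) i = (w : Equiv.Perm ℤ) (i + 1) + 1
  · obtain ⟨h1, h2⟩ := hs'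
    have eR : heckeStep w i = w := by rw [heckeStep_eq hn, if_neg (by omega)]
    have eL : leftHeckeStep j w = w := by
      rw [leftHeckeStep_eq hn, if_neg]
      have h3 := inv_apply_of_adjacent (w * simpleRefl n i) i j
        (by rwa [mul_simpleRefl_apply_self hn])
        (by rwa [mul_simpleRefl_apply_self hn, mul_simpleRefl_apply_succ hn])
      have e := simpleRefl_mul_eq_mul_simpleRefl hn (w * simpleRefl n i) i j
        (by rwa [mul_simpleRefl_apply_self hn])
        (by rwa [mul_simpleRefl_apply_self hn, mul_simpleRefl_apply_succ hn])
      rw [mul_simpleRefl_cancel] at e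
      rw [← e, mul_inv_rev, simpleRefl_inv, mul_simpleRefl_apply_self hn,
        mul_simpleRefl_apply_succ hn]
      omega
    rw [eL, eR, eL]
  -- In all other cases multiplication on one side does not affect the ascent test on the other.
  have hA : ((simpleRefl n j * w : AffineSymmetricGroup n) : Equiv.Perm ℤ) i <
      ((simpleRefl n j * w : AffineSymmetricGroup n) : Equiv.Perm ℤ) (i + 1) ↔
      (w : Equiv.Perm ℤ) i < (w : Equiv.Perm ℤ) (i + 1) := by
    simp only [Subgroup.coe_mul, Equiv.Perm.mul_apply]
    exact simpleRefl_lt_iff hn j hs hs'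
  have hB : (((w * simpleRefl n i)⁻¹ : AffineSymmetricGroup n) : Equiv.Perm ℤ) j <
      (((w * simpleRefl n i)⁻¹ : AffineSymmetricGroup n) : Equiv.Perm ℤ) (j + 1) ↔
      ((w⁻¹ : AffineSymmetricGroup n) : Equiv.Perm ℤ) j <
        ((w⁻¹ : AffineSymmetricGroup n) : Equiv.Perm ℤ) (j + 1) := by
    rw [mul_inv_rev, simpleRefl_inv]
    simp only [Subgroup.coe_mul, Equiv.Perm.mul_apply]
    refine simpleRefl_lt_iff hn i (fun h => hs ?_) (fun h => hs' ?_)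
    · simpa only [inv_inv] using inv_apply_of_adjacent w⁻¹ j i h.1 h.2
    · have e := inv_apply_of_adjacent (w⁻¹ * simpleRefl n j) j i
        (by rw [mul_simpleRefl_apply_self hn]; exact h.1)
        (by rw [mul_simpleRefl_apply_self hn, mul_simpleRefl_apply_succ hn]; exact h.2)
      rw [mul_inv_rev, inv_inv, simpleRefl_inv] at e
      simp only [Subgroup.coe_mul, Equiv.Perm.mul_apply] at e
      have e3 := simpleRefl_apply_of_dvd hn e.1
      rw [simpleRefl_simpleRefl_apply hn] at e3
      have e4 := simpleRefl_apply_of_dvd_succ hn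
        (k := (simpleRefl n j : Equiv.Perm ℤ) ((w : Equiv.Perm ℤ) (i + 1))) (i := j)
        (by rw [e.2]; convert e.1 using 1; ring)
      rw [simpleRefl_simpleRefl_apply hn] at e4
      refine ⟨?_, by omega⟩
      convert e.1 using 1
      omega
  rw [leftHeckeStep_eq hn, heckeStep_eq hn w]
  split_ifs with h1 h2 h2
  · rw [heckeStep_eq hn, if_pos (hA.2 h2), leftHeckeStep_eq hn, if_pos (hB.2 h1), mul_assoc]
  · rw [heckeStep_eq hn, if_neg (fun h => h2 (hA.1 h)), leftHeckeStep_eq hn, if_pos h1]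
  · rw [heckeStep_eq hn, if_pos h2, leftHeckeStep_eq hn, if_neg (fun h => h1 (hB.1 h))]
  · rw [heckeStep_eq hn, if_neg h2, leftHeckeStep_eq hn, if_neg h1]

theorem IsReducedWord.of_append_left {n : ℕ} (hn : 0 < n) {l m : List ℤ}
    {π : AffineSymmetricGroup n} (h : IsReducedWord (l ++ m) π) :
    IsReducedWord l (wordProd n l) := by
  refine ⟨rfl, le_antisymm ?_ (length_wordProd_le l)⟩
  have h1 := length_mul_le hn (wordProd n l) (wordProd n m)
  have h2 := length_wordProd_le (n := n) m
  rw [← wordProd_append, h.1, ← h.2, List.length_append] at h1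
  omega

theorem IsReducedWord.of_append_right {n : ℕ} (hn : 0 < n) {l m : List ℤ}
    {π : AffineSymmetricGroup n} (h : IsReducedWord (l ++ m) π) :
    IsReducedWord m (wordProd n m) := by
  refine ⟨rfl, le_antisymm ?_ (length_wordProd_le m)⟩
  have h1 := length_mul_le hn (wordProd n l) (wordProd n m)
  have h2 := length_wordProd_le (n := n) l
  rw [← wordProd_append, h.1, ← h.2, List.length_append] at h1
  omega

theorem foldl_heckeStep_one {n : ℕ} (hn : 0 < n) (l : List ℤ) (σ : AffineSymmetricGroup n)
    (h : IsReducedWord l σ) : l.foldl heckeStep 1 = σ := by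
  induction l using List.reverseRecOn generalizing σ with
  | nil => exact h.1
  | append_singleton l i ih =>
    have h1 := h.of_append_left hn
    rw [List.foldl_append, ih _ h1, List.foldl_cons, List.foldl_nil, heckeStep, if_pos]
    · rw [← h.1, wordProd_append]; simp
    · have h2 := h.2
      rw [← h.1, wordProd_append, List.length_append, h1.2] at h2
      simp only [List.length_singleton, wordProd_cons, wordProd_nil, mul_one] at h2
      omega

theorem foldr_leftHeckeStep_one {n : ℕ} (hn : 0 < n) (l : List ℤ) (σ : AffineSymmetricGroup n)
    (h : IsReducedWord l σ) : l.foldr leftHeckeStep 1 = σ := by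
  have e : ∀ l : List ℤ, l.foldr leftHeckeStep 1 =
      (l.reverse.foldl heckeStep (1 : AffineSymmetricGroup n))⁻¹ := by
    intro l
    induction l with
    | nil => simp
    | cons i l ih => simp [List.foldl_append, ih, leftHeckeStep]
  rw [e, foldl_heckeStep_one hn l.reverse σ⁻¹, inv_inv]
  exact ⟨by rw [wordProd_reverse, h.1], by rw [List.length_reverse, h.2, length_inv hn]⟩

/-- Write π as left steps applied to 1. Left steps commute with right steps, so any reduced word of
σ can be folded from 1 first; that gives σ whichever word is used. -/
theorem foldl_heckeStep_eq_heckeMul {n : ℕ} (hn : 2 ≤ n) (π σ : AffineSymmetricGroup n)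
    (l : List ℤ) (h : IsReducedWord l σ) : l.foldl heckeStep π = heckeMul π σ := by
  have hn0 : 0 < n := by omega
  have step : ∀ (l : List ℤ) (w : AffineSymmetricGroup n) (j : ℤ),
      l.foldl heckeStep (leftHeckeStep j w) = leftHeckeStep j (l.foldl heckeStep w) := by
    intro l
    induction l with
    | nil => intros; rfl
    | cons i l ih => intro w j; rw [List.foldl_cons, heckeStep_leftHeckeStep hn, ih, List.foldl_cons]
  have steps : ∀ m l : List ℤ, l.foldl heckeStep (m.foldr leftHeckeStep (1 : AffineSymmetricGroup n))
      = m.foldr leftHeckeStep (l.foldl heckeStep 1) := by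
    intro m l
    induction m with
    | nil => rfl
    | cons j m ih => rw [List.foldr_cons, step, ih, List.foldr_cons]
  obtain ⟨m, hm⟩ := exists_reducedWord hn0 π
  have h' : IsReducedWord (Classical.epsilon fun l : List ℤ => IsReducedWord l σ) σ :=
    Classical.epsilon_spec (p := fun l : List ℤ => IsReducedWord l σ) ⟨l, h⟩
  unfold heckeMul
  rw [← foldr_leftHeckeStep_one hn0 m π hm, steps, steps, foldl_heckeStep_one hn0 _ _ h,
    foldl_heckeStep_one hn0 _ _ h']

/-! ### Diagram automorphisms -/

section automorphism

variable {n : ℕ} (φ : AffineSymmetricGroup n ≃* AffineSymmetricGroup n) (f : ℤ → ℤ)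
  (hf : ∀ i, φ (simpleRefl n i) = simpleRefl n (f i))

include hf

theorem map_wordProd (l : List ℤ) : φ (wordProd n l) = wordProd n (l.map f) := by
  induction l with
  | nil => simp
  | cons i l ih => simp [hf, ih]

theorem length_map_le (hn : 0 < n) (π : AffineSymmetricGroup n) : length (φ π) ≤ length π := by
  obtain ⟨l, rfl, hl⟩ := exists_reducedWord hn π
  rw [map_wordProd φ f hf, ← hl]
  simpa using length_wordProd_le (n := n) (l.map f)

end automorphism

/-- An automorphism permuting the simple reflections, with its action on the indices. -/
structure IsDiagramAutomorphism {n : ℕ} (φ : AffineSymmetricGroup n ≃* AffineSymmetricGroup n)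
    (f g : ℤ → ℤ) : Prop where
  map_simpleRefl : ∀ i, φ (simpleRefl n i) = simpleRefl n (f i)
  symm_simpleRefl : ∀ i, φ.symm (simpleRefl n i) = simpleRefl n (g i)

namespace IsDiagramAutomorphism

variable {n : ℕ} {φ : AffineSymmetricGroup n ≃* AffineSymmetricGroup n} {f g : ℤ → ℤ}

theorem symm (h : IsDiagramAutomorphism φ f g) : IsDiagramAutomorphism φ.symm g f :=
  ⟨h.2, h.1⟩

theorem length_map (h : IsDiagramAutomorphism φ f g) (hn : 0 < n) (π : AffineSymmetricGroup n) :
    length (φ π) = length π := by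
  refine le_antisymm (length_map_le φ f h.1 hn π) ?_
  simpa using length_map_le φ.symm g h.2 hn (φ π)

theorem map_isReducedWord (h : IsDiagramAutomorphism φ f g) (hn : 0 < n) {l : List ℤ}
    {π : AffineSymmetricGroup n} (hl : IsReducedWord l π) : IsReducedWord (l.map f) (φ π) :=
  ⟨by rw [← map_wordProd φ f h.1, hl.1], by rw [List.length_map, hl.2, h.length_map hn]⟩

theorem map_heckeStep (h : IsDiagramAutomorphism φ f g) (hn : 0 < n)
    (w : AffineSymmetricGroup n) (i : ℤ) : φ (heckeStep w i) = heckeStep (φ w) (f i) := by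
  unfold heckeStep
  rw [← h.1, ← map_mul, h.length_map hn, h.length_map hn]
  split_ifs <;> rfl

/-- An automorphism need not send the chosen reduced word of σ to the chosen one of its image, so
independence of the word is essential here. -/
theorem map_heckeMul (h : IsDiagramAutomorphism φ f g) (hn : 2 ≤ n)
    (π σ : AffineSymmetricGroup n) : φ (heckeMul π σ) = heckeMul (φ π) (φ σ) := by
  obtain ⟨l, hl⟩ := exists_reducedWord (by omega) σ
  rw [← foldl_heckeStep_eq_heckeMul hn π σ l hl,
    ← foldl_heckeStep_eq_heckeMul hn _ _ _ (h.map_isReducedWord (by omega) hl)]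
  clear hl
  induction l generalizing π with
  | nil => rfl
  | cons i l ih => rw [List.foldl_cons, ih, List.map_cons, List.foldl_cons, h.map_heckeStep (by omega)]

theorem map_mem_heckeAtoms (h : IsDiagramAutomorphism φ f g) (hn : 2 ≤ n)
    {z π : AffineSymmetricGroup n} (hπ : π ∈ heckeAtoms z) : φ π ∈ heckeAtoms (φ z) := by
  have : heckeMul π⁻¹ π = z := hπ
  change heckeMul (φ π)⁻¹ (φ π) = φ z
  rw [← map_inv, ← h.map_heckeMul hn, this]

theorem map_mem_atoms (h : IsDiagramAutomorphism φ f g) (hn : 2 ≤ n)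
    {z π : AffineSymmetricGroup n} (hπ : π ∈ atoms z) : φ π ∈ atoms (φ z) := by
  refine ⟨h.map_mem_heckeAtoms hn hπ.1, fun σ hσ => ?_⟩
  have h1 := h.symm.map_mem_heckeAtoms hn hσ
  rw [MulEquiv.symm_apply_apply] at h1
  have h2 := hπ.2 _ h1
  rwa [h.symm.length_map (by omega), ← h.length_map (by omega) π] at h2

theorem image_atoms (h : IsDiagramAutomorphism φ f g) (hn : 2 ≤ n)
    (z : AffineSymmetricGroup n) : atoms (φ z) = φ '' atoms z := by
  ext π
  constructor
  · intro hπ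
    have := h.symm.map_mem_atoms hn hπ
    rw [MulEquiv.symm_apply_apply] at this
    exact ⟨_, this, MulEquiv.apply_symm_apply φ π⟩
  · rintro ⟨σ, hσ, rfl⟩
    exact h.map_mem_atoms hn hσ

theorem involutionStanley_map (h : IsDiagramAutomorphism φ f g) (hn : 2 ≤ n)
    (z : AffineSymmetricGroup n) :
    involutionStanley (φ z) = ∑ᶠ π ∈ atoms z, stanley (φ π) := by
  unfold involutionStanley
  rw [h.image_atoms hn, finsum_mem_image φ.injective.injOn]

end IsDiagramAutomorphism

theorem isDiagramAutomorphism_rotate (n : ℕ) :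
    IsDiagramAutomorphism (rotate n) (fun i => i + 1) (fun i => i - 1) :=
  ⟨rotate_simpleRefl n, fun i => by rw [MulEquiv.symm_apply_eq, rotate_simpleRefl, sub_add_cancel]⟩

theorem isDiagramAutomorphism_star (n : ℕ) :
    IsDiagramAutomorphism (star n) (fun i => n - i) (fun i => n - i) :=
  ⟨star_simpleRefl n, fun i => by rw [MulEquiv.symm_apply_eq, star_simpleRefl, sub_sub_cancel]⟩

/-! ### Rotation invariance -/

theorem isCyclicallyDecreasing_rotate {n : ℕ} (hn : 0 < n) {π : AffineSymmetricGroup n}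
    (h : IsCyclicallyDecreasing π) : IsCyclicallyDecreasing (rotate n π) := by
  obtain ⟨l, hl, hp⟩ := h
  refine ⟨_, (isDiagramAutomorphism_rotate n).map_isReducedWord hn hl, ?_⟩
  rw [List.pairwise_map]
  refine hp.imp fun {i k} hik he => hik ((rotate n).injective ?_)
  rw [rotate_simpleRefl, rotate_simpleRefl, he]

theorem isCyclicallyDecreasing_rotate_symm {n : ℕ} (hn : 0 < n) {π : AffineSymmetricGroup n}
    (h : IsCyclicallyDecreasing π) : IsCyclicallyDecreasing ((rotate n).symm π) := by
  obtain ⟨l, hl, hp⟩ := h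
  refine ⟨_, (isDiagramAutomorphism_rotate n).symm.map_isReducedWord hn hl, ?_⟩
  rw [List.pairwise_map]
  refine hp.imp fun {i k} hik he => hik ?_
  rw [← sub_add_cancel k 1, ← rotate_simpleRefl n (k - 1), ← he, rotate_simpleRefl, sub_add_cancel]

theorem isStanleyFactorization_map {n : ℕ}
    (φ : AffineSymmetricGroup n ≃* AffineSymmetricGroup n)
    (hlen : ∀ π, length (φ π) = length π)
    (hcyc : ∀ π, IsCyclicallyDecreasing π → IsCyclicallyDecreasing (φ π))
    {π : AffineSymmetricGroup n} {f : ℕ → AffineSymmetricGroup n}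
    (h : IsStanleyFactorization π f) : IsStanleyFactorization (φ π) (fun i => φ (f i)) := by
  obtain ⟨h1, N, h2, h3, h4⟩ := h
  refine ⟨fun i => hcyc _ (h1 i), N, fun i hi => by simp only [h2 i hi, map_one], ?_, ?_⟩
  · rw [← h3, map_list_prod, List.map_map]
    rfl
  · simp only [hlen, h4]

/-- The affine Stanley symmetric functions are invariant under rotation. -/
theorem stanley_rotate {n : ℕ} (hn : 0 < n) (π : AffineSymmetricGroup n) :
    stanley (rotate n π) = stanley π := by
  have hlen := (isDiagramAutomorphism_rotate n).length_map hn
  have hlen' := (isDiagramAutomorphism_rotate n).symm.length_map hn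
  funext α
  unfold stanley
  congr 1
  symm
  refine Set.ncard_congr (fun f _ i => rotate n (f i)) ?_ ?_ ?_
  · rintro f ⟨h1, h2⟩
    exact ⟨isStanleyFactorization_map _ hlen (fun _ => isCyclicallyDecreasing_rotate hn) h1,
      fun i => by rw [hlen, h2]⟩
  · intro f f' _ _ he
    funext i
    exact (rotate n).injective (congrFun he i)
  · rintro f ⟨h1, h2⟩
    refine ⟨fun i => (rotate n).symm (f i), ⟨?_, fun i => by rw [hlen', h2]⟩, ?_⟩
    · have := isStanleyFactorization_map _ hlen' (fun _ => isCyclicallyDecreasing_rotate_symm hn) h1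
      rwa [MulEquiv.symm_apply_apply] at this
    · funext i
      exact MulEquiv.apply_symm_apply _ _

theorem involutionStanley_rotate {n : ℕ} (hn : 2 ≤ n) (z : AffineSymmetricGroup n) :
    involutionStanley (rotate n z) = involutionStanley z := by
  rw [(isDiagramAutomorphism_rotate n).involutionStanley_map hn]
  simp only [stanley_rotate (show 0 < n by omega)]
  rfl

end AffineStanley
namespace AffineStanley
open Finset

/-! ### Cyclically decreasing elements and proper subsets of `ℤ/n` -/

theorem simpleRefl_apply_zmod {n : ℕ} (hn : 2 ≤ n) (i k : ℤ) :
    (simpleRefl n i : Equiv.Perm ℤ) k =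
      if (k : ZMod n) = i then k + 1 else if (k : ZMod n) = i + 1 then k - 1 else k := by
  have h : ∀ a b : ℤ, (n : ℤ) ∣ a - b ↔ (a : ZMod n) = b := fun a b => by
    rw [eq_comm, ZMod.intCast_eq_intCast_iff_dvd_sub]
  rw [simpleRefl_apply hn, simpleFun]
  simp only [h, Int.cast_add, Int.cast_one]

theorem simpleRefl_congr {n : ℕ} {a b : ℤ} (h : (a : ZMod n) = b) :
    simpleRefl n a = simpleRefl n b := by
  by_cases hn : 2 ≤ n
  · apply Subtype.ext; ext k
    rw [simpleRefl_apply_zmod hn, simpleRefl_apply_zmod hn, h]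
  · simp [simpleRefl, hn]

theorem simpleRefl_eq_iff {n : ℕ} (hn : 2 ≤ n) {a b : ℤ} :
    simpleRefl n a = simpleRefl n b ↔ (a : ZMod n) = b := by
  refine ⟨fun h => ?_, simpleRefl_congr⟩
  have e : (simpleRefl n a : Equiv.Perm ℤ) a = (simpleRefl n b : Equiv.Perm ℤ) a := by rw [h]
  rw [simpleRefl_apply_zmod hn, simpleRefl_apply_zmod hn, if_pos rfl] at e
  by_contra hne
  rw [if_neg hne] at e
  split_ifs at e <;> omega

theorem zmod_one_ne_zero {n : ℕ} (hn : 2 ≤ n) : (1 : ZMod n) ≠ 0 := by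
  have : Fact (1 < n) := ⟨by omega⟩
  exact one_ne_zero

/-- The distance from `a` to the next residue class outside `P`. -/
noncomputable def gap {n : ℕ} (P : Finset (ZMod n)) (a : ZMod n) : ℕ :=
  sInf {k : ℕ | a + k ∉ P}

/-- The least integer `≥ x` whose residue class is outside `P`. -/
noncomputable def skip {n : ℕ} (P : Finset (ZMod n)) (x : ℤ) : ℤ := x + gap P (x : ZMod n)

theorem le_skip {n : ℕ} (P : Finset (ZMod n)) (x : ℤ) : x ≤ skip P x := by
  unfold skip; omega

theorem mem_of_lt_gap {n : ℕ} {P : Finset (ZMod n)} {a : ZMod n} {k : ℕ} (h : k < gap P a) :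
    a + k ∈ P := by
  by_contra h'
  exact Nat.notMem_of_lt_sInf h h'

theorem mem_of_lt_skip {n : ℕ} {P : Finset (ZMod n)} {x y : ℤ} (h : x ≤ y) (h' : y < skip P x) :
    (y : ZMod n) ∈ P := by
  unfold skip at h'
  have := mem_of_lt_gap (P := P) (a := (x : ZMod n)) (k := (y - x).toNat) (by omega)
  have e : (x : ZMod n) + ((y - x).toNat : ℕ) = (y : ZMod n) := by
    rw [← Int.cast_natCast ((y - x).toNat), Int.toNat_of_nonneg (by omega)]
    push_cast; ring
  rwa [e] at this

theorem skip_of_notMem {n : ℕ} {P : Finset (ZMod n)} {x : ℤ}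
    (hx : (x : ZMod n) ∉ P) : skip P x = x := by
  rcases (le_skip P x).lt_or_eq with h | h
  · exact absurd (mem_of_lt_skip le_rfl h) hx
  · exact h.symm

variable {n : ℕ} [NeZero n]

theorem gap_set_nonempty {P : Finset (ZMod n)} (hP : P ≠ univ) (a : ZMod n) :
    {k : ℕ | a + k ∉ P}.Nonempty := by
  obtain ⟨b, hb⟩ : ∃ b, b ∉ P := by
    by_contra! h
    exact hP (Finset.eq_univ_of_forall h)
  exact ⟨(b - a).val, by simpa using hb⟩

theorem add_gap_notMem {P : Finset (ZMod n)} (hP : P ≠ univ) (a : ZMod n) :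
    a + gap P a ∉ P := Nat.sInf_mem (gap_set_nonempty hP a)

theorem skip_notMem {P : Finset (ZMod n)} (hP : P ≠ univ) (x : ℤ) :
    ((skip P x : ℤ) : ZMod n) ∉ P := by
  unfold skip
  push_cast
  exact add_gap_notMem hP _

theorem skip_eq {P : Finset (ZMod n)} (hP : P ≠ univ) {x y : ℤ} (h : x ≤ y)
    (hy : (y : ZMod n) ∉ P) (hz : ∀ z, x ≤ z → z < y → (z : ZMod n) ∈ P) : skip P x = y := by
  rcases lt_trichotomy (skip P x) y with h1 | h1 | h1
  · exact absurd (hz _ (le_skip P x) h1) (skip_notMem hP x)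
  · exact h1
  · exact absurd (mem_of_lt_skip h h1) hy

theorem skip_of_mem {P : Finset (ZMod n)} (hP : P ≠ univ) {x : ℤ}
    (hx : (x : ZMod n) ∈ P) : skip P x = skip P (x + 1) := by
  refine skip_eq hP (by have := le_skip P (x + 1); omega) (skip_notMem hP _) fun z h1 h2 => ?_
  rcases h1.eq_or_lt with rfl | h1
  · exact hx
  · exact mem_of_lt_skip (by omega) h2

/-- The one-line form of the cyclically decreasing element with letters in `P`. -/
noncomputable def cycFun (P : Finset (ZMod n)) (x : ℤ) : ℤ :=
  open Classical in if ((x - 1 : ℤ) : ZMod n) ∈ P then x - 1 else skip P x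

theorem ne_univ_of_notMem {P : Finset (ZMod n)} {a : ZMod n} (h : a ∉ P) : P ≠ univ := by
  rintro rfl
  exact h (Finset.mem_univ _)

theorem erase_ne_univ (P : Finset (ZMod n)) (a : ZMod n) : P.erase a ≠ univ :=
  ne_univ_of_notMem (Finset.notMem_erase a P)

/-- The factor of a run a, …, i of P is s_i ⋯ s_a, so the top letter of a run splits off on the
left. -/
theorem cycFun_eq_simpleRefl_cycFun (hn : 2 ≤ n) {P : Finset (ZMod n)} {i : ℤ}
    (hi : (i : ZMod n) ∈ P) (hi' : (i : ZMod n) + 1 ∉ P) (x : ℤ) :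
    cycFun P x = (simpleRefl n i : Equiv.Perm ℤ) (cycFun (P.erase i) x) := by
  have h10 := zmod_one_ne_zero hn
  have hP := ne_univ_of_notMem hi'
  have hP' := erase_ne_univ P (i : ZMod n)
  rw [simpleRefl_apply_zmod hn]
  by_cases h1 : ((x - 1 : ℤ) : ZMod n) ∈ P
  · by_cases h2 : ((x - 1 : ℤ) : ZMod n) = i
    · have hx : (x : ZMod n) = i + 1 := by rw [← h2]; push_cast; ring
      have e : cycFun (P.erase (i : ZMod n)) x = x := by
        rw [cycFun, if_neg (by simp [h2]), skip_of_notMem]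
        rw [hx]
        exact fun h => hi' (Finset.mem_of_mem_erase h)
      rw [e, cycFun, if_pos h1, if_neg (by simp [hx, h10]), if_pos hx]
    · have e : cycFun (P.erase (i : ZMod n)) x = x - 1 := by
        rw [cycFun, if_pos (Finset.mem_erase.2 ⟨h2, h1⟩)]
      rw [e, cycFun, if_pos h1, if_neg h2,
        if_neg (show ¬ ((x - 1 : ℤ) : ZMod n) = i + 1 from fun h => hi' (h ▸ h1))]
  · have h2 : ((x - 1 : ℤ) : ZMod n) ∉ P.erase (i : ZMod n) :=
      fun h => h1 (Finset.mem_of_mem_erase h)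
    rw [cycFun, if_neg h1, cycFun, if_neg h2]
    set y := skip (P.erase (i : ZMod n)) x with hy
    have hxy : x ≤ y := le_skip _ _
    have hz : ∀ z, x ≤ z → z < y → (z : ZMod n) ∈ P := fun z ha hb =>
      Finset.mem_of_mem_erase (mem_of_lt_skip ha hb)
    -- The skip over `P.erase i` stops in the class of i exactly when it has climbed to the top of
    -- this run; s_i then carries it one further.
    by_cases h3 : (y : ZMod n) = i
    · rw [if_pos h3]
      refine skip_eq hP (by omega) (by push_cast; rwa [h3]) fun z ha hb => ?_
      rcases (show z ≤ y by omega).eq_or_lt with rfl | hb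
      · rwa [h3]
      · exact hz z ha hb
    · have h4 : (y : ZMod n) ∉ P := fun h =>
        skip_notMem hP' x (Finset.mem_erase.2 ⟨h3, h⟩)
      rw [if_neg h3, if_neg, skip_eq hP hxy h4 hz]
      intro h5
      have h6 : ((y - 1 : ℤ) : ZMod n) = i := by push_cast; rw [h5]; ring
      rcases hxy.eq_or_lt with h7 | h7
      · rw [← h7] at h6
        exact h1 (h6 ▸ hi)
      · have := mem_of_lt_skip (P := P.erase (i : ZMod n)) (x := x) (y := y - 1) (by omega)
          (by omega)
        rw [h6] at this
        exact Finset.notMem_erase _ _ this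

theorem skip_erase {P : Finset (ZMod n)} (hP : P ≠ univ) {a : ZMod n} {x : ℤ}
    (h : ∀ z, x ≤ z → z < skip P x → (z : ZMod n) ≠ a) : skip (P.erase a) x = skip P x :=
  skip_eq (erase_ne_univ P a) (le_skip P x)
    (fun h' => skip_notMem hP x (Finset.mem_of_mem_erase h'))
    fun z h1 h2 => Finset.mem_erase.2 ⟨h z h1 h2, mem_of_lt_skip h1 h2⟩

/-- Mirror image: the bottom letter of a run is the last one and splits off on the right. -/
theorem cycFun_eq_cycFun_simpleRefl (hn : 2 ≤ n) {P : Finset (ZMod n)} {a : ℤ}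
    (ha : (a : ZMod n) ∈ P) (ha' : (a : ZMod n) - 1 ∉ P) (x : ℤ) :
    cycFun P x = cycFun (P.erase a) ((simpleRefl n a : Equiv.Perm ℤ) x) := by
  have h10 := zmod_one_ne_zero hn
  have hP := ne_univ_of_notMem ha'
  have key : ∀ x : ℤ, (x : ZMod n) ≠ a → skip (P.erase (a : ZMod n)) x = skip P x := by
    intro x hx
    refine skip_erase hP fun z h1 h2 h3 => ha' ?_
    have : x ≠ z := by rintro rfl; exact hx h3
    have := mem_of_lt_skip (P := P) (x := x) (y := z - 1) (by omega) (by omega)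
    push_cast at this
    rwa [h3] at this
  rw [simpleRefl_apply_zmod hn]
  by_cases h1 : (x : ZMod n) = a
  · rw [if_pos h1, cycFun, if_neg (by push_cast; rwa [h1]), cycFun, if_neg (by simp [h1]),
      key, skip_of_mem hP (h1 ▸ ha)]
    push_cast
    rw [h1]
    simp [h10]
  · by_cases h2 : (x : ZMod n) = a + 1
    · rw [if_neg h1, if_pos h2, cycFun, if_pos (by push_cast; rw [h2]; simpa using ha), cycFun,
        if_neg, skip_of_notMem]
      · push_cast
        simp [h2]
      · push_cast
        intro h
        apply ha'
        have := Finset.mem_of_mem_erase h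
        rw [h2] at this
        simpa using this
    · have h3 : ((x - 1 : ℤ) : ZMod n) ≠ a := fun h => h2 (by rw [← h]; push_cast; ring)
      rw [if_neg h1, if_neg h2, cycFun, cycFun, key x h1]
      simp only [Finset.mem_erase, ne_eq, h3, not_false_eq_true, true_and]

theorem exists_mem_succ_notMem {P : Finset (ZMod n)} (hP : P ≠ univ) (hP' : P.Nonempty) :
    ∃ i ∈ P, i + 1 ∉ P := by
  by_contra! h
  obtain ⟨a, ha⟩ := hP'
  have h1 : ∀ k : ℕ, a + k ∈ P := by
    intro k
    induction k with
    | zero => simpa using ha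
    | succ k ih => have := h _ ih; push_cast; rwa [← add_assoc]
  exact add_gap_notMem hP a (h1 _)

/-- Peel off run tops. When i is removed, i + 1 is not in the remaining set, so i + 1 never occurs
after i: the word is cyclically decreasing by construction. -/
theorem exists_cyc (hn : 2 ≤ n) (P : Finset (ZMod n)) (hP : P ≠ univ) :
    ∃ l : List ℤ, (∀ x, (wordProd n l : Equiv.Perm ℤ) x = cycFun P x) ∧ l.length = P.card ∧
      (∀ k ∈ l, (k : ZMod n) ∈ P) ∧
      l.Pairwise (fun i k => simpleRefl n (i + 1) ≠ simpleRefl n k) := by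
  induction hm : P.card generalizing P with
  | zero =>
    rw [Finset.card_eq_zero] at hm
    subst hm
    refine ⟨[], fun x => ?_, rfl, by simp, List.Pairwise.nil⟩
    rw [cycFun, if_neg (Finset.notMem_empty _), skip_of_notMem (Finset.notMem_empty _)]
    simp
  | succ m ih =>
    obtain ⟨i, hi, hi'⟩ := exists_mem_succ_notMem hP (Finset.card_pos.1 (by omega))
    obtain ⟨i, rfl⟩ := ZMod.intCast_surjective i
    obtain ⟨l, h1, h2, h3, h4⟩ := ih (P.erase (i : ZMod n)) (erase_ne_univ _ _)
      (by rw [Finset.card_erase_of_mem hi]; omega)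
    refine ⟨i :: l, fun x => ?_, by simp [h2], ?_, List.pairwise_cons.2 ⟨fun k hk he => ?_, h4⟩⟩
    · rw [cycFun_eq_simpleRefl_cycFun hn hi hi', ← h1]
      simp
    · intro k hk
      rcases List.mem_cons.1 hk with rfl | hk
      · exact hi
      · exact Finset.mem_of_mem_erase (h3 k hk)
    · rw [simpleRefl_eq_iff hn] at he
      push_cast at he
      exact hi' (he ▸ Finset.mem_of_mem_erase (h3 k hk))

/-- The cyclically decreasing element with letters in the proper subset `P` of `ℤ/n`. -/
noncomputable def cycElt (P : Finset (ZMod n)) : AffineSymmetricGroup n :=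
  Classical.epsilon fun σ => ∀ x, (σ : Equiv.Perm ℤ) x = cycFun P x

theorem cycElt_apply (hn : 2 ≤ n) {P : Finset (ZMod n)} (hP : P ≠ univ) (x : ℤ) :
    (cycElt P : Equiv.Perm ℤ) x = cycFun P x := by
  obtain ⟨l, h, _⟩ := exists_cyc hn P hP
  exact Classical.epsilon_spec
    (p := fun σ : AffineSymmetricGroup n => ∀ x, (σ : Equiv.Perm ℤ) x = cycFun P x) ⟨_, h⟩ x

theorem eq_cycElt (hn : 2 ≤ n) {P : Finset (ZMod n)} (hP : P ≠ univ) {σ : AffineSymmetricGroup n}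
    (h : ∀ x, (σ : Equiv.Perm ℤ) x = cycFun P x) : σ = cycElt P := by
  apply Subtype.ext; ext x
  rw [h, cycElt_apply hn hP]

theorem cycElt_empty (hn : 2 ≤ n) : cycElt (∅ : Finset (ZMod n)) = 1 := by
  refine (eq_cycElt hn (ne_univ_of_notMem (Finset.notMem_empty 0)) fun x => ?_).symm
  rw [cycFun, if_neg (Finset.notMem_empty _), skip_of_notMem (Finset.notMem_empty _)]
  simp

theorem cycElt_eq_simpleRefl_mul (hn : 2 ≤ n) {P : Finset (ZMod n)} {i : ℤ}
    (hi : (i : ZMod n) ∈ P) (hi' : (i : ZMod n) + 1 ∉ P) :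
    cycElt P = simpleRefl n i * cycElt (P.erase (i : ZMod n)) := by
  refine (eq_cycElt hn (ne_univ_of_notMem hi') fun x => ?_).symm
  rw [cycFun_eq_simpleRefl_cycFun hn hi hi', ← cycElt_apply hn (erase_ne_univ _ _)]
  simp

theorem cycElt_eq_mul_simpleRefl (hn : 2 ≤ n) {P : Finset (ZMod n)} {a : ℤ}
    (ha : (a : ZMod n) ∈ P) (ha' : (a : ZMod n) - 1 ∉ P) :
    cycElt P = cycElt (P.erase (a : ZMod n)) * simpleRefl n a := by
  refine (eq_cycElt hn (ne_univ_of_notMem ha') fun x => ?_).symm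
  rw [cycFun_eq_cycFun_simpleRefl hn ha ha', ← cycElt_apply hn (erase_ne_univ _ _)]
  simp

theorem exists_word_cycElt (hn : 2 ≤ n) {P : Finset (ZMod n)} (hP : P ≠ univ) :
    ∃ l : List ℤ, wordProd n l = cycElt P ∧ l.length = P.card ∧
      l.Pairwise (fun i k => simpleRefl n (i + 1) ≠ simpleRefl n k) := by
  obtain ⟨l, h, h2, _, h3⟩ := exists_cyc hn P hP
  exact ⟨l, eq_cycElt hn hP h, h2, h3⟩

theorem length_cycElt_le (hn : 2 ≤ n) {P : Finset (ZMod n)} (hP : P ≠ univ) :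
    length (cycElt P) ≤ P.card := by
  obtain ⟨l, h, h2, _⟩ := exists_word_cycElt hn hP
  rw [← h, ← h2]
  exact length_wordProd_le l

/-- Recovers P from the one-line form, since `skip` never moves down; this is what makes `cycElt`
injective. -/
theorem mem_iff_cycElt_apply (hn : 2 ≤ n) {P : Finset (ZMod n)} (hP : P ≠ univ) (x : ℤ) :
    (x : ZMod n) ∈ P ↔ (cycElt P : Equiv.Perm ℤ) (x + 1) = x := by
  rw [cycElt_apply hn hP, cycFun]
  have h := le_skip P (x + 1)
  split_ifs with h1
  · simpa using h1
  · rw [add_sub_cancel_right] at h1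
    simp only [h1, false_iff]
    omega

theorem cycElt_injective (hn : 2 ≤ n) {P Q : Finset (ZMod n)} (hP : P ≠ univ) (hQ : Q ≠ univ)
    (h : cycElt P = cycElt Q) : P = Q := by
  ext a
  obtain ⟨x, rfl⟩ := ZMod.intCast_surjective a
  rw [mem_iff_cycElt_apply hn hP, mem_iff_cycElt_apply hn hQ, h]

theorem exists_cycElt_of_reduced (hn : 2 ≤ n) (l : List ℤ) (hl : IsReducedWord l (wordProd n l))
    (hp : l.Pairwise (fun i k => simpleRefl n (i + 1) ≠ simpleRefl n k)) :
    ∃ P : Finset (ZMod n), P ≠ univ ∧ wordProd n l = cycElt P ∧ P.card = l.length ∧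
      ∀ p ∈ P, ∃ k ∈ l, (k : ZMod n) = p := by
  induction l with
  | nil =>
    exact ⟨∅, ne_univ_of_notMem (Finset.notMem_empty 0), by rw [cycElt_empty hn]; rfl, rfl, by simp⟩
  | cons i t ih =>
    rw [List.pairwise_cons] at hp
    have ht : IsReducedWord t (wordProd n t) :=
      IsReducedWord.of_append_right (l := [i]) (by omega) hl
    obtain ⟨P, hP, h1, h2, h3⟩ := ih ht hp.2
    have hi' : (i : ZMod n) + 1 ∉ P := fun h => by
      obtain ⟨k, hk, hk'⟩ := h3 _ h
      exact hp.1 k hk (simpleRefl_congr (by rw [hk']; push_cast; rfl))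
    -- As i + 1 is not in P, a repeated i could be brought to the front of the remaining product and
    -- cancelled, contradicting reducedness.
    have hi : (i : ZMod n) ∉ P := by
      intro hi
      have e := cycElt_eq_simpleRefl_mul hn hi hi'
      have e2 : wordProd n (i :: t) = cycElt (P.erase (i : ZMod n)) := by
        rw [wordProd_cons, h1, e, simpleRefl_mul_cancel]
      have h4 := length_cycElt_le hn (erase_ne_univ P (i : ZMod n))
      rw [← e2, ← hl.2, List.length_cons, Finset.card_erase_of_mem hi] at h4
      omega
    have hi'' : (i : ZMod n) + 1 ∉ insert (i : ZMod n) P := by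
      simp [hi', zmod_one_ne_zero hn]
    refine ⟨insert (i : ZMod n) P, ne_univ_of_notMem hi'', ?_, ?_, ?_⟩
    · rw [cycElt_eq_simpleRefl_mul hn (Finset.mem_insert_self _ _) hi'', Finset.erase_insert hi,
        wordProd_cons, h1]
    · rw [Finset.card_insert_of_notMem hi, h2, List.length_cons]
    · intro p hp
      rcases Finset.mem_insert.1 hp with rfl | hp
      · exact ⟨i, by simp, rfl⟩
      · obtain ⟨k, hk, hk'⟩ := h3 p hp
        exact ⟨k, by simp [hk], hk'⟩

/-- The equality of length and cardinality is kept as a condition rather than proved for all P;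
`consFactor_mem` obtains it from length additivity. -/
theorem isCyclicallyDecreasing_iff (hn : 2 ≤ n) (σ : AffineSymmetricGroup n) :
    IsCyclicallyDecreasing σ ↔
      ∃ P : Finset (ZMod n), P ≠ univ ∧ σ = cycElt P ∧ length σ = P.card := by
  constructor
  · rintro ⟨l, ⟨rfl, hl⟩, hp⟩
    obtain ⟨P, h1, h2, h3, _⟩ := exists_cycElt_of_reduced hn l ⟨rfl, hl⟩ hp
    exact ⟨P, h1, h2, by omega⟩
  · rintro ⟨P, hP, rfl, h⟩
    obtain ⟨l, h1, h2, h3⟩ := exists_word_cycElt hn hP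
    exact ⟨l, ⟨h1, by omega⟩, h3⟩

theorem image_neg_ne_univ {P : Finset (ZMod n)} (hP : P ≠ univ) :
    P.image (fun x => -x) ≠ univ := by
  intro h
  apply hP
  refine Finset.eq_univ_of_card _ ?_
  rw [← Finset.card_image_of_injective P neg_injective, ← Finset.card_univ, ← h]

/-- The star sends s_i to s_{-i}, so the top of a run of P becomes the bottom of a run of -P; peel
the letter off at the matching ends. -/
theorem star_cycElt (hn : 2 ≤ n) {P : Finset (ZMod n)} (hP : P ≠ univ) :
    star n (cycElt P) = (cycElt (P.image fun x => -x))⁻¹ := by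
  induction hm : P.card generalizing P with
  | zero =>
    rw [Finset.card_eq_zero] at hm
    subst hm
    simp [cycElt_empty hn]
  | succ m ih =>
    obtain ⟨i, hi, hi'⟩ := exists_mem_succ_notMem hP (Finset.card_pos.1 (by omega))
    obtain ⟨i, rfl⟩ := ZMod.intCast_surjective i
    have h1 : ((-i : ℤ) : ZMod n) ∈ P.image (fun x => -x) := by simpa using hi
    have h2 : ((-i : ℤ) : ZMod n) - 1 ∉ P.image (fun x => -x) := by
      intro h
      obtain ⟨x, hx, he⟩ := Finset.mem_image.1 h
      apply hi'
      have : x = i + 1 := by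
        rw [← neg_neg x, he]; push_cast; ring
      rwa [← this]
    have h3 : (P.image (fun x => -x)).erase ((-i : ℤ) : ZMod n) =
        (P.erase (i : ZMod n)).image (fun x => -x) := by
      rw [Finset.image_erase neg_injective]
      simp
    have h4 : simpleRefl n (n - i) = simpleRefl n (-i) := simpleRefl_congr (by simp)
    rw [cycElt_eq_simpleRefl_mul hn hi hi', map_mul, star_simpleRefl,
      ih (erase_ne_univ _ _) (by rw [Finset.card_erase_of_mem hi]; omega),
      cycElt_eq_mul_simpleRefl hn h1 h2, h3, mul_inv_rev, simpleRefl_inv, h4]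

end AffineStanley
namespace AffineStanley
open Finset

variable {n : ℕ} [NeZero n]

/-! ### Exchanging a cyclically increasing and a cyclically decreasing factor -/

/-- The permutation of `ℤ/n` sending each element of `E` to the cyclically next one. -/
noncomputable def nextIn (E : Finset (ZMod n)) (a : ZMod n) : ZMod n :=
  if a ∈ E then a + 1 + gap Eᶜ (a + 1) else a

theorem nextIn_of_notMem {E : Finset (ZMod n)} {a : ZMod n} (h : a ∉ E) : nextIn E a = a :=
  if_neg h

theorem nextIn_mem {E : Finset (ZMod n)} {a : ZMod n} (h : a ∈ E) : nextIn E a ∈ E := by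
  rw [nextIn, if_pos h]
  simpa using add_gap_notMem (P := Eᶜ) (ne_univ_of_notMem (a := a) (by simpa using h)) (a + 1)

theorem nextIn_mem_iff {E : Finset (ZMod n)} {a : ZMod n} : nextIn E a ∈ E ↔ a ∈ E := by
  refine ⟨fun h => ?_, nextIn_mem⟩
  by_contra h'
  rw [nextIn_of_notMem h'] at h
  exact h' h

theorem nextIn_of_succ_mem {E : Finset (ZMod n)} {a : ZMod n} (h : a ∈ E) (h' : a + 1 ∈ E) :
    nextIn E a = a + 1 := by
  have : gap Eᶜ (a + 1) = 0 := by
    rw [gap, Nat.sInf_eq_zero]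
    left
    simpa using h'
  rw [nextIn, if_pos h, this]
  simp

theorem nextIn_injective (E : Finset (ZMod n)) : Function.Injective (nextIn E) := by
  have key : ∀ a b, a ∈ E → b ∈ E → nextIn E a = nextIn E b →
      gap Eᶜ (a + 1) ≤ gap Eᶜ (b + 1) → a = b := by
    intro a b ha hb h hle
    rw [nextIn, nextIn, if_pos ha, if_pos hb] at h
    obtain ⟨d, hd⟩ := Nat.exists_eq_add_of_le hle
    rw [hd] at h
    push_cast at h
    -- So a lies d steps after b, and for d > 0 it falls among the classes skipped between b and its
    -- successor in E, hence outside E.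
    have h1 : a = b + d := by linear_combination h
    rcases d with _ | d
    · simpa using h1
    · have := mem_of_lt_gap (P := Eᶜ) (a := b + 1) (k := d) (by omega)
      rw [Finset.mem_compl] at this
      exact absurd ha (by rw [h1]; push_cast; rwa [add_comm (d : ZMod n) 1, ← add_assoc])
  intro a b h
  by_cases ha : a ∈ E
  · have hb : b ∈ E := nextIn_mem_iff.1 (h ▸ nextIn_mem ha)
    rcases le_total (gap Eᶜ (a + 1)) (gap Eᶜ (b + 1)) with h1 | h1
    · exact key a b ha hb h h1
    · exact (key b a hb ha h.symm h1).symm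
  · have hb : b ∉ E := fun hb => ha (nextIn_mem_iff.1 (h ▸ nextIn_mem hb))
    rwa [nextIn_of_notMem ha, nextIn_of_notMem hb] at h

theorem nextIn_surjective (E : Finset (ZMod n)) : Function.Surjective (nextIn E) :=
  Finite.surjective_of_injective (nextIn_injective E)

theorem image_nextIn_self (E : Finset (ZMod n)) : E.image (nextIn E) = E := by
  ext a
  obtain ⟨b, rfl⟩ := nextIn_surjective E a
  rw [(nextIn_injective E).mem_finset_image, nextIn_mem_iff]

/-- If the predecessor of `a ∈ E` is outside `E`, then `a` is the image of an element of `E` whose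
successor is outside `E`. -/
theorem exists_nextIn_eq {E : Finset (ZMod n)} {a : ZMod n} (h : a + 1 ∈ E) (h' : a ∉ E) :
    ∃ e ∈ E, e + 1 ∉ E ∧ nextIn E e = a + 1 := by
  obtain ⟨e, he⟩ := nextIn_surjective E (a + 1)
  have heE : e ∈ E := nextIn_mem_iff.1 (he ▸ h)
  refine ⟨e, heE, fun h1 => h' ?_, he⟩
  rw [nextIn_of_succ_mem heE h1] at he
  rwa [← add_right_cancel he]

/-- If the successor of `e ∈ E` is outside `E`, then so is the predecessor of its image. -/
theorem nextIn_sub_one_notMem {E : Finset (ZMod n)} {e : ZMod n} (h : e ∈ E) (h' : e + 1 ∉ E) :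
    nextIn E e - 1 ∉ E := by
  have h0 : gap Eᶜ (e + 1) ≠ 0 := by
    intro h0
    have := nextIn_mem h
    rw [nextIn, if_pos h, h0] at this
    exact h' (by simpa using this)
  obtain ⟨d, hd⟩ := Nat.exists_eq_succ_of_ne_zero h0
  have := mem_of_lt_gap (P := Eᶜ) (a := e + 1) (k := d) (by omega)
  rw [Finset.mem_compl] at this
  rw [nextIn, if_pos h, hd]
  convert this using 1
  push_cast
  ring_nf

section exchange

variable {P Q P' Q' : Finset (ZMod n)}

/-- Inside a run of P ∪ Q the set P' is P moved up by one, so the skip along P' from x + 1 shadows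
the skip along P from x, one step ahead. Where it stops, `cycFun Q` repairs the offset. -/
theorem cycFun_skip_exchange (hP : P ≠ univ) (hP' : P' ≠ univ)
    (h1 : ∀ x, x ∈ P ∪ Q → x + 1 ∈ P ∪ Q → (x + 1 ∈ P' ↔ x ∈ P))
    (hE : ∀ x, x ∈ P' → x ∈ P ∪ Q)
    (h2 : ∀ x, x ∈ P → x ∈ Q → x + 1 ∈ P ∪ Q) (x : ℤ) (hx : (x : ZMod n) ∈ P ∪ Q) :
    cycFun Q (skip P' (x + 1)) = skip P x := by
  induction hm : (skip P' (x + 1) - x).toNat using Nat.strong_induction_on generalizing x with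
  | _ m ih =>
  by_cases h3 : ((x + 1 : ℤ) : ZMod n) ∈ P'
  · have h4 := hE _ h3
    have h5 := h3
    push_cast at h4 h5
    have h6 : (x : ZMod n) ∈ P := (h1 _ hx h4).1 h5
    rw [skip_of_mem hP h6, skip_of_mem hP' h3]
    have h7 := le_skip P' (x + 1)
    have h8 := le_skip P' (x + 1 + 1)
    refine ih _ ?_ (x + 1) (by push_cast; exact h4) rfl
    rw [← hm, skip_of_mem hP' h3]
    omega
  · rw [skip_of_notMem h3, cycFun, add_sub_cancel_right]
    by_cases h4 : (x : ZMod n) + 1 ∈ P ∪ Q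
    · have h5 : (x : ZMod n) ∉ P := fun h => h3 (by push_cast; exact (h1 _ hx h4).2 h)
      rw [skip_of_notMem h5, if_pos ((Finset.mem_union.1 hx).resolve_left h5)]
    · by_cases h5 : (x : ZMod n) ∈ Q
      · rw [if_pos h5, skip_of_notMem (fun h => h4 (h2 _ h h5))]
      · have h6 := (Finset.mem_union.1 hx).resolve_right h5
        rw [Finset.mem_union, not_or] at h4
        rw [if_neg h5, skip_of_mem hP h6, skip_of_notMem (by push_cast; exact h4.2),
          skip_of_notMem (by push_cast; exact h4.1)]

/-- At the argument x + 1 the test in `cycFun` concerns x, so the cases are which of P', Q' contain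
x. The hypotheses `h2` and `h3` exclude a letter shared at the top of a run by P and Q, or at the
bottom of a run by P' and Q', where it would cancel. -/
theorem cycFun_cycFun_exchange (hP : P ≠ univ) (hQ : Q ≠ univ) (hP' : P' ≠ univ) (hQ' : Q' ≠ univ)
    (h1 : ∀ x, x ∈ P ∪ Q → x + 1 ∈ P ∪ Q → (x + 1 ∈ P' ↔ x ∈ P))
    (h1' : ∀ x, x ∈ P ∪ Q → x + 1 ∈ P ∪ Q → (x + 1 ∈ Q' ↔ x ∈ Q))
    (hE : P' ∪ Q' = P ∪ Q)
    (h2 : ∀ x, x ∈ P → x ∈ Q → x + 1 ∈ P ∪ Q)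
    (h3 : ∀ x, x + 1 ∈ P' → x + 1 ∈ Q' → x ∈ P ∪ Q) (x : ℤ) :
    cycFun P (cycFun Q' (x + 1)) = cycFun Q (cycFun P' (x + 1)) := by
  have hE1 : ∀ x, x ∈ P' → x ∈ P ∪ Q := fun x h => hE ▸ Finset.mem_union_left _ h
  have hE2 : ∀ x, x ∈ Q' → x ∈ P ∪ Q := fun x h => hE ▸ Finset.mem_union_right _ h
  have keyP := cycFun_skip_exchange hP hP' h1 hE1 h2
  have keyQ : ∀ x : ℤ, (x : ZMod n) ∈ P ∪ Q → cycFun P (skip Q' (x + 1)) = skip Q x := by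
    have := cycFun_skip_exchange (P := Q) (Q := P) hQ hQ' (by rwa [Finset.union_comm])
      (by rwa [Finset.union_comm]) (by rw [Finset.union_comm]; exact fun x a b => h2 x b a)
    rwa [Finset.union_comm] at this
  have hpred : ((x - 1 : ℤ) : ZMod n) + 1 = x := by push_cast; ring
  have hcyc : ∀ S : Finset (ZMod n), cycFun S (x + 1) =
      if (x : ZMod n) ∈ S then x else skip S (x + 1) := fun S => by
    rw [cycFun, add_sub_cancel_right]
  have hskip : ∀ S : Finset (ZMod n), ((x - 1 : ℤ) : ZMod n) ∉ S → cycFun S x = skip S x :=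
    fun S h => by rw [cycFun, if_neg h]
  have hpredP : (x : ZMod n) ∈ P ∪ Q → (x : ZMod n) ∉ P' → ((x - 1 : ℤ) : ZMod n) ∉ P :=
    fun hx hx' h => hx' (by
      have := (h1 _ (Finset.mem_union_left _ h) (by rwa [hpred])).2 h
      rwa [hpred] at this)
  have hpredQ : (x : ZMod n) ∈ P ∪ Q → (x : ZMod n) ∉ Q' → ((x - 1 : ℤ) : ZMod n) ∉ Q :=
    fun hx hx' h => hx' (by
      have := (h1' _ (Finset.mem_union_right _ h) (by rwa [hpred])).2 h
      rwa [hpred] at this)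
  rw [hcyc, hcyc]
  by_cases hx : (x : ZMod n) ∈ P' <;> by_cases hx' : (x : ZMod n) ∈ Q'
  -- Both inner maps send x + 1 to x; then x - 1 lies in both P and Q, and both outer maps send x to
  -- x - 1.
  · have h4 := h3 ((x - 1 : ℤ) : ZMod n) (by rwa [hpred]) (by rwa [hpred])
    have h5 : ((x - 1 : ℤ) : ZMod n) ∈ P :=
      (h1 _ h4 (by rw [hpred]; exact hE1 _ hx)).1 (by rwa [hpred])
    have h6 : ((x - 1 : ℤ) : ZMod n) ∈ Q :=
      (h1' _ h4 (by rw [hpred]; exact hE1 _ hx)).1 (by rwa [hpred])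
    rw [if_pos hx, if_pos hx', cycFun, if_pos h5, cycFun, if_pos h6]
  · rw [if_pos hx, if_neg hx', keyQ x (hE1 _ hx), hskip Q (hpredQ (hE1 _ hx) hx')]
  · rw [if_neg hx, if_pos hx', keyP x (hE2 _ hx'), hskip P (hpredP (hE2 _ hx') hx)]
  · have hxE : (x : ZMod n) ∉ P ∪ Q := by
      rw [← hE, Finset.mem_union]; tauto
    have hxP : (x : ZMod n) ∉ P := fun h => hxE (Finset.mem_union_left _ h)
    have hxQ : (x : ZMod n) ∉ Q := fun h => hxE (Finset.mem_union_right _ h)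
    have hcP : cycFun P (x + 1) = skip P (x + 1) := by rw [hcyc, if_neg hxP]
    have hcQ : cycFun Q (x + 1) = skip Q (x + 1) := by rw [hcyc, if_neg hxQ]
    rw [if_neg hx, if_neg hx']
    by_cases hy : ((x + 1 : ℤ) : ZMod n) ∈ P'
    · have hy' : ((x + 1 : ℤ) : ZMod n) ∉ Q' := fun h => hxE (h3 _ (by simpa using hy)
        (by simpa using h))
      rw [skip_of_notMem hy', skip_of_mem hP' hy, keyP _ (hE1 _ hy), hcP]
    · by_cases hy' : ((x + 1 : ℤ) : ZMod n) ∈ Q'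
      · rw [skip_of_notMem hy, skip_of_mem hQ' hy', keyQ _ (hE2 _ hy'), hcQ]
      · have hyE : ((x + 1 : ℤ) : ZMod n) ∉ P ∪ Q := by
          rw [← hE, Finset.mem_union]; tauto
        rw [skip_of_notMem hy, skip_of_notMem hy', hcP, hcQ,
          skip_of_notMem (fun h => hyE (Finset.mem_union_left _ h)),
          skip_of_notMem (fun h => hyE (Finset.mem_union_right _ h))]

end exchange

theorem image_ne_univ_iff {f : ZMod n → ZMod n} (hf : Function.Injective f)
    {P : Finset (ZMod n)} : P.image f ≠ univ ↔ P ≠ univ := by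
  rw [not_iff_not, ← Finset.card_eq_iff_eq_univ, ← Finset.card_eq_iff_eq_univ,
    Finset.card_image_of_injective _ hf]

/-- The exchange of an increasing and a decreasing factor, on pairs of sets of letters. -/
noncomputable def exchange (p : Finset (ZMod n) × Finset (ZMod n)) :
    Finset (ZMod n) × Finset (ZMod n) :=
  (p.1.image (nextIn (p.1 ∪ p.2)), p.2.image (nextIn (p.1 ∪ p.2)))

theorem exchange_union (p : Finset (ZMod n) × Finset (ZMod n)) :
    (exchange p).1 ∪ (exchange p).2 = p.1 ∪ p.2 := by
  rw [exchange, ← Finset.image_union, image_nextIn_self]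

/-- The union is preserved, so the map `nextIn` that was applied is known from the result and can be
undone. -/
theorem exchange_injective : Function.Injective (exchange (n := n)) := by
  intro p q h
  have hU : p.1 ∪ p.2 = q.1 ∪ q.2 := by rw [← exchange_union p, h, exchange_union]
  have h1 := congrArg Prod.fst h
  have h2 := congrArg Prod.snd h
  simp only [exchange, hU] at h1 h2
  exact Prod.ext (Finset.image_injective (nextIn_injective _) h1)
    (Finset.image_injective (nextIn_injective _) h2)

/-- `exchange` as a permutation. -/
noncomputable def exchangeEquiv :
    Finset (ZMod n) × Finset (ZMod n) ≃ Finset (ZMod n) × Finset (ZMod n) :=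
  Equiv.ofBijective exchange (Finite.injective_iff_bijective.1 exchange_injective)

theorem inv_cycElt_mul_cycElt (hn : 2 ≤ n) {P Q : Finset (ZMod n)} (hP : P ≠ univ) (hQ : Q ≠ univ)
    (h2 : ∀ x, x ∈ P → x ∈ Q → x + 1 ∈ P ∪ Q) :
    (cycElt P)⁻¹ * cycElt Q = cycElt (exchange (P, Q)).2 * (cycElt (exchange (P, Q)).1)⁻¹ := by
  set E := P ∪ Q with hE
  have hinj := nextIn_injective E
  have hP' : P.image (nextIn E) ≠ univ := (image_ne_univ_iff hinj).2 hP
  have hQ' : Q.image (nextIn E) ≠ univ := (image_ne_univ_iff hinj).2 hQ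
  -- Clearing inverses leaves c_Q c_{P'} = c_P c_{Q'}, an identity between explicit maps.
  rw [inv_mul_eq_iff_eq_mul, ← mul_assoc, eq_mul_inv_iff_mul_eq]
  simp only [exchange, ← hE]
  symm
  apply Subtype.ext; ext x
  simp only [Subgroup.coe_mul, Equiv.Perm.mul_apply, cycElt_apply hn hP, cycElt_apply hn hQ,
    cycElt_apply hn hP', cycElt_apply hn hQ']
  have := cycFun_cycFun_exchange hP hQ hP' hQ' ?_ ?_ ?_ h2 ?_ (x - 1)
  · simpa using this
  · intro x hx hx'
    rw [← nextIn_of_succ_mem hx hx', hinj.mem_finset_image]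
  · intro x hx hx'
    rw [← nextIn_of_succ_mem hx hx', hinj.mem_finset_image]
  · rw [← Finset.image_union, ← hE, image_nextIn_self]
  · intro y hy hy'
    by_contra h
    have hy1 : y + 1 ∈ E := by
      rw [← image_nextIn_self E, hE]
      exact Finset.image_subset_image Finset.subset_union_left hy
    -- A run bottom of E is the `nextIn` image of the top of the preceding run; a letter shared
    -- there would come from a shared top, which `h2` excludes.
    obtain ⟨e, _, he2, he3⟩ := exists_nextIn_eq hy1 h
    rw [← he3, hinj.mem_finset_image] at hy hy'
    exact he2 (h2 e hy hy')

/-- The shared run top can be taken as the first letter of both elements, so it cancels in the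
middle of the product. -/
theorem length_inv_cycElt_mul_lt (hn : 2 ≤ n) {P Q : Finset (ZMod n)} {i : ZMod n}
    (hiP : i ∈ P) (hiQ : i ∈ Q) (hi : i + 1 ∉ P ∪ Q) :
    length ((cycElt P)⁻¹ * cycElt Q) < P.card + Q.card := by
  obtain ⟨i, rfl⟩ := ZMod.intCast_surjective i
  rw [Finset.mem_union, not_or] at hi
  rw [cycElt_eq_simpleRefl_mul hn hiP hi.1, cycElt_eq_simpleRefl_mul hn hiQ hi.2, mul_inv_rev,
    simpleRefl_inv, mul_assoc, simpleRefl_mul_cancel]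
  have h1 := length_mul_le (show 0 < n by omega) (cycElt (P.erase (i : ZMod n)))⁻¹
    (cycElt (Q.erase (i : ZMod n)))
  rw [length_inv (by omega)] at h1
  have h2 := length_cycElt_le hn (erase_ne_univ P (i : ZMod n))
  have h3 := length_cycElt_le hn (erase_ne_univ Q (i : ZMod n))
  have h4 := Finset.card_erase_lt_of_mem hiP
  have h5 := Finset.card_erase_lt_of_mem hiQ
  omega

theorem length_cycElt_mul_inv_lt (hn : 2 ≤ n) {P Q : Finset (ZMod n)} {i : ZMod n}
    (hiP : i ∈ P) (hiQ : i ∈ Q) (hi : i - 1 ∉ P ∪ Q) :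
    length (cycElt Q * (cycElt P)⁻¹) < P.card + Q.card := by
  obtain ⟨i, rfl⟩ := ZMod.intCast_surjective i
  rw [Finset.mem_union, not_or] at hi
  rw [cycElt_eq_mul_simpleRefl hn hiP hi.1, cycElt_eq_mul_simpleRefl hn hiQ hi.2, mul_inv_rev,
    simpleRefl_inv, mul_assoc, simpleRefl_mul_cancel]
  have h1 := length_mul_le (show 0 < n by omega) (cycElt (Q.erase (i : ZMod n)))
    (cycElt (P.erase (i : ZMod n)))⁻¹
  rw [length_inv (by omega)] at h1
  have h2 := length_cycElt_le hn (erase_ne_univ P (i : ZMod n))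
  have h3 := length_cycElt_le hn (erase_ne_univ Q (i : ZMod n))
  have h4 := Finset.card_erase_lt_of_mem hiP
  have h5 := Finset.card_erase_lt_of_mem hiQ
  omega

/-! ### Operators on functions on the affine symmetric group -/

/-- The operator `f ↦ (w ↦ f (w g))`, restricted to those `w` with `ℓ(w g) = ℓ(w) + d`. -/
noncomputable def stepOp (d : ℕ) (g : AffineSymmetricGroup n) :
    Module.End ℚ (AffineSymmetricGroup n → ℚ) where
  toFun f w := if length (w * g) = length w + d then f (w * g) else 0
  map_add' f f' := by funext w; simp only [Pi.add_apply]; split_ifs <;> simp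
  map_smul' c f := by funext w; simp only [Pi.smul_apply]; split_ifs <;> simp

theorem stepOp_apply {n : ℕ} (d : ℕ) (g : AffineSymmetricGroup n) (f : AffineSymmetricGroup n → ℚ)
    (w : AffineSymmetricGroup n) :
    stepOp d g f w = if length (w * g) = length w + d then f (w * g) else 0 := rfl

/-- By subadditivity, a total gain of d + e forces gains of exactly d and then e, so upper bounds on
the two lengths are enough. -/
theorem stepOp_mul_stepOp {n : ℕ} (hn : 0 < n) {d e : ℕ} {g h : AffineSymmetricGroup n}
    (hg : length g ≤ d) (hh : length h ≤ e) :
    stepOp d g * stepOp e h = stepOp (d + e) (g * h) := by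
  apply LinearMap.ext; intro f; funext w
  rw [Module.End.mul_apply, stepOp_apply, stepOp_apply, stepOp_apply, ← mul_assoc]
  have h1 := length_mul_le hn w g
  have h2 := length_mul_le hn (w * g) h
  split_ifs <;> first | rfl | omega

theorem stepOp_eq_zero {n : ℕ} (hn : 0 < n) {d : ℕ} {g : AffineSymmetricGroup n} (hg : length g < d) :
    stepOp d g = 0 := by
  apply LinearMap.ext; intro f; funext w
  have h1 := length_mul_le hn w g
  rw [stepOp_apply, if_neg (by omega)]
  rfl

theorem stepOp_zero_one {n : ℕ} : stepOp 0 (1 : AffineSymmetricGroup n) = 1 := by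
  apply LinearMap.ext; intro f; funext w
  simp [stepOp_apply]

/-- The proper subsets of `ℤ/n` with `k` elements. -/
noncomputable def properSubsets (n : ℕ) [NeZero n] (k : ℕ) : Finset (Finset (ZMod n)) :=
  univ.filter fun P => P ≠ univ ∧ P.card = k

theorem mem_properSubsets {k : ℕ} {P : Finset (ZMod n)} :
    P ∈ properSubsets n k ↔ P ≠ univ ∧ P.card = k := by simp [properSubsets]

theorem properSubsets_zero : properSubsets n 0 = {∅} := by
  ext P
  rw [mem_properSubsets, Finset.card_eq_zero, Finset.mem_singleton, and_iff_right_iff_imp]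
  rintro rfl
  exact ne_univ_of_notMem (Finset.notMem_empty 0)

theorem properSubsets_eq_empty {k : ℕ} (hk : n ≤ k) : properSubsets n k = ∅ := by
  ext P
  simp only [mem_properSubsets, Finset.notMem_empty, iff_false, not_and]
  intro h h'
  have h1 := Finset.card_lt_univ_of_notMem (s := P)
    (x := (not_forall.1 fun h2 => h (Finset.eq_univ_of_forall h2)).choose)
    (not_forall.1 fun h2 => h (Finset.eq_univ_of_forall h2)).choose_spec
  rw [ZMod.card] at h1
  omega

/-- The operator attached to the sum of all cyclically decreasing elements of length `k`. -/
noncomputable def hOp (n : ℕ) [NeZero n] (k : ℕ) : Module.End ℚ (AffineSymmetricGroup n → ℚ) :=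
  ∑ P ∈ properSubsets n k, stepOp k (cycElt P)

/-- The operator attached to the sum of all cyclically increasing elements of length `k`. -/
noncomputable def eOp (n : ℕ) [NeZero n] (k : ℕ) : Module.End ℚ (AffineSymmetricGroup n → ℚ) :=
  ∑ P ∈ properSubsets n k, stepOp k (cycElt P)⁻¹

theorem hOp_zero (hn : 2 ≤ n) : hOp n 0 = 1 := by
  simp [hOp, properSubsets_zero, cycElt_empty hn, stepOp_zero_one]

theorem eOp_zero (hn : 2 ≤ n) : eOp n 0 = 1 := by
  simp [eOp, properSubsets_zero, cycElt_empty hn, stepOp_zero_one]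

theorem hOp_eq_zero {k : ℕ} (hk : n ≤ k) : hOp n k = 0 := by
  simp [hOp, properSubsets_eq_empty hk]

theorem eOp_eq_zero {k : ℕ} (hk : n ≤ k) : eOp n k = 0 := by
  simp [eOp, properSubsets_eq_empty hk]

theorem eOp_mul_hOp (hn : 2 ≤ n) (i j : ℕ) :
    eOp n i * hOp n j = ∑ p ∈ properSubsets n i ×ˢ properSubsets n j,
      stepOp (i + j) ((cycElt p.1)⁻¹ * cycElt p.2) := by
  rw [eOp, hOp, Finset.sum_mul_sum, Finset.sum_product]
  refine Finset.sum_congr rfl fun P hP => Finset.sum_congr rfl fun Q hQ => ?_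
  rw [mem_properSubsets] at hP hQ
  refine stepOp_mul_stepOp (by omega) ?_ ?_
  · rw [length_inv (by omega), ← hP.2]
    exact length_cycElt_le hn hP.1
  · rw [← hQ.2]
    exact length_cycElt_le hn hQ.1

theorem hOp_mul_eOp (hn : 2 ≤ n) (i j : ℕ) :
    hOp n j * eOp n i = ∑ p ∈ properSubsets n i ×ˢ properSubsets n j,
      stepOp (i + j) (cycElt p.2 * (cycElt p.1)⁻¹) := by
  rw [eOp, hOp, Finset.sum_mul_sum, Finset.sum_product_right]
  refine Finset.sum_congr rfl fun Q hQ => Finset.sum_congr rfl fun P hP => ?_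
  rw [mem_properSubsets] at hP hQ
  rw [add_comm i j]
  refine stepOp_mul_stepOp (by omega) ?_ ?_
  · rw [← hQ.2]
    exact length_cycElt_le hn hQ.1
  · rw [length_inv (by omega), ← hP.2]
    exact length_cycElt_le hn hP.1

/-- The exchange is a bijection preserving both cardinalities, and it matches the terms of the two
expanded products. -/
theorem eOp_hOp_commute (hn : 2 ≤ n) (i j : ℕ) : Commute (eOp n i) (hOp n j) := by
  rw [Commute, SemiconjBy, eOp_mul_hOp hn, hOp_mul_eOp hn]
  refine Finset.sum_equiv exchangeEquiv ?_ ?_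
  · rintro ⟨P, Q⟩
    have hinj := nextIn_injective (P ∪ Q)
    simp only [Finset.mem_product, mem_properSubsets, exchangeEquiv, Equiv.ofBijective_apply,
      exchange, image_ne_univ_iff hinj, Finset.card_image_of_injective _ hinj]
  · rintro ⟨P, Q⟩ hPQ
    simp only [Finset.mem_product, mem_properSubsets] at hPQ
    obtain ⟨⟨hP, hPi⟩, hQ, hQj⟩ := hPQ
    simp only [exchangeEquiv, Equiv.ofBijective_apply]
    by_cases h2 : ∀ x, x ∈ P → x ∈ Q → x + 1 ∈ P ∪ Q
    · rw [inv_cycElt_mul_cycElt hn hP hQ h2]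
    -- Here the group elements need not agree, but a run top shared by P and Q is sent to a run
    -- bottom shared by their images. Both products lose length and both operators vanish.
    · push Not at h2
      obtain ⟨x, hxP, hxQ, hx⟩ := h2
      have hinj := nextIn_injective (P ∪ Q)
      have h3 := length_inv_cycElt_mul_lt hn hxP hxQ hx
      have h4 := length_cycElt_mul_inv_lt hn (P := (exchange (P, Q)).1) (Q := (exchange (P, Q)).2)
        (i := nextIn (P ∪ Q) x) (Finset.mem_image_of_mem _ hxP) (Finset.mem_image_of_mem _ hxQ)
        (by rw [exchange_union]; exact nextIn_sub_one_notMem (Finset.mem_union_left _ hxP) hx)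
      rw [show (exchange (P, Q)).1.card = P.card from Finset.card_image_of_injective _ hinj,
        show (exchange (P, Q)).2.card = Q.card from Finset.card_image_of_injective _ hinj] at h4
      rw [stepOp_eq_zero (by omega) (by omega), stepOp_eq_zero (by omega) (by omega)]

/-! ### The alternating relation between the e's and the h's -/

/-- An element of `U` whose successor is outside `U`. -/
noncomputable def lastOf (U : Finset (ZMod n)) : ZMod n :=
  Classical.epsilon fun i => i ∈ U ∧ i + 1 ∉ U

theorem lastOf_spec {U : Finset (ZMod n)} (hU : U ≠ univ) (hU' : U.Nonempty) :
    lastOf U ∈ U ∧ lastOf U + 1 ∉ U := by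
  obtain ⟨i, h⟩ := exists_mem_succ_notMem hU hU'
  exact Classical.epsilon_spec (p := fun i => i ∈ U ∧ i + 1 ∉ U) ⟨i, h⟩

/-- Move the last letter of the union from one set to the other, unless both contain it. -/
noncomputable def toggle (p : Finset (ZMod n) × Finset (ZMod n)) :
    Finset (ZMod n) × Finset (ZMod n) :=
  let i := lastOf (p.1 ∪ p.2)
  if i ∈ p.1 ∧ i ∈ p.2 then p else
    if i ∈ p.1 then (p.1.erase i, insert i p.2) else (insert i p.1, p.2.erase i)

/-- The letter i is last in (c_P)⁻¹ and would be first in the element of `insert i Q`, so it sits at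
the junction and may be counted on either side. -/
theorem inv_cycElt_mul_move (hn : 2 ≤ n) {P Q : Finset (ZMod n)} {i : ZMod n} (hi : i ∈ P)
    (hi' : i ∉ Q) (hP : i + 1 ∉ P) (hQ : i + 1 ∉ Q) :
    (cycElt P)⁻¹ * cycElt Q = (cycElt (P.erase i))⁻¹ * cycElt (insert i Q) := by
  obtain ⟨i, rfl⟩ := ZMod.intCast_surjective i
  rw [cycElt_eq_simpleRefl_mul hn hi hP, cycElt_eq_simpleRefl_mul hn (Finset.mem_insert_self _ Q)
    (by simp [hQ, zmod_one_ne_zero hn]), Finset.erase_insert hi', mul_inv_rev, simpleRefl_inv,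
    mul_assoc]

/-- The Newton-type relation between the two families of operators. -/
theorem sum_eOp_mul_hOp (hn : 2 ≤ n) {k : ℕ} (hk : 0 < k) (hkn : k < n) :
    ∑ i ∈ antidiagonal k, (-1 : ℚ) ^ i.1 • (eOp n i.1 * hOp n i.2) = 0 := by
  classical
  set S : Finset (Finset (ZMod n) × Finset (ZMod n)) :=
    univ.filter fun p => p.1.card + p.2.card = k with hS
  -- The bound k < n makes every set that occurs proper, so S needs no properness condition and is
  -- closed under `toggle`.
  have hproper : ∀ P : Finset (ZMod n), P.card ≤ k → P ≠ univ := by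
    rintro P hP rfl
    rw [Finset.card_univ, ZMod.card] at hP
    omega
  have e1 : ∑ p ∈ S, (-1 : ℚ) ^ p.1.card • stepOp k ((cycElt p.1)⁻¹ * cycElt p.2) =
      ∑ i ∈ antidiagonal k, (-1 : ℚ) ^ i.1 • (eOp n i.1 * hOp n i.2) := by
    rw [← Finset.sum_fiberwise_of_maps_to (s := S) (t := antidiagonal k)
      (g := fun p => (p.1.card, p.2.card)) (fun p hp => by
        rw [HasAntidiagonal.mem_antidiagonal]; simpa [hS] using hp)]
    refine Finset.sum_congr rfl fun i hi => ?_
    rw [HasAntidiagonal.mem_antidiagonal] at hi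
    rw [eOp_mul_hOp hn, Finset.smul_sum]
    refine Finset.sum_congr ?_ fun p hp => ?_
    · ext p
      simp only [hS, Finset.mem_filter, Finset.mem_univ, true_and, Finset.mem_product,
        mem_properSubsets, Prod.ext_iff]
      constructor
      · rintro ⟨h1, h2, h3⟩
        exact ⟨⟨hproper _ (by omega), h2⟩, hproper _ (by omega), h3⟩
      · rintro ⟨⟨_, h2⟩, _, h3⟩
        exact ⟨by omega, h2, h3⟩
    · rw [Finset.mem_product, mem_properSubsets, mem_properSubsets] at hp
      rw [hp.1.2, hi]
  rw [← e1]
  have hlast : ∀ p ∈ S, lastOf (p.1 ∪ p.2) ∈ p.1 ∪ p.2 ∧ lastOf (p.1 ∪ p.2) + 1 ∉ p.1 ∪ p.2 := by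
    intro p hp
    simp only [hS, Finset.mem_filter, Finset.mem_univ, true_and] at hp
    have h1 := Finset.card_union_le p.1 p.2
    refine lastOf_spec (hproper _ (by omega)) ?_
    by_contra h2
    rw [Finset.not_nonempty_iff_eq_empty, Finset.union_eq_empty] at h2
    rw [h2.1, h2.2] at hp
    simp only [Finset.card_empty] at hp
    omega
  -- `toggle` fixes the pairs that share the last letter, which is harmless because their terms
  -- vanish.
  have hboth : ∀ p ∈ S, lastOf (p.1 ∪ p.2) ∈ p.1 → lastOf (p.1 ∪ p.2) ∈ p.2 →
      stepOp k ((cycElt p.1)⁻¹ * cycElt p.2) = 0 := by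
    intro p hp h1 h2
    have h3 := length_inv_cycElt_mul_lt hn h1 h2 (hlast p hp).2
    simp only [hS, Finset.mem_filter, Finset.mem_univ, true_and] at hp
    exact stepOp_eq_zero (by omega) (by omega)
  refine Finset.sum_involution (fun p _ => toggle p) ?_ ?_ ?_ ?_
  · rintro ⟨P, Q⟩ hp
    obtain ⟨h1, h2⟩ := hlast _ hp
    have hb := hboth _ hp
    simp only [toggle] at h1 h2 hb ⊢
    set i := lastOf (P ∪ Q) with hi
    rw [Finset.mem_union] at h1
    rw [Finset.mem_union, not_or] at h2
    by_cases hP : i ∈ P <;> by_cases hQ : i ∈ Q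
    · rw [if_pos ⟨hP, hQ⟩, hb hP hQ, smul_zero, add_zero]
    · rw [if_neg (by tauto), if_pos hP]
      simp only
      rw [inv_cycElt_mul_move hn hP hQ h2.1 h2.2, Finset.card_erase_of_mem hP, ← add_smul]
      obtain ⟨c, hc⟩ := Nat.exists_eq_succ_of_ne_zero (Finset.card_pos.2 ⟨i, hP⟩).ne'
      rw [hc, Nat.succ_sub_one, pow_succ]
      simp
    · rw [if_neg (by tauto), if_neg hP]
      simp only
      have h3 := inv_cycElt_mul_move hn (P := insert i P) (Q := Q.erase i) (i := i)
        (Finset.mem_insert_self _ _) (Finset.notMem_erase _ _)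
        (by simp [h2.1, zmod_one_ne_zero hn]) (fun h => h2.2 (Finset.mem_of_mem_erase h))
      rw [Finset.erase_insert hP, Finset.insert_erase hQ] at h3
      rw [h3, Finset.card_insert_of_notMem hP, ← add_smul, pow_succ]
      simp
    · tauto
  · rintro ⟨P, Q⟩ hp hne heq
    have hb := hboth _ hp
    simp only [toggle] at hb heq
    set i := lastOf (P ∪ Q) with hi
    by_cases hP : i ∈ P <;> by_cases hQ : i ∈ Q
    · exact hne (by simp only; rw [hb hP hQ, smul_zero])
    · rw [if_neg (by tauto), if_pos hP] at heq
      have := congrArg Prod.fst heq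
      exact Finset.notMem_erase i P (by rw [show P.erase i = P from this]; exact hP)
    · rw [if_neg (by tauto), if_neg hP] at heq
      have := congrArg Prod.fst heq
      exact hP (by rw [← show insert i P = P from this]; exact Finset.mem_insert_self _ _)
    · rw [if_neg (by tauto), if_neg hP] at heq
      have := congrArg Prod.fst heq
      exact hP (by rw [← show insert i P = P from this]; exact Finset.mem_insert_self _ _)
  · rintro ⟨P, Q⟩ hp
    obtain ⟨h1, h2⟩ := hlast _ hp
    simp only [hS, Finset.mem_filter, Finset.mem_univ, true_and] at hp ⊢
    simp only [toggle] at h1 ⊢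
    set i := lastOf (P ∪ Q) with hi
    rw [Finset.mem_union] at h1
    by_cases hP : i ∈ P <;> by_cases hQ : i ∈ Q
    · rw [if_pos ⟨hP, hQ⟩]; exact hp
    · rw [if_neg (by tauto), if_pos hP]
      simp only
      have := Finset.card_pos.2 ⟨i, hP⟩
      rw [Finset.card_erase_of_mem hP, Finset.card_insert_of_notMem hQ]
      omega
    · rw [if_neg (by tauto), if_neg hP]
      simp only
      have := Finset.card_pos.2 ⟨i, hQ⟩
      rw [Finset.card_erase_of_mem hQ, Finset.card_insert_of_notMem hP]
      omega
    · tauto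
  · rintro ⟨P, Q⟩ hp
    obtain ⟨h1, h2⟩ := hlast _ hp
    simp only [toggle] at h1 ⊢
    set i := lastOf (P ∪ Q) with hi
    rw [Finset.mem_union] at h1
    by_cases hP : i ∈ P <;> by_cases hQ : i ∈ Q
    · simp only [if_pos (And.intro hP hQ), ← hi]
    -- The union, and with it the chosen letter, is unchanged, so a second toggle undoes the move.
    · have hU : P.erase i ∪ insert i Q = P ∪ Q := by
        ext x
        by_cases hx : x = i
        · subst hx; simp [hP]
        · simp [hx]
      simp only [if_neg (show ¬ (i ∈ P ∧ i ∈ Q) by tauto), if_pos hP, hU, ← hi]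
      simp [hQ, Finset.insert_erase hP]
    · have hU : insert i P ∪ Q.erase i = P ∪ Q := by
        ext x
        by_cases hx : x = i
        · subst hx; simp [hQ]
        · simp [hx]
      simp only [if_neg (show ¬ (i ∈ P ∧ i ∈ Q) by tauto), if_neg hP, hU, ← hi]
      simp [hP, Finset.insert_erase hQ]
    · tauto

/-! ### Solving the alternating relations in a noncommutative ring -/

section ring

variable {R : Type*} [Ring R] [Algebra ℚ R] {e h : ℕ → R} {N : ℕ}

theorem eq_sum_of_newton (h0 : e 0 = 1) {k : ℕ}
    (hk : ∑ i ∈ antidiagonal k, (-1 : ℚ) ^ i.1 • (e i.1 * h i.2) = 0) :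
    h k = -∑ i ∈ (antidiagonal k).erase (0, k), (-1 : ℚ) ^ i.1 • (e i.1 * h i.2) := by
  rw [← Finset.add_sum_erase _ _ (show ((0, k) : ℕ × ℕ) ∈ antidiagonal k by simp)] at hk
  simp only [pow_zero, h0, one_mul, one_smul] at hk
  exact eq_neg_of_add_eq_zero_left hk

/-- The relation writes h i through products of some e with an h of smaller index. The e's commute
with h j by hypothesis and the smaller h's by induction. -/
theorem commute_of_newton (e0 : e 0 = 1) (h0 : h 0 = 1) (hN : ∀ k, N ≤ k → h k = 0)
    (hnewton : ∀ k, 0 < k → k < N →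
      ∑ i ∈ antidiagonal k, (-1 : ℚ) ^ i.1 • (e i.1 * h i.2) = 0)
    (hcomm : ∀ i j, Commute (e i) (h j)) (i j : ℕ) : Commute (h i) (h j) := by
  induction i using Nat.strong_induction_on with
  | _ i ih =>
  rcases Nat.eq_zero_or_pos i with rfl | hi
  · rw [h0]; exact Commute.one_left _
  rcases Nat.lt_or_ge i N with hiN | hiN
  · rw [eq_sum_of_newton e0 (hnewton i hi hiN)]
    refine Commute.neg_left (Commute.sum_left _ _ _ fun a ha => Commute.smul_left ?_ _)
    rw [Finset.mem_erase, HasAntidiagonal.mem_antidiagonal] at ha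
    refine (hcomm _ _).mul_left (ih _ ?_)
    have : a.1 ≠ 0 := fun h' => ha.1 (Prod.ext h' (by simp only; omega))
    omega
  · rw [hN i hiN]; exact Commute.zero_left _

/-- The same relations solved for the e of top index, whose cofactor is h 0 = 1. -/
theorem mem_adjoin_of_newton (h0 : h 0 = 1) (e0 : e 0 = 1) (eN : ∀ k, N ≤ k → e k = 0)
    (hnewton : ∀ k, 0 < k → k < N →
      ∑ i ∈ antidiagonal k, (-1 : ℚ) ^ i.1 • (e i.1 * h i.2) = 0) (k : ℕ) :
    e k ∈ Algebra.adjoin ℚ (Set.range h) := by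
  induction k using Nat.strong_induction_on with
  | _ k ih =>
  rcases Nat.eq_zero_or_pos k with rfl | hk
  · rw [e0]; exact one_mem _
  rcases Nat.lt_or_ge k N with hkN | hkN
  · have h1 := hnewton k hk hkN
    rw [← Finset.add_sum_erase _ _ (show ((k, 0) : ℕ × ℕ) ∈ antidiagonal k by simp)] at h1
    simp only [h0, mul_one] at h1
    have h2 : (-1 : ℚ) ^ k • e k ∈ Algebra.adjoin ℚ (Set.range h) := by
      rw [eq_neg_of_add_eq_zero_left h1]
      refine neg_mem (sum_mem fun a ha => Subalgebra.smul_mem _ (mul_mem (ih _ ?_)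
        (Algebra.subset_adjoin ⟨_, rfl⟩)) _)
      rw [Finset.mem_erase, HasAntidiagonal.mem_antidiagonal] at ha
      have : a.2 ≠ 0 := fun h' => ha.1 (Prod.ext (by simp only; omega) h')
      omega
    have h3 := Subalgebra.smul_mem _ h2 ((-1 : ℚ) ^ k)
    rwa [smul_smul, ← mul_pow, neg_one_mul, neg_neg, one_pow, one_smul] at h3
  · rw [eN k hkN]; exact zero_mem _

end ring

theorem hOp_commute (hn : 2 ≤ n) (i j : ℕ) : Commute (hOp n i) (hOp n j) :=
  commute_of_newton (eOp_zero hn) (hOp_zero hn) (fun _ => hOp_eq_zero)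
    (fun _ => sum_eOp_mul_hOp hn) (eOp_hOp_commute hn) i j

theorem eOp_mem_adjoin (hn : 2 ≤ n) (k : ℕ) :
    eOp n k ∈ Algebra.adjoin ℚ (Set.range (hOp n)) :=
  mem_adjoin_of_newton (hOp_zero hn) (eOp_zero hn) (fun _ => eOp_eq_zero)
    (fun _ => sum_eOp_mul_hOp hn) k

end AffineStanley
namespace AffineStanley
open Finset

variable {n : ℕ} [NeZero n]

/-! ### Coefficients of Stanley symmetric functions through operators -/

/-- Length-additive factorizations of `w⁻¹ π` into cyclically decreasing factors of prescribed
lengths, relative to the left factor `w`. -/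
def factorizations {n : ℕ} (w π : AffineSymmetricGroup n) (a : ℕ → ℕ) :
    Set (ℕ → AffineSymmetricGroup n) :=
  {f | (∀ i, IsCyclicallyDecreasing (f i) ∧ length (f i) = a i) ∧
    ∃ N, (∀ i, N ≤ i → f i = 1) ∧ w * ((List.range N).map f).prod = π ∧
      length w + ∑ i ∈ range N, length (f i) = length π}

theorem stanley_eq_ncard_factorizations {n : ℕ} (π : AffineSymmetricGroup n) (α : ℕ →₀ ℕ) :
    stanley π α = ((factorizations 1 π α).ncard : ℚ) := by
  unfold stanley factorizations IsStanleyFactorization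
  congr 2
  ext f
  simp only [Set.mem_ofPred_eq, one_mul, length_one, zero_add]
  constructor
  · rintro ⟨⟨h1, h2⟩, h3⟩
    exact ⟨fun i => ⟨h1 i, h3 i⟩, h2⟩
  · rintro ⟨h1, h2⟩
    exact ⟨⟨fun i => (h1 i).1, h2⟩, fun i => (h1 i).2⟩

theorem isCyclicallyDecreasing_one {n : ℕ} :
    IsCyclicallyDecreasing (1 : AffineSymmetricGroup n) :=
  ⟨[], ⟨rfl, by rw [length_one]; rfl⟩, List.Pairwise.nil⟩

theorem prod_map_range_succ {M : Type*} [Monoid M] (f : ℕ → M) (N : ℕ) :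
    ((List.range (N + 1)).map f).prod = f 0 * ((List.range N).map fun i => f (i + 1)).prod := by
  rw [List.range_succ_eq_map, List.map_cons, List.prod_cons, List.map_map]
  rfl

open Classical in
theorem factorizations_zero {n : ℕ} (hn : 0 < n) (w π : AffineSymmetricGroup n) (a : ℕ → ℕ)
    (ha : ∀ i, a i = 0) : factorizations w π a = if w = π then {fun _ => 1} else ∅ := by
  ext f
  split_ifs with h
  · subst h
    simp only [Set.mem_singleton_iff]
    constructor
    · rintro ⟨h1, _⟩
      funext i
      exact eq_one_of_length_eq_zero hn (by rw [(h1 i).2, ha])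
    · rintro rfl
      exact ⟨fun i => ⟨isCyclicallyDecreasing_one, by rw [length_one, ha]⟩, 0, by simp⟩
  · simp only [Set.mem_empty_iff_false, iff_false]
    rintro ⟨h1, N, _, h3, _⟩
    have hf : f = fun _ => 1 := funext fun i =>
      eq_one_of_length_eq_zero hn (by rw [(h1 i).2, ha])
    subst hf
    exact h (by simpa using h3)

/-- Prepending a factor. -/
def consFactor {G : Type*} (g : G) (f : ℕ → G) : ℕ → G
  | 0 => g
  | i + 1 => f i

/-- The sets that can index the first factor. -/
abbrev FirstFactor (w : AffineSymmetricGroup n) (k : ℕ) : Type :=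
  {P : Finset (ZMod n) // P ∈ properSubsets n k ∧ length (w * cycElt P) = length w + k}

theorem consFactor_mem (hn : 2 ≤ n) {w π : AffineSymmetricGroup n} {a : ℕ → ℕ}
    {P : Finset (ZMod n)} (hP : P ∈ properSubsets n (a 0))
    (hlen : length (w * cycElt P) = length w + a 0) {f : ℕ → AffineSymmetricGroup n}
    (hf : f ∈ factorizations (w * cycElt P) π (fun i => a (i + 1))) :
    consFactor (cycElt P) f ∈ factorizations w π a := by
  obtain ⟨h1, N, h2, h3, h4⟩ := hf
  rw [mem_properSubsets] at hP
  have h5 := length_mul_le (show 0 < n by omega) w (cycElt P)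
  have h6 := length_cycElt_le hn hP.1
  -- Squeezed between the length gained in the product and the cardinality of P.
  have h7 : length (cycElt P) = a 0 := by omega
  refine ⟨fun i => ?_, N + 1, fun i hi => ?_, ?_, ?_⟩
  · cases i with
    | zero => exact ⟨(isCyclicallyDecreasing_iff hn _).2 ⟨P, hP.1, rfl, h7.trans hP.2.symm⟩, h7⟩
    | succ i => exact h1 i
  · cases i with
    | zero => omega
    | succ i => exact h2 i (by omega)
  · rw [prod_map_range_succ, ← mul_assoc]
    exact h3
  · rw [Finset.sum_range_succ']
    simp only [consFactor]
    omega

theorem exists_of_mem_factorizations (hn : 2 ≤ n) {w π : AffineSymmetricGroup n} {a : ℕ → ℕ}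
    {f : ℕ → AffineSymmetricGroup n} (hf : f ∈ factorizations w π a) :
    ∃ P : Finset (ZMod n), P ∈ properSubsets n (a 0) ∧
      length (w * cycElt P) = length w + a 0 ∧ f 0 = cycElt P ∧
      (fun i => f (i + 1)) ∈ factorizations (w * cycElt P) π (fun i => a (i + 1)) := by
  obtain ⟨h1, N, h2, h3, h4⟩ := hf
  obtain ⟨P, hP, hfP, hlP⟩ := (isCyclicallyDecreasing_iff hn _).1 (h1 0).1
  -- Padding with the trivial factor `f N` guarantees a first factor to split off even when N = 0.
  have h4' : length w + ∑ i ∈ range (N + 1), length (f i) = length π := by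
    rw [Finset.sum_range_succ, h2 N le_rfl, length_one]; omega
  have h3' : w * ((List.range (N + 1)).map f).prod = π := by
    rw [List.range_succ, List.map_append, List.prod_append, ← mul_assoc, h3]
    simp [h2 N le_rfl]
  rw [prod_map_range_succ, ← mul_assoc, hfP] at h3'
  rw [Finset.sum_range_succ', (h1 0).2] at h4'
  have hn0 : 0 < n := by omega
  have h5 := length_mul_le hn0 w (cycElt P)
  have h6 := length_cycElt_le hn hP
  have h7 := length_mul_le hn0 (w * cycElt P) ((List.range N).map fun i => f (i + 1)).prod
  have h8 := length_list_prod_le hn0 ((List.range N).map fun i => f (i + 1))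
  have h9 : (((List.range N).map fun i => f (i + 1)).map length).sum =
      ∑ i ∈ range N, length (f (i + 1)) := by
    rw [List.map_map, Finset.sum_range, ← List.sum_ofFn, List.ofFn_eq_map]
    congr 1
    apply List.ext_getElem <;> simp
  rw [h3'] at h7
  have h10 := (h1 0).2
  -- Additivity of the whole product forces additivity of its first step.
  have h11 : length (w * cycElt P) = length w + a 0 := by omega
  refine ⟨P, mem_properSubsets.2 ⟨hP, by omega⟩, h11, hfP,
    fun i => h1 (i + 1), N, fun i hi => h2 (i + 1) (by omega), h3', ?_⟩
  change length (w * cycElt P) + ∑ i ∈ range N, length (f (i + 1)) = length π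
  omega

theorem factorizations_bijective (hn : 2 ≤ n) (w π : AffineSymmetricGroup n) (a : ℕ → ℕ) :
    Function.Bijective (fun x : Σ P : FirstFactor w (a 0),
      factorizations (w * cycElt P.1) π (fun i => a (i + 1)) =>
        (⟨consFactor (cycElt x.1.1) x.2.1, consFactor_mem hn x.1.2.1 x.1.2.2 x.2.2⟩ :
          factorizations w π a)) := by
  constructor
  · rintro ⟨⟨P, hP, hP'⟩, ⟨f, hf⟩⟩ ⟨⟨Q, hQ, hQ'⟩, ⟨g, hg⟩⟩ h
    have h' : consFactor (cycElt P) f = consFactor (cycElt Q) g := congrArg Subtype.val h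
    obtain rfl : P = Q := cycElt_injective hn (mem_properSubsets.1 hP).1 (mem_properSubsets.1 hQ).1
      (congrFun h' 0)
    obtain rfl : f = g := funext fun i => congrFun h' (i + 1)
    rfl
  · rintro ⟨f, hf⟩
    obtain ⟨P, h1, h2, h3, h4⟩ := exists_of_mem_factorizations hn hf
    refine ⟨⟨⟨P, h1, h2⟩, ⟨_, h4⟩⟩, Subtype.ext ?_⟩
    funext i
    cases i with
    | zero => exact h3.symm
    | succ i => rfl

/-- The indicator function of `π`. -/
noncomputable def delta {n : ℕ} (π σ : AffineSymmetricGroup n) : ℚ :=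
  open Classical in if σ = π then 1 else 0

/-- Splitting off the first factor turns the count into a sum over P, which is one application of
`hOp`; w accumulates the factors already removed. -/
theorem finite_ncard_factorizations (hn : 2 ≤ n) (π : AffineSymmetricGroup n) (l : List ℕ) :
    ∀ (w : AffineSymmetricGroup n) (a : ℕ → ℕ), (∀ i, a i = l.getD i 0) →
      Finite (factorizations w π a) ∧ ((factorizations w π a).ncard : ℚ) =
        (l.map (hOp n)).prod (delta π) w := by
  induction l with
  | nil =>
    intro w a ha
    rw [factorizations_zero (by omega) w π a (by simpa using ha)]
    refine ⟨by split_ifs <;> infer_instance, ?_⟩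
    split_ifs with h <;> simp [h, delta]
  | cons k l ih =>
    intro w a ha
    have ha0 : a 0 = k := by simpa using ha 0
    have ih' := fun P : FirstFactor w (a 0) => ih (w * cycElt P.1) (fun i => a (i + 1))
      (fun i => by simpa using ha (i + 1))
    have hfin := fun P => (ih' P).1
    have hbij := factorizations_bijective hn w π a
    refine ⟨Finite.of_surjective _ hbij.2, ?_⟩
    rw [← Nat.card_coe_set_eq, ← Nat.card_congr (Equiv.ofBijective _ hbij), Nat.card_sigma]
    push_cast
    simp only [Nat.card_coe_set_eq, fun P => (ih' P).2]
    rw [List.map_cons, List.prod_cons, Module.End.mul_apply, hOp, LinearMap.sum_apply,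
      Finset.sum_apply]
    simp only [stepOp_apply]
    rw [← Finset.sum_filter]
    subst ha0
    exact (Finset.sum_subtype
      ((properSubsets n (a 0)).filter fun P => length (w * cycElt P) = length w + a 0)
      (fun P => Finset.mem_filter)
      fun P => (l.map (hOp n)).prod (delta π) (w * cycElt P)).symm

theorem stanley_eq_hOp (hn : 2 ≤ n) (π : AffineSymmetricGroup n) (l : List ℕ) (α : ℕ →₀ ℕ)
    (h : ∀ i, α i = l.getD i 0) : stanley π α =
      (l.map (hOp n)).prod (delta π) 1 := by
  rw [stanley_eq_ncard_factorizations]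
  exact (finite_ncard_factorizations hn π l 1 α h).2

/-! ### Symmetry -/

/-- The list of exponents of `α`. -/
def exponentList (α : ℕ →₀ ℕ) : List ℕ := (List.range (α.support.sup id + 1)).map α

theorem exponentList_getD (α : ℕ →₀ ℕ) (i : ℕ) : α i = (exponentList α).getD i 0 := by
  unfold exponentList
  by_cases h : i < α.support.sup id + 1
  · rw [List.getD_eq_getElem _ _ (by simpa using h)]
    simp
  · rw [List.getD_eq_default _ _ (by simp; omega), ← Finsupp.notMem_support_iff]
    intro h'
    have : i ≤ α.support.sup id := Finset.le_sup (f := id) h'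
    omega

theorem exponentList_filter (α : ℕ →₀ ℕ) :
    (((exponentList α).filter (· ≠ 0) : List ℕ) : Multiset ℕ) = α.support.val.map α := by
  have hs : α.support = (Finset.range (α.support.sup id + 1)).filter (fun i => α i ≠ 0) := by
    ext i
    simp only [Finsupp.mem_support_iff, Finset.mem_filter, Finset.mem_range, iff_and_self]
    intro h
    have : i ≤ α.support.sup id := Finset.le_sup (f := id) (Finsupp.mem_support_iff.2 h)
    omega
  rw [hs, exponentList, List.filter_map, ← Multiset.map_coe]
  rfl

/-- A coefficient is a product of commuting operators evaluated at 1, and zero exponents contribute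
h_0 = 1, so only the multiset of nonzero exponents matters. -/
theorem stanley_symmetric (hn : 2 ≤ n) (π : AffineSymmetricGroup n) {α β : ℕ →₀ ℕ}
    (h : α.support.val.map α = β.support.val.map β) : stanley π α = stanley π β := by
  have hfilter : ∀ l : List ℕ,
      (l.map (hOp n)).prod = ((l.filter (· ≠ 0)).map (hOp n)).prod := by
    intro l
    induction l with
    | nil => rfl
    | cons k l ih =>
      by_cases hk : k = 0
      · subst hk; simp [hOp_zero hn, ih]
      · simp [hk, ih]
  have hperm : (exponentList α).filter (· ≠ 0) |>.Perm ((exponentList β).filter (· ≠ 0)) := by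
    rw [← Multiset.coe_eq_coe, exponentList_filter, exponentList_filter, h]
  rw [stanley_eq_hOp hn π _ α (exponentList_getD α), stanley_eq_hOp hn π _ β (exponentList_getD β),
    hfilter, hfilter (exponentList β)]
  rw [(hperm.map (hOp n)).prod_eq']
  refine List.pairwise_of_forall_mem_list fun a ha b hb => ?_
  obtain ⟨i, _, rfl⟩ := List.mem_map.1 ha
  obtain ⟨j, _, rfl⟩ := List.mem_map.1 hb
  exact hOp_commute hn i j

theorem exists_factorization_of_stanley_ne_zero {n : ℕ} {π : AffineSymmetricGroup n} {α : ℕ →₀ ℕ}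
    (h : stanley π α ≠ 0) : (factorizations 1 π α).Nonempty := by
  rw [stanley_eq_ncard_factorizations] at h
  by_contra h'
  rw [Set.not_nonempty_iff_eq_empty] at h'
  simp [h'] at h

theorem stanley_ne_zero (hn : 2 ≤ n) {π : AffineSymmetricGroup n} {α : ℕ →₀ ℕ}
    (h : (factorizations 1 π α).Nonempty) : stanley π α ≠ 0 := by
  have hfin := (finite_ncard_factorizations hn π (exponentList α) 1 α (exponentList_getD α)).1
  rw [stanley_eq_ncard_factorizations, Nat.cast_ne_zero]
  exact (Set.ncard_pos (Set.toFinite _)).2 h |>.ne'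

theorem exponent_lt_of_stanley_ne_zero (hn : 2 ≤ n) {π : AffineSymmetricGroup n} {α : ℕ →₀ ℕ}
    (h : stanley π α ≠ 0) (i : ℕ) : α i < n := by
  obtain ⟨f, h1, _⟩ := exists_factorization_of_stanley_ne_zero h
  obtain ⟨P, hP, _, hl⟩ := (isCyclicallyDecreasing_iff hn _).1 (h1 i).1
  rw [← (h1 i).2, hl]
  by_contra h'
  have : P ∈ properSubsets n P.card := mem_properSubsets.2 ⟨hP, rfl⟩
  rw [properSubsets_eq_empty (not_lt.1 h')] at this
  exact Finset.notMem_empty _ this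

theorem degree_of_stanley_ne_zero {n : ℕ} {π : AffineSymmetricGroup n} {α : ℕ →₀ ℕ}
    (h : stanley π α ≠ 0) : (α.support.val.map α).sum = length π := by
  obtain ⟨f, h1, N, h2, _, h4⟩ := exists_factorization_of_stanley_ne_zero h
  rw [length_one, zero_add] at h4
  simp only [fun i => (h1 i).2] at h4
  rw [← h4]
  change ∑ i ∈ α.support, α i = _
  refine Finset.sum_subset (fun i hi => ?_) fun i _ hi => Finsupp.notMem_support_iff.1 hi
  rw [Finset.mem_range]
  by_contra h5
  rw [Finsupp.mem_support_iff, ← (h1 i).2, h2 i (by omega), length_one] at hi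
  exact hi rfl

/-! ### The duality operator -/

/-- The star conjugates right translation by c_P into right translation by (c_{-P})⁻¹, and negation
permutes the proper subsets of each size. -/
theorem hOp_comp_star (hn : 2 ≤ n) (k : ℕ) (F : AffineSymmetricGroup n → ℚ) :
    (hOp n k F) ∘ star n = eOp n k (F ∘ star n) := by
  have hlen := (isDiagramAutomorphism_star n).length_map (show 0 < n by omega)
  have hinv : ∀ P : Finset (ZMod n), (P.image fun x => -x).image (fun x => -x) = P := by
    intro P
    rw [Finset.image_image]
    simp
  funext w
  simp only [Function.comp_apply, hOp, eOp, LinearMap.sum_apply, Finset.sum_apply, stepOp_apply]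
  refine Finset.sum_nbij' (fun P => P.image fun x => -x) (fun P => P.image fun x => -x) ?_ ?_
    (fun P _ => hinv P) (fun P _ => hinv P) ?_
  · intro P hP
    rw [mem_properSubsets] at hP ⊢
    exact ⟨image_neg_ne_univ hP.1, by rw [Finset.card_image_of_injective _ neg_injective, hP.2]⟩
  · intro P hP
    rw [mem_properSubsets] at hP ⊢
    exact ⟨image_neg_ne_univ hP.1, by rw [Finset.card_image_of_injective _ neg_injective, hP.2]⟩
  · intro P hP
    rw [mem_properSubsets] at hP
    have e : star n (w * (cycElt (P.image fun x => -x))⁻¹) = star n w * cycElt P := by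
      rw [map_mul, map_inv, star_cycElt hn (image_neg_ne_univ hP.1), inv_inv, hinv]
    rw [e, ← hlen (w * _), e, hlen w]

theorem star_star {n : ℕ} (π : AffineSymmetricGroup n) : star n (star n π) = π := by
  apply Subtype.ext; ext k
  simp [star_apply]

theorem stanley_star_eq_eOp (hn : 2 ≤ n) (π : AffineSymmetricGroup n) (l : List ℕ) (α : ℕ →₀ ℕ)
    (h : ∀ i, α i = l.getD i 0) : stanley (star n π) α =
      (l.map (eOp n)).prod (delta π) 1 := by
  have key : ∀ (l : List ℕ) (F : AffineSymmetricGroup n → ℚ),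
      ((l.map (hOp n)).prod F) ∘ star n = (l.map (eOp n)).prod (F ∘ star n) := by
    intro l
    induction l with
    | nil => intro F; simp
    | cons k l ih =>
      intro F
      rw [List.map_cons, List.prod_cons, Module.End.mul_apply, hOp_comp_star hn, ih, List.map_cons,
        List.prod_cons, Module.End.mul_apply]
  rw [stanley_eq_hOp hn _ l α h]
  have h1 := congrFun (key l (delta (star n π))) 1
  rw [Function.comp_apply, map_one] at h1
  rw [h1]
  have h2 : delta (star n π) ∘ star n = delta π := by
    funext σ
    by_cases h : σ = π <;> simp [delta, h]
  rw [h2]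

/-- The coefficients depend on the exponents alone, not on any group element; this uniformity is
what makes the duality one linear map. -/
theorem exists_eOp_prod_eq (hn : 2 ≤ n) (l : List ℕ) :
    ∃ c : List ℕ →₀ ℚ, (c.sum fun m r => r • (m.map (hOp n)).prod) = (l.map (eOp n)).prod := by
  rw [← Finsupp.mem_span_range_iff_exists_finsupp]
  have h1 : (l.map (eOp n)).prod ∈ Algebra.adjoin ℚ (Set.range (hOp n)) := by
    refine Subalgebra.list_prod_mem _ fun x hx => ?_
    obtain ⟨k, _, rfl⟩ := List.mem_map.1 hx
    exact eOp_mem_adjoin hn k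
  rw [← Subalgebra.mem_toSubmodule, Algebra.adjoin_eq_span] at h1
  refine Submodule.span_mono ?_ h1
  intro x hx
  obtain ⟨L, hL, rfl⟩ := Submonoid.exists_list_of_mem_closure hx
  clear hx h1
  induction L with
  | nil => exact ⟨[], rfl⟩
  | cons a L ih =>
    obtain ⟨m, hm⟩ := ih fun y hy => hL y (List.mem_cons_of_mem _ hy)
    obtain ⟨k, hk⟩ := hL a List.mem_cons_self
    refine ⟨k :: m, ?_⟩
    simp only [List.map_cons, List.prod_cons] at hm ⊢
    rw [hm, hk]

/-- There is a linear operator on power series sending `F_π` to `F_{π^*}` for all `π`. -/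
theorem exists_duality (hn : 2 ≤ n) :
    ∃ Ω : MvPowerSeries ℕ ℚ →ₗ[ℚ] MvPowerSeries ℕ ℚ,
      ∀ π : AffineSymmetricGroup n, Ω (stanley π) = stanley (star n π) := by
  classical
  choose c hc using exists_eOp_prod_eq hn
  -- Replace each monomial in the expansion of e_α in the h's by the coefficient of g with those
  -- exponents. This makes sense for every power series, symmetric or not.
  refine ⟨{ toFun := fun g α => (c (exponentList α)).sum fun m r => r * g m.toFinsupp
            map_add' := ?_
            map_smul' := ?_ }, fun π => ?_⟩
  · intro g g'
    funext α
    change _ = (_ : ℚ) + _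
    rw [← Finsupp.sum_add]
    exact Finsupp.sum_congr fun m _ => mul_add _ (g m.toFinsupp) (g' m.toFinsupp)
  · intro r g
    funext α
    change _ = r * (_ : ℚ)
    rw [Finsupp.mul_sum]
    exact Finsupp.sum_congr fun m _ => mul_left_comm _ r (g m.toFinsupp)
  · funext α
    change ((c (exponentList α)).sum fun m r => r * stanley π m.toFinsupp) = _
    rw [stanley_star_eq_eOp hn π _ α (exponentList_getD α), ← hc, Finsupp.sum, Finsupp.sum,
      LinearMap.sum_apply, Finset.sum_apply]
    refine Finset.sum_congr rfl fun m _ => ?_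
    rw [stanley_eq_hOp hn π m _ fun i => List.toFinsupp_apply m i]
    rfl

end AffineStanley
namespace AffineStanley
open Finset

variable {n : ℕ} [NeZero n]

/-! ### Codes determine affine permutations -/

theorem codeEntry_le_of_ascent {n : ℕ} (hn : 0 < n) (y : AffineSymmetricGroup n) (i : ℤ)
    (h : (y : Equiv.Perm ℤ) i < (y : Equiv.Perm ℤ) (i + 1)) :
    codeEntry y i ≤ codeEntry y (i + 1) := by
  refine Set.ncard_le_ncard (fun j hj => ?_) (finite_code hn y _ _)
  obtain ⟨h1, h2⟩ := hj
  have : j ≠ i + 1 := by rintro rfl; omega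
  exact ⟨by omega, by omega⟩

theorem codeEntry_eq_of_descent {n : ℕ} (hn : 2 ≤ n) (y : AffineSymmetricGroup n) (i : ℤ)
    (h : (y : Equiv.Perm ℤ) (i + 1) < (y : Equiv.Perm ℤ) i) (k : ℤ) :
    codeEntry y k = codeEntry (y * simpleRefl n i) ((simpleRefl n i : Equiv.Perm ℤ) k) +
      if (n : ℤ) ∣ k - i then 1 else 0 := by
  have := codeEntry_mul_simpleRefl hn (y * simpleRefl n i) i
    (by rwa [mul_simpleRefl_apply_self hn, mul_simpleRefl_apply_succ hn]) k
  rwa [mul_simpleRefl_cancel] at this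

/-- The code is weakly increasing across an ascent; creating a descent swaps the two entries and
adds one to the left one, making the drop strict. -/
theorem descent_iff_codeEntry_lt {n : ℕ} (hn : 2 ≤ n) (y : AffineSymmetricGroup n) (i : ℤ) :
    (y : Equiv.Perm ℤ) (i + 1) < (y : Equiv.Perm ℤ) i ↔ codeEntry y (i + 1) < codeEntry y i := by
  constructor
  · intro h
    have h1 := codeEntry_eq_of_descent hn y i h i
    have h2 := codeEntry_eq_of_descent hn y i h (i + 1)
    rw [simpleRefl_apply_of_dvd hn (by simp), if_pos (by simp)] at h1
    rw [simpleRefl_apply_of_dvd_succ hn (by simp), add_sub_cancel_right,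
      if_neg (not_dvd_of_dvd_succ hn (by simp))] at h2
    have h3 := codeEntry_le_of_ascent (by omega) (y * simpleRefl n i) i
      (by rwa [mul_simpleRefl_apply_self hn, mul_simpleRefl_apply_succ hn])
    omega
  · intro h
    rcases ascent_or_descent y i with h1 | h1
    · have := codeEntry_le_of_ascent (by omega) y i h1
      omega
    · exact h1

/-- Codes show descents, so the same descent can be removed from both elements, changing both codes
in the same way. -/
theorem eq_of_codeEntry_eq {n : ℕ} (hn : 2 ≤ n) (y y' : AffineSymmetricGroup n)
    (h : ∀ k, codeEntry y k = codeEntry y' k) : y = y' := by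
  induction hm : length y using Nat.strong_induction_on generalizing y y' with
  | _ m ih =>
  by_cases hd : ∃ i, (y : Equiv.Perm ℤ) (i + 1) < (y : Equiv.Perm ℤ) i
  · obtain ⟨i, hi⟩ := hd
    have hi' := hi
    rw [descent_iff_codeEntry_lt hn, h, h, ← descent_iff_codeEntry_lt hn] at hi'
    have h1 := ih _ (by have := length_of_descent hn y i hi; omega) (y * simpleRefl n i)
      (y' * simpleRefl n i) (fun k => by
        have e1 := codeEntry_eq_of_descent hn y i hi ((simpleRefl n i : Equiv.Perm ℤ) k)
        have e2 := codeEntry_eq_of_descent hn y' i hi' ((simpleRefl n i : Equiv.Perm ℤ) k)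
        rw [simpleRefl_simpleRefl_apply hn] at e1 e2
        rw [h] at e1
        omega) rfl
    exact mul_right_cancel h1
  · push Not at hd
    have h1 : y = 1 := eq_one_of_no_descent (by omega) y fun i =>
      (ascent_or_descent y i).resolve_right (not_lt.2 (hd i))
    subst h1
    symm
    apply eq_one_of_length_eq_zero (show 0 < n by omega)
    rw [length_eq_inversionCount hn, inversionCount]
    exact Finset.sum_eq_zero fun k _ => by rw [← h, codeEntry_one]

/-- Undo drops of c one at a time, as a descent would be undone. Once no drop is left, c is
increasing, periodic and somewhere zero, hence zero. -/
theorem exists_codeEntry_eq {n : ℕ} (hn : 2 ≤ n) (c : ℤ → ℕ) (hc : ∀ k, c (k + n) = c k)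
    (h0 : ∃ k, c k = 0) : ∃ y : AffineSymmetricGroup n, ∀ k, codeEntry y k = c k := by
  induction hm : ∑ k ∈ Icc (1 : ℤ) n, c k using Nat.strong_induction_on generalizing c with
  | _ m ih =>
  have hper : ∀ k d : ℤ, c (k + n * d) = c k := fun k d => by
    have h : Function.Periodic c (n : ℤ) := hc
    have := (h.zsmul d) k
    rwa [smul_eq_mul, mul_comm] at this
  have hcongr : ∀ k j : ℤ, (n : ℤ) ∣ k - j → c k = c j := by
    rintro k j ⟨d, hd⟩
    rw [← hper j d]
    congr 1
    linarith
  obtain ⟨k0, hk0⟩ := h0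
  by_cases hd : ∃ i, c (i + 1) < c i
  · obtain ⟨i, hi⟩ := hd
    set s : Equiv.Perm ℤ := (simpleRefl n i : Equiv.Perm ℤ) with hs
    have hsper : ∀ k, s (k + n) = s k + n := affine_add _
    have hss : ∀ a, s (s a) = a := simpleRefl_simpleRefl_apply hn i
    -- The truncated subtraction is exact: 1 is subtracted only where the entry equals c i > c (i +
    -- 1).
    set c' : ℤ → ℕ := fun k => c (s k) - if (n : ℤ) ∣ s k - i then 1 else 0 with hc'
    have hind : ∀ k : ℤ, (n : ℤ) ∣ k + n - i ↔ (n : ℤ) ∣ k - i := fun k => by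
      rw [show k + (n : ℤ) - i = k - i + n by ring, dvd_add_self_right]
    have hper' : ∀ k, c' (k + n) = c' k := fun k => by simp only [hc', hsper, hc, hind]
    have hcc' : ∀ k, c k = c' (s k) + if (n : ℤ) ∣ k - i then 1 else 0 := by
      intro k
      simp only [hc', hss]
      split_ifs with h
      · have := hcongr k i h
        omega
      · omega
    have hsum : ∑ k ∈ Icc (1 : ℤ) n, c k = ∑ k ∈ Icc (1 : ℤ) n, c' k + 1 := by
      rw [Finset.sum_congr rfl fun k _ => hcc' k, Finset.sum_add_distrib,
        sum_window_indicator (by omega)]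
      congr 1
      have := sum_window_comp (n := n) (fun k => (c' k : ℤ)) s (fun k => by simp only [hper'])
        (IsAffine.dvd (simpleRefl n i).2.1)
      exact_mod_cast this
    obtain ⟨y, hy⟩ := ih (∑ k ∈ Icc (1 : ℤ) n, c' k) (by omega) c' hper'
      ⟨s k0, by have := hcc' k0; omega⟩ rfl
    refine ⟨y * simpleRefl n i, fun k => ?_⟩
    rw [codeEntry_mul_simpleRefl hn y i, hy, hcc' k]
    -- The strict drop of c leaves c' (i + 1) = c i - 1 ≥ c (i + 1) = c' i, so y ascends at i.
    refine (ascent_or_descent y i).resolve_right fun h => ?_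
    rw [descent_iff_codeEntry_lt hn, hy, hy] at h
    have h1 := hcc' i
    have h2 := hcc' (i + 1)
    rw [hs, simpleRefl_apply_of_dvd hn (by simp), if_pos (by simp)] at h1
    rw [hs, simpleRefl_apply_of_dvd_succ hn (by simp), add_sub_cancel_right] at h2
    omega
  · push Not at hd
    have hmono : Monotone c := monotone_int_of_le_succ hd
    refine ⟨1, fun k => ?_⟩
    rw [codeEntry_one]
    -- Some translate of the zero k0 lies at or beyond k, and monotonicity bounds c k by its value
    -- there.
    obtain ⟨r, hr, d, hd⟩ := exists_mem_window (show 0 < n by omega) (k - k0)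
    have h1 : c k ≤ c (k0 + n * (d + 1)) := hmono (by
      rw [Finset.mem_Icc] at hr
      rw [mul_add]
      linarith [hr.2])
    rw [hper, hk0] at h1
    omega

/-- Take the last position with value ≤ 0: every later value is positive. -/
theorem exists_codeEntry_eq_zero {n : ℕ} (hn : 0 < n) (y : AffineSymmetricGroup n) :
    ∃ k, codeEntry y k = 0 := by
  obtain ⟨M, hM⟩ := exists_displacement_bound hn y
  obtain ⟨k, hk, hk'⟩ := Int.exists_greatest_of_bdd (P := fun k => (y : Equiv.Perm ℤ) k ≤ 0)
    ⟨M, fun k hk => by have := hM k; omega⟩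
    ⟨((y⁻¹ : AffineSymmetricGroup n) : Equiv.Perm ℤ) 0, by rw [affine_apply_inv_self]⟩
  refine ⟨k, ?_⟩
  unfold codeEntry
  convert Set.ncard_empty ℤ
  ext j
  simp only [Set.mem_ofPred_eq, Set.mem_empty_iff_false, iff_false, not_and, not_lt]
  intro h1
  by_contra h2
  have := hk' j (by omega)
  omega

/-! ### Codes and cyclically decreasing factors -/

open Classical in
-- Append the letters of the increasing product one by one; length additivity makes each of them an
-- ascent, so the one-letter rule for codes applies.
theorem codeEntry_mul_inv_cycElt (hn : 2 ≤ n) (z : AffineSymmetricGroup n) (P : Finset (ZMod n))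
    (hP : P ≠ univ) (h : length (z * (cycElt P)⁻¹) = length z + P.card) (k : ℤ) :
    codeEntry (z * (cycElt P)⁻¹) k =
      codeEntry z ((((cycElt P)⁻¹ : AffineSymmetricGroup n) : Equiv.Perm ℤ) k) +
        if (k : ZMod n) ∈ P then 1 else 0 := by
  induction hm : P.card generalizing P k with
  | zero =>
    rw [Finset.card_eq_zero] at hm
    subst hm
    simp [cycElt_empty hn]
  | succ m ih =>
    obtain ⟨i, hi, hi'⟩ := exists_mem_succ_notMem hP (Finset.card_pos.1 (by omega))
    obtain ⟨i, rfl⟩ := ZMod.intCast_surjective i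
    have hcard := Finset.card_erase_of_mem hi
    have e := cycElt_eq_simpleRefl_mul hn hi hi'
    have e' : (cycElt P)⁻¹ = (cycElt (P.erase (i : ZMod n)))⁻¹ * simpleRefl n i := by
      rw [e, mul_inv_rev, simpleRefl_inv]
    have h1 := length_mul_le (show 0 < n by omega) z (cycElt (P.erase (i : ZMod n)))⁻¹
    have h2 := length_cycElt_le hn (erase_ne_univ P (i : ZMod n))
    rw [length_inv (by omega)] at h1
    have h3 := length_mul_le (show 0 < n by omega) (z * (cycElt (P.erase (i : ZMod n)))⁻¹)
      (simpleRefl n i)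
    have h4 := length_simpleRefl_le (n := n) i
    rw [e', ← mul_assoc] at h
    have hasc := (length_lt_length_mul_simpleRefl_iff hn (z * (cycElt (P.erase (i : ZMod n)))⁻¹)
      i).1 (by omega)
    rw [e', ← mul_assoc, codeEntry_mul_simpleRefl hn _ i hasc,
      ih _ (erase_ne_univ _ _) (by omega) _ (by omega), add_assoc]
    have hdvd : ∀ a b : ℤ, (n : ℤ) ∣ a - b ↔ (a : ZMod n) = b := fun a b => by
      rw [eq_comm, ZMod.intCast_eq_intCast_iff_dvd_sub]
    -- s_i swaps only classes outside `P.erase i`, so the earlier increments stay put and the new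
    -- one completes the indicator of P.
    congr 1
    rw [simpleRefl_apply_zmod hn]
    simp only [hdvd]
    have h10 := zmod_one_ne_zero hn
    by_cases hk : (k : ZMod n) = i
    · simp [hk, hi, hi']
    · by_cases hk' : (k : ZMod n) = i + 1
      · simp [hk', hi', h10]
      · simp [hk, hk']

/-- At the top of a run a nonzero entry is followed by a zero, hence a descent. Removing it moves
the zero down one place, and the next letter of the run is again a descent. -/
theorem length_mul_cycElt_of_descents (hn : 2 ≤ n) (y : AffineSymmetricGroup n)
    (P : Finset (ZMod n)) (hP : P ≠ univ)
    (h1 : ∀ k : ℤ, (k : ZMod n) ∈ P → codeEntry y k ≠ 0)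
    (h2 : ∀ k : ℤ, (k : ZMod n) ∈ P → (k : ZMod n) + 1 ∉ P → codeEntry y (k + 1) = 0) :
    length y = length (y * cycElt P) + P.card := by
  induction hm : P.card generalizing P y with
  | zero =>
    rw [Finset.card_eq_zero] at hm
    subst hm
    simp [cycElt_empty hn]
  | succ m ih =>
    obtain ⟨i, hi, hi'⟩ := exists_mem_succ_notMem hP (Finset.card_pos.1 (by omega))
    obtain ⟨i, rfl⟩ := ZMod.intCast_surjective i
    have hcard := Finset.card_erase_of_mem hi
    have hdvd : ∀ a b : ℤ, (n : ℤ) ∣ a - b ↔ (a : ZMod n) = b := fun a b => by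
      rw [eq_comm, ZMod.intCast_eq_intCast_iff_dvd_sub]
    have hdes : (y : Equiv.Perm ℤ) (i + 1) < (y : Equiv.Perm ℤ) i := by
      rw [descent_iff_codeEntry_lt hn, h2 i hi hi']
      exact Nat.pos_of_ne_zero (h1 i hi)
    have hcode := codeEntry_eq_of_descent hn y i hdes
    have hother : ∀ k : ℤ, (k : ZMod n) ≠ i → (k : ZMod n) ≠ i + 1 →
        codeEntry (y * simpleRefl n i) k = codeEntry y k := by
      intro k hk hk'
      rw [hcode k, simpleRefl_apply_zmod hn, if_neg hk, if_neg hk', if_neg (by rwa [hdvd]), add_zero]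
    have hself : ∀ k : ℤ, (k : ZMod n) = i → codeEntry (y * simpleRefl n i) k = 0 := by
      intro k hk
      rw [codeEntry_congr _ ((hdvd k i).2 hk)]
      have h3 := hcode (i + 1)
      rw [h2 i hi hi', simpleRefl_apply_of_dvd_succ hn (by simp), add_sub_cancel_right] at h3
      omega
    have h3 := ih (y * simpleRefl n i) (P.erase (i : ZMod n)) (erase_ne_univ _ _) ?_ ?_ (by omega)
    · rw [length_of_descent hn y i hdes, h3, cycElt_eq_simpleRefl_mul hn hi hi', mul_assoc]
      omega
    · intro k hk
      have hk' := Finset.mem_of_mem_erase hk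
      rw [hother k (Finset.ne_of_mem_erase hk) (fun h => hi' (h ▸ hk'))]
      exact h1 k hk'
    · intro k hk hk1
      have hk' := Finset.mem_of_mem_erase hk
      have hki := Finset.ne_of_mem_erase hk
      by_cases h4 : (k : ZMod n) + 1 = i
      · exact hself _ (by push_cast; exact h4)
      · rw [hother _ (by push_cast; exact h4)
          (by push_cast; exact fun h => hki (add_right_cancel h))]
        exact h2 k hk' fun h => hk1 (Finset.mem_erase.2 ⟨h4, h⟩)

open Classical in
/-- The residue classes where the code is nonzero. -/
noncomputable def codeSupport (y : AffineSymmetricGroup n) : Finset (ZMod n) :=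
  univ.filter fun a => ∃ k : ℤ, (k : ZMod n) = a ∧ codeEntry y k ≠ 0

theorem mem_codeSupport (y : AffineSymmetricGroup n) (k : ℤ) :
    (k : ZMod n) ∈ codeSupport y ↔ codeEntry y k ≠ 0 := by
  simp only [codeSupport, Finset.mem_filter, Finset.mem_univ, true_and]
  constructor
  · rintro ⟨m, hm, h⟩
    rwa [codeEntry_congr y (m := m)]
    rwa [← ZMod.intCast_eq_intCast_iff_dvd_sub]
  · exact fun h => ⟨k, rfl, h⟩

theorem codeSupport_ne_univ (y : AffineSymmetricGroup n) : codeSupport y ≠ univ := by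
  obtain ⟨k, hk⟩ := exists_codeEntry_eq_zero (Nat.pos_of_neZero n) y
  exact ne_univ_of_notMem (a := (k : ZMod n)) (by rw [mem_codeSupport, hk]; simp)

theorem length_mul_cycElt_codeSupport (hn : 2 ≤ n) (y : AffineSymmetricGroup n) :
    length y = length (y * cycElt (codeSupport y)) + (codeSupport y).card := by
  refine length_mul_cycElt_of_descents hn y _ (codeSupport_ne_univ y)
    (fun k hk => (mem_codeSupport y k).1 hk) fun k _ hk => ?_
  by_contra h
  exact hk (by have := (mem_codeSupport y (k + 1)).2 h; push_cast at this; exact this)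

/-- The number of entries of the code exceeding `i`. -/
noncomputable def columnCount {n : ℕ} (y : AffineSymmetricGroup n) (i : ℕ) : ℕ :=
  ((Icc (1 : ℤ) n).filter fun k => i < codeEntry y k).card

open Classical in
theorem card_window_filter (P : Finset (ZMod n)) :
    ((Icc (1 : ℤ) n).filter fun k : ℤ => (k : ZMod n) ∈ P).card = P.card := by
  have hn : (0 : ℤ) < n := by exact_mod_cast Nat.pos_of_neZero n
  refine Finset.card_bij (fun k _ => (k : ZMod n)) (fun k hk => (Finset.mem_filter.1 hk).2) ?_ ?_
  · intro k hk j hj h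
    rw [Finset.mem_filter, Finset.mem_Icc] at hk hj
    rw [ZMod.intCast_eq_intCast_iff_dvd_sub] at h
    have := Int.eq_zero_of_abs_lt_dvd h (by rw [abs_lt]; constructor <;> omega)
    omega
  · intro a ha
    obtain ⟨m, rfl⟩ := ZMod.intCast_surjective a
    obtain ⟨r, hr, d, rfl⟩ := exists_mem_window (Nat.pos_of_neZero n) m
    have e : ((r + n * d : ℤ) : ZMod n) = (r : ZMod n) := by push_cast; simp
    exact ⟨r, Finset.mem_filter.2 ⟨hr, by rwa [e] at ha⟩, e.symm⟩

/-- Lowering every nonzero entry by one deletes the first part of the conjugate partition. -/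
theorem columnCount_of_codeEntry (y z g : AffineSymmetricGroup n) (P : Finset (ZMod n))
    (h : ∀ k ∈ Icc (1 : ℤ) n, ((k : ZMod n) ∈ P ∧
      codeEntry y k = codeEntry z ((g : Equiv.Perm ℤ) k) + 1) ∨
      ((k : ZMod n) ∉ P ∧ codeEntry y k = 0 ∧ codeEntry z ((g : Equiv.Perm ℤ) k) = 0)) :
    columnCount y 0 = P.card ∧ ∀ i, columnCount y (i + 1) = columnCount z i := by
  constructor
  · rw [← card_window_filter P, columnCount, Finset.card_filter, Finset.card_filter]
    refine Finset.sum_congr rfl fun k hk => ?_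
    rcases h k hk with ⟨h1, h2⟩ | ⟨h1, h2, _⟩
    · simp [h1, h2]
    · simp [h1, h2]
  · intro i
    have h1 : columnCount z i =
        ∑ k ∈ Icc (1 : ℤ) n, if i < codeEntry z ((g : Equiv.Perm ℤ) k) then 1 else 0 := by
      rw [sum_code_comp z g fun m => if i < m then 1 else 0, columnCount, Finset.card_filter]
    rw [h1, columnCount, Finset.card_filter]
    refine Finset.sum_congr rfl fun k hk => ?_
    rcases h k hk with ⟨_, h2⟩ | ⟨_, h2, h3⟩
    · simp [h2]
    · simp [h2, h3]

/-- The greedy factorization: each factor uses every class where the code of the remaining inverse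
is nonzero, and so strips one column. -/
theorem factorizations_columnCount_nonempty (hn : 2 ≤ n) (w v : AffineSymmetricGroup n)
    (h : length (w * v) = length w + length v) :
    (factorizations w (w * v) (columnCount v⁻¹)).Nonempty := by
  have hn0 : 0 < n := by omega
  induction hm : length v using Nat.strong_induction_on generalizing w v with
  | _ m ih =>
  by_cases hv : v = 1
  · subst hv
    rw [factorizations_zero hn0, if_pos (by simp)]
    · exact Set.singleton_nonempty _
    · intro i
      simp [columnCount, codeEntry_one]
  · set P := codeSupport v⁻¹ with hPdef
    have hP : P ≠ univ := codeSupport_ne_univ v⁻¹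
    set v' := (v⁻¹ * cycElt P)⁻¹ with hv'
    have hlen : length v = length v' + P.card := by
      rw [hv', length_inv hn0, ← length_inv hn0 v, ← length_mul_cycElt_codeSupport hn]
    have hvv' : v = cycElt P * v' := by rw [hv', mul_inv_rev, inv_inv, mul_inv_cancel_left]
    have hinv : v⁻¹ = v'⁻¹ * (cycElt P)⁻¹ := by rw [hvv', mul_inv_rev]
    have hcode := codeEntry_mul_inv_cycElt hn v'⁻¹ P hP
      (by rw [← hinv, length_inv hn0, length_inv hn0, hlen])
    rw [← hinv] at hcode
    have hcol := columnCount_of_codeEntry v⁻¹ v'⁻¹ (cycElt P)⁻¹ P (fun k _ => by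
      have h1 := hcode k
      by_cases hk : (k : ZMod n) ∈ P
      · rw [if_pos hk] at h1
        exact Or.inl ⟨hk, h1⟩
      · rw [if_neg hk] at h1
        have h2 : codeEntry v⁻¹ k = 0 := by
          by_contra h2
          exact hk ((mem_codeSupport _ _).2 h2)
        exact Or.inr ⟨hk, h2, by omega⟩)
    have h1 := length_mul_le hn0 w (cycElt P)
    have h2 := length_cycElt_le hn hP
    have h3 := length_mul_le hn0 (w * cycElt P) v'
    have e : w * v = w * cycElt P * v' := by rw [mul_assoc, ← hvv']
    rw [e] at h
    -- A nontrivial v has a nonempty support, so the recursion makes progress.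
    have hPcard : P.card ≠ 0 := by
      intro h0
      rw [Finset.card_eq_zero] at h0
      apply hv
      rw [h0, cycElt_empty hn, one_mul] at hvv'
      have hz : inversionCount v⁻¹ = 0 := Finset.sum_eq_zero fun k _ => by
        by_contra h2
        have := (mem_codeSupport _ _).2 h2
        rw [← hPdef, h0] at this
        exact Finset.notMem_empty _ this
      rw [← length_eq_inversionCount hn, length_inv hn0] at hz
      exact eq_one_of_length_eq_zero hn0 hz
    obtain ⟨f, hf⟩ := ih (length v') (by omega) (w * cycElt P) v' (by omega) rfl
    rw [← e, ← funext hcol.2] at hf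
    exact ⟨_, consFactor_mem hn (by rw [hcol.1]; exact mem_properSubsets.2 ⟨hP, rfl⟩)
      (by rw [hcol.1]; omega) hf⟩

/-! ### Triangularity -/

/-- The weighted sum `∑ i aᵢ` of a list. -/
def weight (l : List ℕ) : ℕ := ∑ i ∈ range l.length, i * l.getD i 0

theorem weight_cons (k : ℕ) (l : List ℕ) : weight (k :: l) = weight l + l.sum := by
  have h : l.sum = ∑ i ∈ range l.length, l.getD i 0 := by
    rw [← Fin.sum_univ_getElem, Finset.sum_range]
    exact Finset.sum_congr rfl fun i _ => by simp
  rw [h, weight, weight, List.length_cons, Finset.sum_range_succ', ← Finset.sum_add_distrib]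
  simp [add_mul]

/-- The sum of the binomial coefficients `(c choose 2)` over the code. -/
noncomputable def codeWeight {n : ℕ} (y : AffineSymmetricGroup n) : ℕ :=
  ∑ k ∈ Icc (1 : ℤ) n, (codeEntry y k).choose 2

theorem length_of_mem_factorizations {n : ℕ} (hn : 0 < n) {w π : AffineSymmetricGroup n}
    {a : ℕ → ℕ} {f : ℕ → AffineSymmetricGroup n} (hf : f ∈ factorizations w π a) :
    length π = length w + length (π⁻¹ * w) := by
  obtain ⟨_, N, _, h3, h4⟩ := hf
  have h1 := length_list_prod_le hn ((List.range N).map f)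
  have h9 : (((List.range N).map f).map length).sum = ∑ i ∈ range N, length (f i) := by
    rw [List.map_map, Finset.sum_range, ← List.sum_ofFn, List.ofFn_eq_map]
    congr 1
    apply List.ext_getElem <;> simp
  have e : ((List.range N).map f).prod = (π⁻¹ * w)⁻¹ := by
    rw [← h3]; group
  rw [e, length_inv hn, h9] at h1
  have h2 := length_mul_le hn w (π⁻¹ * w)⁻¹
  rw [← e, h3, e, length_inv hn] at h2
  omega

/-- Removing the first factor lowers the weight of the exponents by the remaining length, and the
code weight by at most that, because an entry c of the rest grows at most to c + 1. Equality means
that every nonzero entry grew, which is the greedy case. -/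
theorem codeWeight_le_weight (hn : 2 ≤ n) (π : AffineSymmetricGroup n) (l : List ℕ) :
    ∀ (w : AffineSymmetricGroup n) (a : ℕ → ℕ), (∀ i, a i = l.getD i 0) →
      (factorizations w π a).Nonempty → l.sum = length (π⁻¹ * w) ∧
      codeWeight (π⁻¹ * w) ≤ weight l ∧
      (codeWeight (π⁻¹ * w) = weight l → ∀ i, a i = columnCount (π⁻¹ * w) i) := by
  have hn0 : 0 < n := by omega
  induction l with
  | nil =>
    intro w a ha hne
    rw [factorizations_zero hn0 _ _ _ (by simpa using ha)] at hne
    split_ifs at hne with h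
    · subst h
      simp [length_one, codeWeight, codeEntry_one, weight, columnCount, ha]
    · exact absurd hne Set.not_nonempty_empty
  | cons c l ih =>
    intro w a ha ⟨f, hf⟩
    have ha0 : a 0 = c := by simpa using ha 0
    obtain ⟨P, hP, hlP, _, hf'⟩ := exists_of_mem_factorizations hn hf
    rw [mem_properSubsets] at hP
    obtain ⟨ih1, ih2, ih3⟩ := ih (w * cycElt P) (fun i => a (i + 1))
      (fun i => by simpa using ha (i + 1)) ⟨_, hf'⟩
    have h1 := length_of_mem_factorizations hn0 hf
    have h2 := length_of_mem_factorizations hn0 hf'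
    set y := π⁻¹ * w with hy
    have ez : π⁻¹ * (w * cycElt P) = y * cycElt P := by rw [hy, mul_assoc]
    rw [ez] at ih1 ih2 ih3 h2
    set z := y * cycElt P with hz
    have hyz : y = z * (cycElt P)⁻¹ := by rw [hz, mul_inv_cancel_right]
    have hlen : length y = length z + P.card := by omega
    have hcode := codeEntry_mul_inv_cycElt hn z P hP.1 (by rw [← hyz, hlen])
    rw [← hyz] at hcode
    have hstep : ∑ k ∈ Icc (1 : ℤ) n,
        (codeEntry z ((((cycElt P)⁻¹ : AffineSymmetricGroup n) : Equiv.Perm ℤ) k) + 1).choose 2 =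
          codeWeight z + length z := by
      rw [sum_code_comp z (cycElt P)⁻¹ fun m => (m + 1).choose 2, length_eq_inversionCount hn,
        codeWeight, inversionCount, ← Finset.sum_add_distrib]
      refine Finset.sum_congr rfl fun k _ => ?_
      rw [Nat.choose_succ_succ', Nat.choose_one_right, add_comm]
    have hle : ∀ k ∈ Icc (1 : ℤ) n, (codeEntry y k).choose 2 ≤
        (codeEntry z ((((cycElt P)⁻¹ : AffineSymmetricGroup n) : Equiv.Perm ℤ) k) + 1).choose 2 := by
      intro k _
      rw [hcode k]
      refine Nat.choose_le_choose 2 ?_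
      split_ifs <;> omega
    have hsum := Finset.sum_le_sum hle
    rw [hstep] at hsum
    have hw := weight_cons c l
    refine ⟨?_, ?_, fun heq => ?_⟩
    · rw [List.sum_cons, ih1, hlen, hP.2, ha0, add_comm]
    · rw [hw]
      unfold codeWeight at hsum ih2 ⊢
      omega
    · have heq1 : codeWeight z = weight l := by
        unfold codeWeight at hsum ih2 heq ⊢
        omega
      have heq2 : ∑ k ∈ Icc (1 : ℤ) n, (codeEntry y k).choose 2 = ∑ k ∈ Icc (1 : ℤ) n,
          (codeEntry z ((((cycElt P)⁻¹ : AffineSymmetricGroup n) : Equiv.Perm ℤ) k) + 1).choose 2 := by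
        rw [hstep]
        unfold codeWeight at hsum ih2 heq heq1 ⊢
        omega
      -- Equality now holds entrywise; outside P it reads (c choose 2) = (c + 1 choose 2), which
      -- forces c = 0.
      rw [Finset.sum_eq_sum_iff_of_le hle] at heq2
      have hcol := columnCount_of_codeEntry y z (cycElt P)⁻¹ P (fun k hk => by
        have h1 := hcode k
        by_cases hkP : (k : ZMod n) ∈ P
        · rw [if_pos hkP] at h1
          exact Or.inl ⟨hkP, h1⟩
        · rw [if_neg hkP, add_zero] at h1
          have h2 := heq2 k hk
          rw [h1, Nat.choose_succ_succ', Nat.choose_one_right] at h2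
          simp only [Nat.reduceAdd] at h2
          exact Or.inr ⟨hkP, by omega, by omega⟩)
      intro i
      cases i with
      | zero => rw [hcol.1, hP.2]
      | succ i => rw [hcol.2]; exact ih3 heq1 i

end AffineStanley
namespace AffineStanley
open Finset

/-! ### Shapes -/

theorem youngDiagram_ext_rowLen {μ ν : YoungDiagram} (h : ∀ i, μ.rowLen i = ν.rowLen i) :
    μ = ν := by
  ext ⟨i, j⟩
  rw [YoungDiagram.mem_cells, YoungDiagram.mem_cells, YoungDiagram.mem_iff_lt_rowLen,
    YoungDiagram.mem_iff_lt_rowLen, h]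

theorem colLen_ofRowLens (w : List ℕ) (hw : w.SortedGE) (i : ℕ) :
    (YoungDiagram.ofRowLens w hw).colLen i = (w.map fun c => if i < c then 1 else 0).sum := by
  rw [← Fin.sum_univ_fun_getElem, YoungDiagram.colLen_eq_card, ← Finset.card_filter]
  symm
  refine Finset.card_bij (fun j _ => ((j : ℕ), i)) ?_ ?_ ?_
  · intro j hj
    rw [YoungDiagram.mk_mem_col_iff, YoungDiagram.mem_ofRowLens]
    exact ⟨j.2, (Finset.mem_filter.1 hj).2⟩
  · intro j _ k _ h
    exact Fin.ext (Prod.ext_iff.1 h).1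
  · rintro ⟨j, i'⟩ h
    rw [YoungDiagram.mem_col_iff, YoungDiagram.mem_ofRowLens] at h
    obtain ⟨⟨h1, h2⟩, h3⟩ := h
    simp only at h1 h2 h3
    subst h3
    exact ⟨⟨j, h1⟩, Finset.mem_filter.2 ⟨Finset.mem_univ _, h2⟩, rfl⟩

theorem rowLen_shape {n : ℕ} (π : AffineSymmetricGroup n) (i : ℕ) :
    (shape π).rowLen i = columnCount π⁻¹ i := by
  rw [shape, YoungDiagram.rowLen_transpose, colLen_ofRowLens, columnCount, Finset.card_filter,
    ← Multiset.sum_coe, ← Multiset.map_coe, Multiset.sort_eq, code, Multiset.map_map]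
  rfl

theorem IsGrassmannian.codeEntry_le {n : ℕ} (hn : 0 < n) {π : AffineSymmetricGroup n}
    (h : IsGrassmannian π) {k m : ℤ} (hk : 1 ≤ k) (hkm : k ≤ m) (hm : m ≤ n) :
    codeEntry π⁻¹ k ≤ codeEntry π⁻¹ m := by
  induction m, hkm using Int.leInduction with
  | base => exact le_rfl
  | succ m hkm ih =>
    refine (ih (by omega)).trans (codeEntry_le_of_ascent hn _ _ ?_)
    exact h ⟨by omega, by omega⟩ ⟨by omega, hm⟩ (by omega)

theorem isGrassmannian_of_codeEntry_le {n : ℕ} (hn : 2 ≤ n) {π : AffineSymmetricGroup n}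
    (h : ∀ k : ℤ, 1 ≤ k → k + 1 ≤ n → codeEntry π⁻¹ k ≤ codeEntry π⁻¹ (k + 1)) :
    IsGrassmannian π := by
  intro a ha b hb hab
  have key : ∀ m : ℤ, a + 1 ≤ m → m ≤ n →
      ((π⁻¹ : AffineSymmetricGroup n) : Equiv.Perm ℤ) a <
        ((π⁻¹ : AffineSymmetricGroup n) : Equiv.Perm ℤ) m := by
    have step : ∀ k : ℤ, 1 ≤ k → k + 1 ≤ n → ((π⁻¹ : AffineSymmetricGroup n) : Equiv.Perm ℤ) k <
        ((π⁻¹ : AffineSymmetricGroup n) : Equiv.Perm ℤ) (k + 1) := fun k h1 h2 =>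
      (ascent_or_descent _ k).resolve_right fun h3 => by
        rw [descent_iff_codeEntry_lt hn] at h3
        have := h k h1 h2
        omega
    intro m hm
    induction m, hm using Int.leInduction with
    | base => exact step a ha.1
    | succ m hm ih => exact fun h1 => (ih (by omega)).trans (step m (by have := ha.1; omega) h1)
  exact key b (by omega) hb.2

/-- The code increases along the window, so its entries exceeding i form a final segment, determined
by its size. -/
theorem IsGrassmannian.lt_codeEntry_iff {n : ℕ} (hn : 0 < n) {π : AffineSymmetricGroup n}
    (h : IsGrassmannian π) {k : ℤ} (hk : 1 ≤ k) (hkn : k ≤ n) (i : ℕ) :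
    i < codeEntry π⁻¹ k ↔ (n : ℤ) + 1 - k ≤ columnCount π⁻¹ i := by
  constructor
  · intro h1
    have h2 : Icc k n ⊆ (Icc (1 : ℤ) n).filter fun k => i < codeEntry π⁻¹ k := by
      intro m hm
      rw [Finset.mem_Icc] at hm
      rw [Finset.mem_filter, Finset.mem_Icc]
      exact ⟨⟨by omega, hm.2⟩, h1.trans_le (h.codeEntry_le hn hk hm.1 hm.2)⟩
    have h3 := Finset.card_le_card h2
    rw [Int.card_Icc] at h3
    unfold columnCount
    omega
  · intro h1
    by_contra h2
    have h3 : ((Icc (1 : ℤ) n).filter fun k => i < codeEntry π⁻¹ k) ⊆ Icc (k + 1) n := by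
      intro m hm
      rw [Finset.mem_filter, Finset.mem_Icc] at hm
      rw [Finset.mem_Icc]
      refine ⟨?_, hm.1.2⟩
      by_contra h4
      have := h.codeEntry_le hn hm.1.1 (show m ≤ k by omega) hkn
      omega
    have h4 := Finset.card_le_card h3
    rw [Int.card_Icc] at h4
    unfold columnCount at h1
    omega

theorem IsGrassmannian.eq_of_shape_eq {n : ℕ} (hn : 2 ≤ n) {π σ : AffineSymmetricGroup n}
    (hπ : IsGrassmannian π) (hσ : IsGrassmannian σ) (h : shape π = shape σ) : π = σ := by
  have hn0 : 0 < n := by omega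
  apply inv_injective
  apply eq_of_codeEntry_eq hn
  intro k
  obtain ⟨r, hr, c, rfl⟩ := exists_mem_window hn0 k
  rw [codeEntry_add_mul, codeEntry_add_mul]
  rw [Finset.mem_Icc] at hr
  refine eq_of_forall_lt_iff fun i => ?_
  rw [hπ.lt_codeEntry_iff hn0 hr.1 hr.2, hσ.lt_codeEntry_iff hn0 hr.1 hr.2, ← rowLen_shape,
    ← rowLen_shape, h]

theorem rowLen_lt_of_mem_par {n : ℕ} (hn : 0 < n) {μ : YoungDiagram} (hμ : μ ∈ Par n) (i : ℕ) :
    μ.rowLen i < n := by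
  by_cases h : i < μ.colLen 0
  · exact hμ _ (List.mem_map.2 ⟨i, List.mem_range.2 h, rfl⟩)
  · rw [← YoungDiagram.mem_iff_lt_colLen, YoungDiagram.mem_iff_lt_rowLen] at h
    omega

theorem exists_isGrassmannian {n : ℕ} (hn : 2 ≤ n) {μ : YoungDiagram} (hμ : μ ∈ Par n) :
    ∃ π : AffineSymmetricGroup n, IsGrassmannian π ∧ shape π = μ := by
  have hn0 : (0 : ℤ) < n := by omega
  have hrow := rowLen_lt_of_mem_par (by omega) hμ
  -- Column j is placed at position n - j, so the columns increase along the window; the residue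
  -- makes c periodic.
  set c : ℤ → ℕ := fun k => μ.colLen ((-k) % n).toNat with hc
  have hcval : ∀ j : ℕ, j < n → c (n - j) = μ.colLen j := by
    intro j hj
    have e : (-((n : ℤ) - j)) % n = j := by
      rw [show -((n : ℤ) - j) = j - n by ring, Int.sub_emod_right, Int.emod_eq_of_lt (by omega)
        (by omega)]
    rw [hc]
    simp only [e, Int.toNat_natCast]
  obtain ⟨y, hy⟩ := exists_codeEntry_eq hn c (fun k => by
      simp only [hc]
      rw [show -(k + (n : ℤ)) = -k - n by ring, Int.sub_emod_right])
    -- Parts less than n leave column n - 1 empty, which supplies the zero every code must have.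
    ⟨n - ((n - 1 : ℕ) : ℤ), by
      rw [hcval _ (by omega)]
      by_contra h
      have h1 := YoungDiagram.mem_iff_lt_colLen.2 (Nat.pos_of_ne_zero h)
      rw [YoungDiagram.mem_iff_lt_rowLen] at h1
      have := hrow 0
      omega⟩
  refine ⟨y⁻¹, isGrassmannian_of_codeEntry_le hn fun k h1 h2 => ?_,
    youngDiagram_ext_rowLen fun i => ?_⟩
  · rw [inv_inv, hy, hy]
    have e1 := hcval (n - k).toNat (by omega)
    have e2 := hcval (n - (k + 1)).toNat (by omega)
    rw [Int.toNat_of_nonneg (by omega), sub_sub_cancel] at e1 e2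
    rw [e1, e2]
    exact μ.colLen_anti _ _ (by omega)
  · rw [rowLen_shape, inv_inv, columnCount, ← Finset.card_range (μ.rowLen i)]
    symm
    refine Finset.card_bij (fun j _ => (n : ℤ) - j) ?_ ?_ ?_
    · intro j hj
      rw [Finset.mem_range] at hj
      have hjn := hj.trans (hrow i)
      rw [Finset.mem_filter, Finset.mem_Icc, hy, hcval j hjn]
      exact ⟨by omega, YoungDiagram.mem_iff_lt_colLen.1 (YoungDiagram.mem_iff_lt_rowLen.2 hj)⟩
    · intro j _ k _ h
      omega
    · intro k hk
      rw [Finset.mem_filter, Finset.mem_Icc, hy] at hk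
      obtain ⟨hk1, hk2⟩ := hk
      have e1 := hcval (n - k).toNat (by omega)
      rw [Int.toNat_of_nonneg (by omega), sub_sub_cancel] at e1
      rw [e1, ← YoungDiagram.mem_iff_lt_colLen, YoungDiagram.mem_iff_lt_rowLen] at hk2
      exact ⟨(n - k).toNat, Finset.mem_range.2 hk2, by omega⟩

theorem grassmannian_spec {n : ℕ} (hn : 2 ≤ n) {μ : YoungDiagram} (hμ : μ ∈ Par n) :
    IsGrassmannian (grassmannian n μ) ∧ shape (grassmannian n μ) = μ :=
  Classical.epsilon_spec (p := fun π : AffineSymmetricGroup n => IsGrassmannian π ∧ shape π = μ)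
    (exists_isGrassmannian hn hμ)

theorem IsGrassmannian.star {n : ℕ} {π : AffineSymmetricGroup n} (h : IsGrassmannian π) :
    IsGrassmannian (star n π) := by
  intro a ha b hb hab
  rw [← map_inv, star_apply, star_apply]
  -- The flip k ↦ 1 - k moves the window to [1 - n, 0]; translation by n brings it back, reversed.
  have h1 := h (a := n + 1 - b) ⟨by have := hb.2; omega, by have := hb.1; omega⟩
    (b := n + 1 - a) ⟨by have := ha.2; omega, by have := ha.1; omega⟩ (by omega)
  rw [show (n : ℤ) + 1 - b = 1 - b + n by ring, show (n : ℤ) + 1 - a = 1 - a + n by ring,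
    affine_add, affine_add] at h1
  omega

/-- The star of a Grassmannian element is itself a Grassmannian element of the required shape, so
uniqueness identifies it with the chosen one. -/
theorem affineSchur_starPartition {n : ℕ} (hn : 2 ≤ n) {μ : YoungDiagram} (hμ : μ ∈ Par n) :
    affineSchur n (starPartition n μ) = stanley (star n (grassmannian n μ)) := by
  have h1 := (grassmannian_spec hn hμ).1.star
  have h2 := Classical.epsilon_spec (p := fun π : AffineSymmetricGroup n =>
    IsGrassmannian π ∧ shape π = starPartition n μ) ⟨_, h1, rfl⟩
  exact congrArg stanley (h2.1.eq_of_shape_eq hn h1 h2.2)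

/-! ### Symmetric functions -/

/-- The exponent vector of a partition. -/
noncomputable def exponents (μ : YoungDiagram) : ℕ →₀ ℕ :=
  Finsupp.onFinset (range (μ.colLen 0)) μ.rowLen fun i hi => by
    rw [Finset.mem_range, ← YoungDiagram.mem_iff_lt_colLen, YoungDiagram.mem_iff_lt_rowLen]
    exact Nat.pos_of_ne_zero hi

theorem exponents_apply (μ : YoungDiagram) (i : ℕ) : exponents μ i = μ.rowLen i := rfl

theorem exponents_support (μ : YoungDiagram) : (exponents μ).support = range (μ.colLen 0) := by
  ext i
  rw [Finsupp.mem_support_iff, exponents_apply, Finset.mem_range, ← YoungDiagram.mem_iff_lt_colLen,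
    YoungDiagram.mem_iff_lt_rowLen, Nat.pos_iff_ne_zero]

theorem exponents_map (μ : YoungDiagram) :
    (exponents μ).support.val.map (exponents μ) = (μ.rowLens : Multiset ℕ) := by
  rw [exponents_support]
  rfl

theorem exponents_getD (μ : YoungDiagram) (i : ℕ) : exponents μ i = μ.rowLens.getD i 0 := by
  by_cases h : i < μ.colLen 0
  · rw [List.getD_eq_getElem _ _ (by rwa [YoungDiagram.length_rowLens]), YoungDiagram.get_rowLens]
    rfl
  · rw [List.getD_eq_default _ _ (by rw [YoungDiagram.length_rowLens]; omega), exponents_apply]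
    rw [← YoungDiagram.mem_iff_lt_colLen, YoungDiagram.mem_iff_lt_rowLen] at h
    omega

theorem eq_of_rowLens_coe_eq {μ ν : YoungDiagram}
    (h : (μ.rowLens : Multiset ℕ) = (ν.rowLens : Multiset ℕ)) : μ = ν := by
  have h1 : μ.rowLens = ν.rowLens :=
    (Multiset.coe_eq_coe.1 h).eq_of_pairwise' μ.rowLens_sorted.pairwise ν.rowLens_sorted.pairwise
  refine youngDiagram_ext_rowLen fun i => ?_
  rw [← exponents_apply, ← exponents_apply, exponents_getD, exponents_getD, h1]

theorem finite_par_degree (n d : ℕ) : {μ ∈ Par n | μ.rowLens.sum = d}.Finite := by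
  refine Set.Finite.of_injOn (f := fun μ => (μ.rowLens : Multiset ℕ))
    (t := Set.range fun p : Nat.Partition d => p.parts) ?_ ?_ (Set.finite_range _)
  · rintro μ ⟨_, hμ⟩
    exact ⟨⟨(μ.rowLens : Multiset ℕ), fun {i} hi => μ.pos_of_mem_rowLens i hi, by simpa using hμ⟩,
      rfl⟩
  · intro μ _ ν _ h
    exact eq_of_rowLens_coe_eq h

/-- The partitions of `d` with all parts less than `n`. -/
noncomputable def parDegree (n d : ℕ) : Finset YoungDiagram := (finite_par_degree n d).toFinset

theorem mem_parDegree {n d : ℕ} {μ : YoungDiagram} :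
    μ ∈ parDegree n d ↔ μ ∈ Par n ∧ μ.rowLens.sum = d := by
  simp [parDegree]

/-- A homogeneous symmetric power series with exponents less than `n` is a combination of monomial
symmetric functions. -/
theorem eq_sum_monomialSymm {n d : ℕ} (g : MvPowerSeries ℕ ℚ)
    (hsym : ∀ α β : ℕ →₀ ℕ, α.support.val.map α = β.support.val.map β → g α = g β)
    (hdeg : ∀ α : ℕ →₀ ℕ, g α ≠ 0 → (α.support.val.map α).sum = d)
    (hlt : ∀ α : ℕ →₀ ℕ, g α ≠ 0 → ∀ i, α i < n) :
    g = ∑ μ ∈ parDegree n d, g (exponents μ) • monomialSymm μ := by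
  funext α
  have e : (∑ μ ∈ parDegree n d, g (exponents μ) • monomialSymm μ) α =
      ∑ μ ∈ parDegree n d, g (exponents μ) *
        (if α.support.val.map α = (μ.rowLens : Multiset ℕ) then 1 else 0) :=
    Finset.sum_apply α (parDegree n d) fun μ => g (exponents μ) • monomialSymm μ
  rw [e]
  have hmatch : ∀ μ : YoungDiagram, α.support.val.map α = (μ.rowLens : Multiset ℕ) →
      g (exponents μ) = g α := fun μ h => hsym _ _ (by rw [exponents_map, h])
  by_cases hg : g α = 0
  · rw [hg]
    symm
    refine Finset.sum_eq_zero fun μ _ => ?_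
    split_ifs with h
    · rw [hmatch μ h, hg, zero_mul]
    · rw [mul_zero]
  · set M := α.support.val.map α with hM
    have hpos : ∀ x ∈ M.sort (· ≥ ·), 0 < x := by
      intro x hx
      rw [Multiset.mem_sort, hM, Multiset.mem_map] at hx
      obtain ⟨i, hi, rfl⟩ := hx
      exact Nat.pos_of_ne_zero (Finsupp.mem_support_iff.1 hi)
    set μ := YoungDiagram.ofRowLens (M.sort (· ≥ ·))
      (Multiset.pairwise_sort M (· ≥ ·)).sortedGE with hμ
    have hrow : (μ.rowLens : Multiset ℕ) = M := by
      rw [hμ, YoungDiagram.rowLens_ofRowLens_eq_self hpos, Multiset.sort_eq]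
    have hmem : μ ∈ parDegree n d := by
      rw [mem_parDegree]
      constructor
      · intro p hp
        rw [← Multiset.mem_coe, hrow, hM, Multiset.mem_map] at hp
        obtain ⟨i, _, rfl⟩ := hp
        exact hlt α hg i
      · rw [← Multiset.sum_coe, hrow]
        exact hdeg α hg
    rw [Finset.sum_eq_single_of_mem μ hmem, if_pos hrow.symm, mul_one, hmatch μ hrow.symm]
    intro ν _ hν
    rw [if_neg, mul_zero]
    intro h
    exact hν (eq_of_rowLens_coe_eq (by rw [hrow, h]))

theorem stanley_eq_sum {n : ℕ} (hn : 2 ≤ n) (π : AffineSymmetricGroup n) :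
    stanley π = ∑ μ ∈ parDegree n (length π), stanley π (exponents μ) • monomialSymm μ := by
  have : NeZero n := ⟨by omega⟩
  exact eq_sum_monomialSymm _ (fun _ _ h => stanley_symmetric hn π h)
    (fun _ h => degree_of_stanley_ne_zero h) (fun _ h => exponent_lt_of_stanley_ne_zero hn h)

theorem stanley_mem_symN {n : ℕ} (hn : 2 ≤ n) (π : AffineSymmetricGroup n) :
    stanley π ∈ SymN n := by
  rw [stanley_eq_sum hn π]
  exact Submodule.sum_mem _ fun μ hμ => Submodule.smul_mem _ _
    (Submodule.subset_span ⟨μ, (mem_parDegree.1 hμ).1, rfl⟩)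

/-- Count each i below an entry c of the code with weight i: summing over the i below c first gives
c choose 2, summing over entries first gives i times a part of the shape. -/
theorem codeWeight_eq_weight {n : ℕ} (π : AffineSymmetricGroup n) :
    codeWeight π⁻¹ = weight (shape π).rowLens := by
  have h1 : ∀ i, (shape π).rowLens.getD i 0 = columnCount π⁻¹ i := fun i => by
    rw [← exponents_getD, exponents_apply, rowLen_shape]
  have h2 : ∀ k ∈ Icc (1 : ℤ) n, codeEntry π⁻¹ k ≤ (shape π).rowLens.length := by
    intro k hk
    by_contra h
    have h3 := h1 (shape π).rowLens.length
    rw [List.getD_eq_default _ _ le_rfl, eq_comm, columnCount, Finset.card_eq_zero] at h3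
    exact Finset.notMem_empty k (h3 ▸ Finset.mem_filter.2 ⟨hk, by omega⟩)
  unfold weight codeWeight
  simp only [h1, columnCount, Finset.card_filter, Finset.mul_sum]
  rw [Finset.sum_comm]
  refine Finset.sum_congr rfl fun k hk => ?_
  simp only [mul_ite, mul_one, mul_zero]
  rw [← Finset.sum_filter, show (range (shape π).rowLens.length).filter
    (fun i => i < codeEntry π⁻¹ k) = range (codeEntry π⁻¹ k) by
      ext i
      have := h2 k hk
      simp only [Finset.mem_filter, Finset.mem_range]
      omega, Finset.sum_range_id, Nat.choose_two_right]

theorem stanley_shape_ne_zero {n : ℕ} (hn : 2 ≤ n) (π : AffineSymmetricGroup n) :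
    stanley π (exponents (shape π)) ≠ 0 := by
  have : NeZero n := ⟨by omega⟩
  apply stanley_ne_zero hn
  have h := factorizations_columnCount_nonempty hn 1 π (by rw [one_mul, length_one, zero_add])
  rw [one_mul] at h
  convert h using 1
  congr 1
  funext i
  rw [exponents_apply, rowLen_shape]

theorem weight_lt_of_stanley_ne_zero {n : ℕ} (hn : 2 ≤ n) (π : AffineSymmetricGroup n)
    {ν : YoungDiagram} (h : stanley π (exponents ν) ≠ 0) (hν : ν ≠ shape π) :
    weight (shape π).rowLens < weight ν.rowLens := by
  have : NeZero n := ⟨by omega⟩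
  obtain ⟨_, h2, h3⟩ := codeWeight_le_weight hn π ν.rowLens 1 (exponents ν) (exponents_getD ν)
    (exists_factorization_of_stanley_ne_zero h)
  rw [mul_one, codeWeight_eq_weight] at h2 h3
  refine lt_of_le_of_ne h2 fun heq => hν (youngDiagram_ext_rowLen fun i => ?_)
  rw [← exponents_apply, h3 heq i, rowLen_shape]

/-- Inverts the triangular system by induction from the largest weight downwards: F_μ is a nonzero
multiple of m_μ plus monomial functions of strictly larger weight and the same degree. -/
theorem monomialSymm_mem_span {n : ℕ} (hn : 2 ≤ n) {μ : YoungDiagram} (hμ : μ ∈ Par n) :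
    monomialSymm μ ∈ Submodule.span ℚ (affineSchur n '' Par n) := by
  classical
  set d := μ.rowLens.sum with hd
  -- Any upper bound for the weights in degree d would do; the sum over the finite set is one.
  set B := ∑ ν ∈ parDegree n d, weight ν.rowLens with hB
  have hbound : ∀ ν ∈ parDegree n d, weight ν.rowLens ≤ B := fun ν hν =>
    Finset.single_le_sum (f := fun ν : YoungDiagram => weight ν.rowLens)
      (fun _ _ => Nat.zero_le _) hν
  have hmem : μ ∈ parDegree n d := mem_parDegree.2 ⟨hμ, hd.symm⟩
  clear_value d B
  clear hd hB hμ
  induction hm : B - weight μ.rowLens using Nat.strong_induction_on generalizing μ with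
  | _ m ih =>
  have hμ := (mem_parDegree.1 hmem).1
  obtain ⟨_, hshape⟩ := grassmannian_spec hn hμ
  set π := grassmannian n μ with hπ
  have hne := stanley_shape_ne_zero hn π
  rw [hshape] at hne
  have hlen : length π = d := by
    rw [← degree_of_stanley_ne_zero hne, exponents_map, Multiset.sum_coe]
    exact (mem_parDegree.1 hmem).2
  have hsum := stanley_eq_sum hn π
  rw [hlen, ← Finset.add_sum_erase _ _ hmem] at hsum
  have hF : stanley π ∈ Submodule.span ℚ (affineSchur n '' Par n) :=
    Submodule.subset_span ⟨μ, hμ, rfl⟩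
  have hrest : ∑ ν ∈ (parDegree n d).erase μ, stanley π (exponents ν) • monomialSymm ν ∈
      Submodule.span ℚ (affineSchur n '' Par n) := by
    refine Submodule.sum_mem _ fun ν hν => ?_
    by_cases h0 : stanley π (exponents ν) = 0
    · rw [h0, zero_smul]
      exact Submodule.zero_mem _
    · have hν' := Finset.mem_of_mem_erase hν
      have hlt := weight_lt_of_stanley_ne_zero hn π h0
        (by rw [hshape]; exact Finset.ne_of_mem_erase hν)
      rw [hshape] at hlt
      have hb := hbound ν hν'
      exact Submodule.smul_mem _ _ (ih _ (by omega) hν' rfl)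
  have hsmul : stanley π (exponents μ) • monomialSymm μ ∈
      Submodule.span ℚ (affineSchur n '' Par n) := by
    have e := eq_sub_of_add_eq hsum.symm
    rw [e]
    exact Submodule.sub_mem _ hF hrest
  exact (Submodule.smul_mem_iff _ hne).1 hsmul

theorem symN_eq_span {n : ℕ} (hn : 2 ≤ n) :
    SymN n = Submodule.span ℚ (affineSchur n '' Par n) := by
  refine le_antisymm (Submodule.span_le.2 ?_) (Submodule.span_le.2 ?_)
  · rintro _ ⟨μ, hμ, rfl⟩
    exact monomialSymm_mem_span hn hμ
  · rintro _ ⟨μ, _, rfl⟩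
    exact stanley_mem_symN hn _

/-! ### The involution -/

theorem involutionStanley_mem {n : ℕ} (S : Submodule ℚ (MvPowerSeries ℕ ℚ))
    (hS : ∀ π : AffineSymmetricGroup n, stanley π ∈ S) (z : AffineSymmetricGroup n) :
    involutionStanley z ∈ S :=
  finsum_mem_induction (· ∈ S) S.zero_mem (fun _ _ => S.add_mem) fun π _ => hS π

theorem exists_omegaPlus {n : ℕ} (hn : 2 ≤ n) :
    ∃ ω : SymN n →ₗ[ℚ] SymN n, IsOmegaPlus n ω ∧ ∀ z : AffineSymmetricGroup n,
      ∃ h : involutionStanley z ∈ SymN n,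
        involutionStanley (star n z) = (ω ⟨involutionStanley z, h⟩ : MvPowerSeries ℕ ℚ) := by
  have : NeZero n := ⟨by omega⟩
  obtain ⟨Ω, hΩ⟩ := exists_duality hn
  have hmaps : ∀ x ∈ SymN n, Ω x ∈ SymN n := by
    intro x hx
    rw [symN_eq_span hn] at hx
    induction hx using Submodule.span_induction with
    | mem x h =>
      obtain ⟨μ, _, rfl⟩ := h
      rw [affineSchur, hΩ]
      exact stanley_mem_symN hn _
    | zero => rw [map_zero]; exact Submodule.zero_mem _
    | add x y _ _ hx hy => rw [map_add]; exact Submodule.add_mem _ hx hy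
    | smul c x _ hx => rw [map_smul]; exact Submodule.smul_mem _ _ hx
  have hinv : ∀ x ∈ SymN n, Ω (Ω x) = x := by
    intro x hx
    rw [symN_eq_span hn] at hx
    induction hx using Submodule.span_induction with
    | mem x h =>
      obtain ⟨μ, _, rfl⟩ := h
      rw [affineSchur, hΩ, hΩ, star_star]
    | zero => rw [map_zero, map_zero]
    | add x y _ _ hx hy => rw [map_add, map_add, hx, hy]
    | smul c x _ hx => rw [map_smul, map_smul, hx]
  refine ⟨Ω.restrict hmaps, ⟨fun x => Subtype.ext (hinv x x.2), fun μ hμ =>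
    ⟨stanley_mem_symN hn _, ?_⟩⟩, fun z => ⟨involutionStanley_mem _ (stanley_mem_symN hn) z, ?_⟩⟩
  · rw [affineSchur_starPartition hn hμ, ← hΩ]
    rfl
  · rw [(isDiagramAutomorphism_star n).involutionStanley_map hn]
    simp only [← hΩ]
    exact (Ω.toAddMonoidHom.map_finsum_mem (fun π => stanley π) (atoms_finite (by omega) z)).symm

/-- Two linear maps agreeing on a spanning set. The spanning property is a hypothesis so that n = 1
is covered as well. -/
theorem omegaPlus_unique {n : ℕ} (hspan : SymN n ≤ Submodule.span ℚ (affineSchur n '' Par n))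
    {ω ω' : SymN n →ₗ[ℚ] SymN n} (h : IsOmegaPlus n ω) (h' : IsOmegaPlus n ω') : ω' = ω := by
  have key : ∀ x (_ : x ∈ Submodule.span ℚ (affineSchur n '' Par n)) (hx : x ∈ SymN n),
      ω' ⟨x, hx⟩ = ω ⟨x, hx⟩ := by
    have hmem : ∀ x ∈ Submodule.span ℚ (affineSchur n '' Par n), x ∈ SymN n := by
      intro x hx
      refine Submodule.span_le.2 ?_ hx
      rintro _ ⟨μ, hμ, rfl⟩
      exact (h.2 μ hμ).1
    intro x hx
    induction hx using Submodule.span_induction with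
    | mem x hx =>
      obtain ⟨μ, hμ, rfl⟩ := hx
      intro hx
      obtain ⟨_, e⟩ := h.2 μ hμ
      obtain ⟨_, e'⟩ := h'.2 μ hμ
      exact Subtype.ext (e'.trans e.symm)
    | zero =>
      intro hx
      have e : (⟨0, hx⟩ : SymN n) = 0 := rfl
      rw [e, map_zero, map_zero]
    | add x y hx' hy' hx hy =>
      intro hxy
      have e : (⟨x + y, hxy⟩ : SymN n) = ⟨x, hmem x hx'⟩ + ⟨y, hmem y hy'⟩ := rfl
      rw [e, map_add, map_add, hx, hy]
    | smul c x hx' hx =>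
      intro hcx
      have e : (⟨c • x, hcx⟩ : SymN n) = c • ⟨x, hmem x hx'⟩ := rfl
      rw [e, map_smul, map_smul, hx]
  exact LinearMap.ext fun x => key x (hspan x.2) x.2

/-! ### The trivial case `n = 1` -/

theorem eq_one_of_affine_one (π : AffineSymmetricGroup 1) : π = 1 := by
  obtain ⟨l, rfl⟩ := exists_word one_pos π
  induction l with
  | nil => rfl
  | cons i l ih => rw [wordProd_cons, ih]; simp [simpleRefl]

theorem eq_bot_of_mem_par_one {μ : YoungDiagram} (hμ : μ ∈ Par 1) : μ = ⊥ := by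
  refine youngDiagram_ext_rowLen fun i => ?_
  have h1 := rowLen_lt_of_mem_par one_pos hμ i
  have h2 : ¬ 0 < (⊥ : YoungDiagram).rowLen i := by
    rw [← YoungDiagram.mem_iff_lt_rowLen]
    exact YoungDiagram.notMem_bot _
  omega

theorem bot_mem_par (n : ℕ) : (⊥ : YoungDiagram) ∈ Par n := by
  intro p hp
  obtain ⟨i, hi, _⟩ := List.mem_map.1 hp
  rw [List.mem_range, ← YoungDiagram.mem_iff_lt_colLen] at hi
  exact absurd hi (YoungDiagram.notMem_bot _)

theorem stanley_one_one : stanley (1 : AffineSymmetricGroup 1) = monomialSymm ⊥ := by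
  have hlen : ∀ π : AffineSymmetricGroup 1, length π = 0 := fun π => by
    rw [eq_one_of_affine_one π, length_one]
  have hrow : (⊥ : YoungDiagram).rowLens = [] := by
    rw [List.eq_nil_iff_forall_not_mem]
    intro p hp
    have h1 := bot_mem_par 1 p hp
    have h2 := YoungDiagram.pos_of_mem_rowLens _ p hp
    omega
  funext α
  rw [stanley_eq_ncard_factorizations, monomialSymm, hrow]
  by_cases h : ∀ i, α i = 0
  · obtain rfl : α = 0 := Finsupp.ext h
    rw [factorizations_zero one_pos _ _ _ h]
    simp
  · rw [if_neg]
    · have : factorizations (1 : AffineSymmetricGroup 1) 1 α = ∅ := by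
        rw [Set.eq_empty_iff_forall_notMem]
        exact fun f hf => h fun i => by rw [← (hf.1 i).2, hlen]
      rw [this]
      simp
    · intro h'
      apply h
      have h2 : α.support = ∅ := by
        rw [← Finset.val_eq_zero]
        simpa using h'
      intro i
      rw [← Finsupp.notMem_support_iff, h2]
      exact Finset.notMem_empty _

theorem affineSchur_one (μ : YoungDiagram) : affineSchur 1 μ = monomialSymm ⊥ := by
  rw [affineSchur, eq_one_of_affine_one (grassmannian 1 μ), stanley_one_one]

end AffineStanley

theorem mainTheorem9 (n : ℕ) (hn : 0 < n) :
    (∀ z ∈ AffineStanley.affineInvolutions n,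
      AffineStanley.involutionStanley (AffineStanley.rotate n z)
        = AffineStanley.involutionStanley z) ∧
    ∃ ω : AffineStanley.SymN n →ₗ[ℚ] AffineStanley.SymN n,
      AffineStanley.IsOmegaPlus n ω ∧
      (∀ ω' : AffineStanley.SymN n →ₗ[ℚ] AffineStanley.SymN n,
        AffineStanley.IsOmegaPlus n ω' → ω' = ω) ∧
      ∀ z ∈ AffineStanley.affineInvolutions n,
        ∃ h : AffineStanley.involutionStanley z ∈ AffineStanley.SymN n,
          AffineStanley.involutionStanley (AffineStanley.star n z)
            = (ω ⟨AffineStanley.involutionStanley z, h⟩ : MvPowerSeries ℕ ℚ) := by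
  rcases Nat.lt_or_ge n 2 with h | h
  -- The group is trivial and Sym^{(1)} is the line through m_∅, so the identity map serves as ω⁺.
  · obtain rfl : n = 1 := by omega
    have hbot : AffineStanley.monomialSymm ⊥ ∈ AffineStanley.SymN 1 :=
      Submodule.subset_span ⟨⊥, AffineStanley.bot_mem_par 1, rfl⟩
    have hω : AffineStanley.IsOmegaPlus 1 LinearMap.id := by
      refine ⟨fun _ => rfl, fun μ _ => ⟨by rwa [AffineStanley.affineSchur_one], ?_⟩⟩
      exact (AffineStanley.affineSchur_one μ).trans (AffineStanley.affineSchur_one _).symm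
    refine ⟨fun z _ => ?_, LinearMap.id, hω, fun ω' hω' =>
      AffineStanley.omegaPlus_unique ?_ hω hω', fun z _ =>
      ⟨AffineStanley.involutionStanley_mem _ (fun π => ?_) z, ?_⟩⟩
    · rw [AffineStanley.eq_one_of_affine_one z, map_one]
    · refine Submodule.span_mono ?_
      rintro _ ⟨μ, hμ, rfl⟩
      rw [AffineStanley.eq_bot_of_mem_par_one hμ]
      exact ⟨⊥, AffineStanley.bot_mem_par 1, AffineStanley.affineSchur_one ⊥⟩
    · rwa [AffineStanley.eq_one_of_affine_one π, AffineStanley.stanley_one_one]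
    · rw [AffineStanley.eq_one_of_affine_one z, map_one]
      rfl
  · obtain ⟨ω, hω, hz⟩ := AffineStanley.exists_omegaPlus h
    exact ⟨fun z _ => AffineStanley.involutionStanley_rotate h z, ω, hω, fun ω' hω' =>
      AffineStanley.omegaPlus_unique (AffineStanley.symN_eq_span h).le hω hω', fun z _ => hz z⟩
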